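/- For the class $T\in PSL(2,\mathbb R)$ of a matrix $\begin{pmatrix} a&b\\ c&d\end{pmatrix}$ put $\mathrm{tr}(T)=|a+d|$; $T$ is parabolic if $T\ne 1$ and $\mathrm{tr}(T)=2$, and elliptic if $\mathrm{tr}(T)<2$. A Fuchsian group is a discrete subgroup of $PSL(2,\mathbb R)$; it acts on the hyperbolic plane $\mathbb H$ by fractional linear transformations. A Y-piece $Y(u,v,w)$, with $u,v,w\ge 0$, is a hyperbolic surface whose interior is homeomorphic to a sphere with three points removed and whose three boundary components are simple closed geodesics of lengths $u,v,w$, where a boundary geodesic of length $0$ means a cusp. For a length $u\ge 0$ put $\mathrm{tr}(u)=2\cosh(u/2)$. In a degenerate Y-piece $Y(u,v,w)$ the boundary geodesic $u$ is replaced by an elliptic fixed point, which is also denoted by $u$ and which is one of the three removed points; then $\mathrm{tr}(u)$ is the trace of an elliptic element that generates the stabilizer of this fixed point. A quotient $G\backslash\mathbb H$ contains $Y(u,v,w)$ if it has a subset that is such a surface, with pairwise disjoint boundary components and with no elliptic fixed point of $G$ in its interior. Corollary. Let $\Gamma$ be a Fuchsian group containing at least one parabolic element. Then for every non-trivial, non-parabolic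 element $T_u\in\Gamma$ there exist $T_v\in\Gamma$ and a length $v\ge 0$ with $\mathrm{tr}(v)=\mathrm{tr}(T_v)$ such that $\langle T_u,T_v\rangle\backslash\mathbb H$ contains a Y-piece $Y(u,v,0)$ with $\mathrm{tr}(u)=\mathrm{tr}(T_u)$. Here the Y-piece is degenerate, with $u$ an elliptic fixed point, if and only if $T_u$ is elliptic. -/

import Mathlib

open scoped MatrixGroups NNReal UpperHalfPlane

namespace FuchsianY

/-- `PSL(2, ℝ)`, the quotient of `SL(2, ℝ)` by its center `{1, -1}`. -/
abbrev PSL2R : Type := Matrix.ProjectiveSpecialLinearGroup (Fin 2) ℝ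

theorem eq_one_or_neg_one_of_mem_center (g : SL(2, ℝ)) (hg : g ∈ Subgroup.center SL(2, ℝ)) :
    g = 1 ∨ g = -1 := by
  obtain ⟨r, hr, hs⟩ := Matrix.SpecialLinearGroup.mem_center_iff.1 hg
  have hr' : r = 1 ∨ r = -1 := by simpa using hr
  rcases hr' with rfl | rfl
  · left
    ext i j
    rw [← hs]
    simp
  · right
    ext i j
    rw [← hs]
    fin_cases i <;> fin_cases j <;> simp

theorem center_smul (g : SL(2, ℝ)) (hg : g ∈ Subgroup.center SL(2, ℝ)) (z : ℍ) :
    g • z = z := by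
  rcases eq_one_or_neg_one_of_mem_center g hg with rfl | rfl
  · simp
  · ext
    rw [UpperHalfPlane.coe_specialLinearGroup_apply]
    simp

/-- The homomorphism from `PSL(2, ℝ)` to the bijections of the upper half-plane that is induced by
the action of `SL(2, ℝ)` by fractional linear transformations. -/
noncomputable def actionHom : PSL2R →* Equiv.Perm ℍ :=
  QuotientGroup.lift (Subgroup.center SL(2, ℝ)) (MulAction.toPermHom SL(2, ℝ) ℍ)
    (fun g hg => Equiv.ext (fun z => center_smul g hg z))

/-- `PSL(2, ℝ)` acts on the upper half-plane by fractional linear transformations. -/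
noncomputable instance : MulAction PSL2R ℍ := MulAction.compHom ℍ actionHom

theorem mk_smul (g : SL(2, ℝ)) (z : ℍ) : ((g : PSL2R)) • z = g • z := rfl

theorem abs_trace_eq (g h : SL(2, ℝ)) (hgh : g⁻¹ * h ∈ Subgroup.center SL(2, ℝ)) :
    |(g : Matrix (Fin 2) (Fin 2) ℝ).trace| = |(h : Matrix (Fin 2) (Fin 2) ℝ).trace| := by
  rcases eq_one_or_neg_one_of_mem_center _ hgh with h1 | h1
  · rw [inv_mul_eq_one.1 h1]
  · have h2 : h = -g := by rw [inv_mul_eq_iff_eq_mul] at h1; simpa using h1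
    rw [h2, Matrix.SpecialLinearGroup.coe_neg, Matrix.trace_neg, abs_neg]

/-- The trace `tr T = |a + d|` of the class `T` of a matrix with diagonal entries `a`, `d`. -/
noncomputable def tr (T : PSL2R) : ℝ :=
  Quotient.liftOn' T (fun g : SL(2, ℝ) => |(g : Matrix (Fin 2) (Fin 2) ℝ).trace|)
    (fun g h hgh => abs_trace_eq g h (QuotientGroup.leftRel_apply.1 hgh))

theorem tr_mk (g : SL(2, ℝ)) : tr (g : PSL2R) = |g 0 0 + g 1 1| := by
  change |(g : Matrix (Fin 2) (Fin 2) ℝ).trace| = _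
  rw [Matrix.trace_fin_two]

/-- Parabolic elements: nontrivial with trace `2`. -/
def IsParabolic (T : PSL2R) : Prop := T ≠ 1 ∧ tr T = 2

/-- Elliptic elements: trace less than `2`. -/
def IsElliptic (T : PSL2R) : Prop := tr T < 2

/-- A Fuchsian group: a discrete subgroup of `PSL(2, ℝ)` (with its quotient topology). -/
def IsFuchsian (Γ : Subgroup PSL2R) : Prop := DiscreteTopology Γ

/-- The displacement `d(z, T z)` of a point of the hyperbolic plane. -/
noncomputable def displacement (T : PSL2R) (z : ℍ) : ℝ := dist z (T • z)

/-- The set of points of minimal displacement: the axis of a hyperbolic element, the fixed point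
of an elliptic element, and the empty set for a parabolic element. -/
def core (T : PSL2R) : Set ℍ := {z | ∀ w : ℍ, displacement T z ≤ displacement T w}

/-- The points of displacement less than `δ`: an open tubular neighbourhood of the axis of a
hyperbolic element, an open disc about the fixed point of an elliptic element, an open horoball
at the fixed point of a parabolic element (or empty, if `δ` is too small). -/
def tube (T : PSL2R) (δ : ℝ) : Set ℍ := {z | displacement T z < δ}

/-- The quotient `G \ ℍ`, with the quotient topology. -/
abbrev Surface (G : Subgroup PSL2R) : Type := MulAction.orbitRel.Quotient G ℍ

/-- The projection of the hyperbolic plane onto `G \ ℍ`. -/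
noncomputable def proj (G : Subgroup PSL2R) (z : ℍ) : Surface G := Quotient.mk _ z

/-- The types of boundary components of a (possibly degenerate) Y-piece: a boundary geodesic of
length `ℓ ≥ 0`, where length `0` means a cusp, or, in a degenerate Y-piece, an elliptic fixed
point with a generating elliptic element of trace `t`. -/
inductive Boundary : Type
  | geodesic (ℓ : ℝ≥0) : Boundary
  | ellipticPoint (t : ℝ) : Boundary

/-- The trace of a boundary component: `2 cosh (ℓ / 2)` for a geodesic of length `ℓ`, and the trace
of the generating elliptic element for an elliptic fixed point. -/
noncomputable def Boundary.trace : Boundary → ℝ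
  | .geodesic ℓ => 2 * Real.cosh ((ℓ : ℝ) / 2)
  | .ellipticPoint t => t

/-- The element `P` has the type `x`: it is nontrivial, not elliptic, and has translation length
`ℓ` (so it is hyperbolic if `ℓ > 0` and parabolic if `ℓ = 0`), or it is elliptic of trace `t`. -/
def HasType (P : PSL2R) : Boundary → Prop
  | .geodesic ℓ => P ≠ 1 ∧ ¬ IsElliptic P ∧ IsGLB (Set.range (displacement P)) (ℓ : ℝ)
  | .ellipticPoint t => IsElliptic P ∧ tr P = t

/-- The element `P` of `G` gives a boundary component of type `x` in `G \ ℍ`, with embedded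
neighbourhood the image of `tube P δ`: the nonempty set `tube P δ` is mapped to `G \ ℍ` with no
other identifications than those by powers of `P`. So `core P` is mapped to a simple closed geodesic
whose length is the translation length of `P` (if `P` is hyperbolic), or to a point whose stabilizer
is generated by `P` (if `P` is elliptic), and the image of `tube P δ` is an embedded collar of this
geodesic, a disc about this point, or a cusp (if `P` is parabolic). -/
structure IsBoundary (G : Subgroup PSL2R) (P : PSL2R) (δ : ℝ) (x : Boundary) : Prop where
  mem : P ∈ G
  hasType : HasType P x
  nonempty : (tube P δ).Nonempty
  precise : ∀ g ∈ G, ∀ z ∈ tube P δ, g • z ∈ tube P δ → g ∈ Subgroup.zpowers P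

/-- The set `S` is the interior of a Y-piece `Y(x₀, x₁, x₂)` in `G \ ℍ`: it is an open set, without
elliptic fixed points, homeomorphic to the sphere with the three points `0`, `1`, `∞` removed; its
frontier consists of the (pairwise disjoint) boundary geodesics and elliptic fixed points of the
types `x₀`, `x₁`, `x₂`; and it is compact up to neighbourhoods of its three boundary components
(in particular, it has a cusp for each `xᵢ` that is a geodesic of length `0`). -/
def IsYPiece (G : Subgroup PSL2R) (x : Fin 3 → Boundary) (S : Set (Surface G)) : Prop :=
  IsOpen S ∧
  (∀ z : ℍ, proj G z ∈ S → ∀ g ∈ G, g • z = z → g = 1) ∧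
  Nonempty (S ≃ₜ (({0, 1}ᶜ : Set ℂ))) ∧
  ∃ (P : Fin 3 → PSL2R) (δ : Fin 3 → ℝ),
    (∀ i, IsBoundary G (P i) (δ i) (x i)) ∧
    (∀ i j, i ≠ j → Disjoint (proj G '' tube (P i) (δ i)) (proj G '' tube (P j) (δ j))) ∧
    frontier S = ⋃ i, proj G '' core (P i) ∧
    (∀ i, (S ∩ proj G '' tube (P i) (δ i)).Nonempty) ∧
    IsCompact (S \ ⋃ i, proj G '' tube (P i) (δ i))

/-- The surface `G \ ℍ` contains a (possibly degenerate) Y-piece `Y(x, y, z)`. -/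
def ContainsYPiece (G : Subgroup PSL2R) (x y z : Boundary) : Prop :=
  ∃ S : Set (Surface G), IsYPiece G ![x, y, z] S

end FuchsianY

open FuchsianY

/-! Conjugate the parabolic element to a translation. By discreteness `Tu` does not fix ∞
(`OrbitFinite.sq_eq_one`), so a further translation makes its diagonal entries equal, and then all
its powers have the form `[d, k * c; c, d]`. A power with the smallest nonzero `|c|` exists, and a
dilation turns this entry into `1`: up to inversion this power is `rotGen m = [m, m ^ 2 - 1; 1, m]`,
hyperbolic for `m > 1` and elliptic for `m < 1` (`exists_normalForm`). It is the inversion in the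
circle `|z + m| = 1` followed by the reflection in the imaginary axis.

The exterior of the two circles `|z ± m| = 1` is a fundamental domain of `K = ⟨Tu⟩`. Replace the
translation by a power `z ↦ z + 2 * q` with `q > m + 1`. The strip `|re z| ≤ q` then contains both
discs in its interior, and by ping-pong the strip minus the discs is a fundamental domain of the
group `G` generated by `K` and this translation (`Setup.unique`, `Setup.exists_fund`). Its sides are
paired by the reflection in the imaginary axis. The element `genV` is the translation after the
inverse of `rotGen m`; it is conjugate to `rotGen (q - m)`, hence hyperbolic, and together with `Tu`
it generates `G`.

For the topology, use the coordinates `|re z|` and `|z| ^ 2`, in which geodesics are straight lines.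
Half of the Y-piece lies above the maximum `lowBd` of three linear functions: the axis of `rotGen
m`, the isometric circle, and the axis of `genV`. The height above this graph and a parameter along
it serve as elliptic coordinates with foci `0` and `1`, the two halves of the domain going to the
two half-planes. The resulting `chart` glues paired sides, collapses the part beyond `u` to `0` and
the part beyond `v` to `1`, and sends the cusp to ∞. It descends to the quotient, and over the
complement of `{0, 1}` it is a proper continuous bijection (`Setup.nonempty_homeomorph`).

For the geometry, displacements are explicit rational functions after applying `sinh²(·/2)`. Thin
tubes around `u` and `v` meet the fundamental domain on different sides of the vertical lines `|re
z| = midEnd m q`, and below the horoball chosen for the cusp. So disjointness and embeddedness of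
the three neighbourhoods reduce to `Setup.unique` (`Setup.preciseU`, `Setup.preciseV`,
`Setup.preciseB`). -/

namespace FuchsianY

/-! ### Calculus with matrix representatives and displacements. -/

/-- The matrix of determinant one with the given entries. -/
def slMat (a b c d : ℝ) (h : a * d - b * c = 1) : SL(2, ℝ) :=
  ⟨!![a, b; c, d], by rw [Matrix.det_fin_two_of]; exact h⟩

theorem coe_slMat (a b c d : ℝ) (h : a * d - b * c = 1) :
    (slMat a b c d h : Matrix (Fin 2) (Fin 2) ℝ) = !![a, b; c, d] := rfl

/-- The class in `PSL(2, ℝ)` of a matrix of determinant one, given by its entries. -/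
def cls (a b c d : ℝ) (h : a * d - b * c = 1) : PSL2R :=
  QuotientGroup.mk (s := Subgroup.center SL(2, ℝ)) (slMat a b c d h)

theorem exists_eq_cls (T : PSL2R) : ∃ a b c d h, T = cls a b c d h := by
  obtain ⟨g, rfl⟩ := QuotientGroup.mk_surjective T
  refine ⟨g 0 0, g 0 1, g 1 0, g 1 1, ?_, ?_⟩
  · rw [← Matrix.det_fin_two]; exact g.2
  · unfold cls
    congr 1
    ext i j
    fin_cases i <;> fin_cases j <;> rfl

theorem cls_congr {a b c d a' b' c' d' : ℝ} {h : a * d - b * c = 1} {h' : a' * d' - b' * c' = 1}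
    (ha : a = a') (hb : b = b') (hc : c = c') (hd : d = d') :
    cls a b c d h = cls a' b' c' d' h' := by
  subst ha hb hc hd; rfl

theorem cls_mul (a b c d a' b' c' d' : ℝ) (h : a * d - b * c = 1) (h' : a' * d' - b' * c' = 1) :
    cls a b c d h * cls a' b' c' d' h' =
      cls (a * a' + b * c') (a * b' + b * d') (c * a' + d * c') (c * b' + d * d')
        (by linear_combination (a' * d' - b' * c') * h + h') := by
  unfold cls
  rw [← QuotientGroup.mk_mul]
  congr 1
  ext i j
  fin_cases i <;> fin_cases j <;>
    simp [Matrix.mul_apply, Fin.sum_univ_two, coe_slMat]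

theorem cls_one : cls 1 0 0 1 (by norm_num) = 1 := by
  unfold cls
  rw [← QuotientGroup.mk_one]
  congr 1
  ext i j
  fin_cases i <;> fin_cases j <;> simp [coe_slMat]

theorem cls_inv (a b c d : ℝ) (h : a * d - b * c = 1) :
    (cls a b c d h)⁻¹ = cls d (-b) (-c) a (by linarith) := by
  rw [inv_eq_iff_mul_eq_one, cls_mul, ← cls_one]
  apply cls_congr <;> linarith

theorem cls_neg (a b c d : ℝ) (h : a * d - b * c = 1) :
    cls (-a) (-b) (-c) (-d) (by linarith) = cls a b c d h := by
  unfold cls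
  rw [QuotientGroup.eq]
  rw [Matrix.SpecialLinearGroup.mem_center_iff]
  refine ⟨-1, by norm_num, ?_⟩
  ext i j
  fin_cases i <;> fin_cases j <;>
    simp [Matrix.mul_apply, Fin.sum_univ_two, Matrix.adjugate_fin_two, coe_slMat] <;> linarith

theorem cls_eq_iff {a b c d a' b' c' d' : ℝ} {h : a * d - b * c = 1} {h' : a' * d' - b' * c' = 1} :
    cls a b c d h = cls a' b' c' d' h' ↔
      (a = a' ∧ b = b' ∧ c = c' ∧ d = d') ∨ (a = -a' ∧ b = -b' ∧ c = -c' ∧ d = -d') := by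
  constructor
  · intro H
    unfold cls at H
    rw [QuotientGroup.eq] at H
    rcases eq_one_or_neg_one_of_mem_center _ H with H | H
    · left
      rw [inv_mul_eq_one] at H
      have := fun i j => congrArg (fun g : SL(2, ℝ) => g i j) H
      exact ⟨by simpa [coe_slMat] using this 0 0, by simpa [coe_slMat] using this 0 1, by simpa [coe_slMat] using this 1 0,
        by simpa [coe_slMat] using this 1 1⟩
    · right
      rw [inv_mul_eq_iff_eq_mul] at H
      have := fun i j => congrArg (fun g : SL(2, ℝ) => g i j) H
      refine ⟨?_, ?_, ?_, ?_⟩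
      · have := this 0 0; simp [coe_slMat] at this; linarith
      · have := this 0 1; simp [coe_slMat] at this; linarith
      · have := this 1 0; simp [coe_slMat] at this; linarith
      · have := this 1 1; simp [coe_slMat] at this; linarith
  · rintro (⟨rfl, rfl, rfl, rfl⟩ | ⟨rfl, rfl, rfl, rfl⟩)
    · rfl
    · exact cls_neg _ _ _ _ h'

theorem tr_cls (a b c d : ℝ) (h : a * d - b * c = 1) : tr (cls a b c d h) = |a + d| := by
  unfold cls; rw [tr_mk]; rfl

theorem tr_conj (g T : PSL2R) : tr (g * T * g⁻¹) = tr T := by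
  obtain ⟨a, b, c, d, h, rfl⟩ := exists_eq_cls g
  obtain ⟨a', b', c', d', h', rfl⟩ := exists_eq_cls T
  rw [cls_inv, cls_mul, cls_mul, tr_cls, tr_cls]
  congr 1
  linear_combination (a' + d') * h

theorem coe_cls_smul (a b c d : ℝ) (h : a * d - b * c = 1) (z : ℍ) :
    ((cls a b c d h • z : ℍ) : ℂ) = (a * z + b) / (c * z + d) := by
  unfold cls
  rw [mk_smul, UpperHalfPlane.coe_specialLinearGroup_apply]
  simp [coe_slMat]

theorem sq_norm_denom_pos (a b c d : ℝ) (h : a * d - b * c = 1) (z : ℍ) :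
    0 < (c * z.re + d) ^ 2 + (c * z.im) ^ 2 := by
  rcases eq_or_ne c 0 with rfl | hc
  · have : d ≠ 0 := by rintro rfl; simp at h
    simp; positivity
  · have := z.im_pos
    positivity

theorem re_cls_smul (a b c d : ℝ) (h : a * d - b * c = 1) (z : ℍ) :
    (cls a b c d h • z : ℍ).re =
      ((a * z.re + b) * (c * z.re + d) + a * c * z.im ^ 2) /
        ((c * z.re + d) ^ 2 + (c * z.im) ^ 2) := by
  have hp := (sq_norm_denom_pos a b c d h z).ne'
  rw [← UpperHalfPlane.coe_re, coe_cls_smul, Complex.div_re]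
  simp only [Complex.normSq_apply, Complex.add_re, Complex.mul_re, Complex.add_im, Complex.mul_im,
    Complex.ofReal_re, Complex.ofReal_im, UpperHalfPlane.coe_re, UpperHalfPlane.coe_im]
  rw [← add_div]
  congr 1 <;> ring

theorem im_cls_smul (a b c d : ℝ) (h : a * d - b * c = 1) (z : ℍ) :
    (cls a b c d h • z : ℍ).im = z.im / ((c * z.re + d) ^ 2 + (c * z.im) ^ 2) := by
  have hp := (sq_norm_denom_pos a b c d h z).ne'
  rw [← UpperHalfPlane.coe_im, coe_cls_smul, Complex.div_im]
  simp only [Complex.normSq_apply, Complex.add_re, Complex.mul_re, Complex.add_im, Complex.mul_im,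
    Complex.ofReal_re, Complex.ofReal_im, UpperHalfPlane.coe_re, UpperHalfPlane.coe_im]
  rw [← sub_div]
  congr 1
  · linear_combination z.im * h
  · ring

theorem dist_smul_smul (g : PSL2R) (z w : ℍ) : dist (g • z) (g • w) = dist z w := by
  obtain ⟨g, rfl⟩ := QuotientGroup.mk_surjective g
  rw [mk_smul, mk_smul, dist_smul]

theorem continuous_smul_psl (g : PSL2R) : Continuous fun z : ℍ => g • z :=
  (Isometry.of_dist_eq (dist_smul_smul g)).continuous

instance : ContinuousConstSMul PSL2R ℍ := ⟨continuous_smul_psl⟩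

/-- The square of `sinh` of half of the displacement. -/
noncomputable def disp (T : PSL2R) (z : ℍ) : ℝ := Real.sinh (displacement T z / 2) ^ 2

theorem displacement_nonneg (T : PSL2R) (z : ℍ) : 0 ≤ displacement T z := dist_nonneg

theorem disp_cls (a b c d : ℝ) (h : a * d - b * c = 1) (z : ℍ) :
    disp (cls a b c d h) z =
      ((c * (z.re ^ 2 - z.im ^ 2) + (d - a) * z.re - b) ^ 2 +
        (2 * c * z.re + (d - a)) ^ 2 * z.im ^ 2) / (4 * z.im ^ 2) := by
  have hp := sq_norm_denom_pos a b c d h z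
  have hy := z.im_pos
  have hy' := (cls a b c d h • z).im_pos
  have hne : (c * z + d : ℂ) ≠ 0 := by
    intro h0
    have h1 := congrArg Complex.re h0
    have h2 := congrArg Complex.im h0
    simp at h1 h2
    rcases h2 with h2 | h2
    · rw [h1, h2] at hp; simp at hp
    · exact hy.ne' h2
  have key : (z : ℂ) - (a * z + b) / (c * z + d) =
      (c * z ^ 2 + (d - a) * z - b) / (c * z + d) := by
    rw [eq_div_iff hne, sub_mul, div_mul_cancel₀ _ hne]
    ring
  rw [disp, displacement, UpperHalfPlane.sinh_half_dist, div_pow, mul_pow,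
    Real.sq_sqrt (by positivity), Complex.dist_eq, coe_cls_smul, key, norm_div, div_pow,
    Complex.sq_norm, Complex.sq_norm, im_cls_smul, Complex.normSq_apply, Complex.normSq_apply]
  have e1 : (c * z + d : ℂ).re * (c * z + d : ℂ).re + (c * z + d : ℂ).im * (c * z + d : ℂ).im =
      (c * z.re + d) ^ 2 + (c * z.im) ^ 2 := by
    simp; ring
  have e2 : (c * z ^ 2 + (d - a) * z - b : ℂ).re * (c * z ^ 2 + (d - a) * z - b : ℂ).re +
      (c * z ^ 2 + (d - a) * z - b : ℂ).im * (c * z ^ 2 + (d - a) * z - b : ℂ).im =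
      (c * (z.re ^ 2 - z.im ^ 2) + (d - a) * z.re - b) ^ 2 +
        (2 * c * z.re + (d - a)) ^ 2 * z.im ^ 2 := by
    simp [pow_two]; ring
  rw [e1, e2]
  generalize (c * z.re + d) ^ 2 + (c * z.im) ^ 2 = M at hp ⊢
  field_simp
  ring

/-! ### Discreteness as finiteness of orbits in balls. -/

/-- Finitely many elements of `G` move a given point into a given ball. -/
def OrbitFinite (G : Subgroup PSL2R) : Prop :=
  ∀ (z w : ℍ) (r : ℝ), {g : PSL2R | g ∈ G ∧ dist w (g • z) ≤ r}.Finite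

/-- Discreteness lifts to the preimage in `SL(2, ℝ)`, where discrete subgroups act properly
discontinuously. This is the only form in which discreteness is used later. -/
theorem IsFuchsian.orbitFinite {Γ : Subgroup PSL2R} (hΓ : IsFuchsian Γ) : OrbitFinite Γ := by
  intro z w r
  let π : SL(2, ℝ) →* PSL2R := QuotientGroup.mk' (Subgroup.center SL(2, ℝ))
  have hπc : Continuous π := continuous_quot_mk
  let Γ' : Subgroup SL(2, ℝ) := Γ.comap π
  have hd : DiscreteTopology Γ' := by
    have h1 : IsOpen ({1} : Set Γ) := by
      have : DiscreteTopology Γ := hΓ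
      exact isOpen_discrete _
    obtain ⟨U, hU, hU1⟩ := isOpen_induced_iff.1 h1
    have h2 : IsOpen ({1} : Set Γ') := by
      -- The matrix `-1` also lies over the identity, so it has to be removed to isolate `1`
      -- upstairs.
      refine isOpen_induced_iff.2 ⟨π ⁻¹' U ∩ {-1}ᶜ, (hU.preimage hπc).inter
        isClosed_singleton.isOpen_compl, ?_⟩
      ext ⟨g, hg⟩
      simp only [Set.mem_preimage, Set.mem_inter_iff, Set.mem_compl_iff, Set.mem_singleton_iff]
      constructor
      · rintro ⟨hgU, hg1⟩
        have : (⟨π g, hg⟩ : Γ) ∈ ({1} : Set Γ) := by rw [← hU1]; exact hgU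
        have h3 : π g = 1 := congrArg Subtype.val this
        have h4 : g ∈ Subgroup.center SL(2, ℝ) := by
          rwa [← MonoidHom.mem_ker, QuotientGroup.ker_mk'] at h3
        rcases eq_one_or_neg_one_of_mem_center g h4 with h5 | h5
        · exact Subtype.ext h5
        · exact absurd h5 hg1
      · intro h3
        have h3' : g = 1 := congrArg Subtype.val h3
        subst h3'
        refine ⟨?_, ?_⟩
        · have : (1 : Γ) ∈ Subtype.val ⁻¹' U := by rw [hU1]; rfl
          rw [map_one]
          exact this
        · intro h4
          have := congrArg (fun g : SL(2, ℝ) => g 0 0) h4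
          norm_num at this
    exact discreteTopology_of_isOpen_singleton_one h2
  have hfin : {γ : Γ' | ((γ • ·) '' ({z} : Set ℍ) ∩ Metric.closedBall w r).Nonempty}.Finite :=
    (ProperlyDiscontinuousSMul.finite_disjoint_inter_image (Γ := Γ') isCompact_singleton
      (isCompact_closedBall w r))
  refine (hfin.image (fun γ : Γ' => π γ)).subset ?_
  rintro g ⟨hg, hgd⟩
  obtain ⟨g, rfl⟩ := QuotientGroup.mk_surjective g
  refine ⟨⟨g, hg⟩, ?_, rfl⟩
  simp only [Set.image_singleton, Set.mem_ofPred_eq, Set.singleton_inter_nonempty]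
  rw [Metric.mem_closedBall, dist_comm]
  exact hgd

theorem OrbitFinite.mono {G H : Subgroup PSL2R} (hG : OrbitFinite G) (h : H ≤ G) :
    OrbitFinite H :=
  fun z w r => (hG z w r).subset fun _ hg => ⟨h hg.1, hg.2⟩

theorem OrbitFinite.conj {G G' : Subgroup PSL2R} (hG : OrbitFinite G) (h : PSL2R)
    (hG' : ∀ g ∈ G', h⁻¹ * g * h ∈ G) : OrbitFinite G' := by
  intro z w r
  refine ((hG (h⁻¹ • z) (h⁻¹ • w) r).image fun g => h * g * h⁻¹).subset ?_
  rintro g ⟨hg, hgr⟩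
  refine ⟨h⁻¹ * g * h, ⟨hG' g hg, ?_⟩, by group⟩
  rw [smul_smul, mul_assoc, mul_inv_cancel, mul_one, mul_smul, dist_smul_smul]
  exact hgr

/-- The orbit of a point has a point closest to `p`. -/
theorem OrbitFinite.exists_closest {G : Subgroup PSL2R} (hG : OrbitFinite G) (z p : ℍ) :
    ∃ g ∈ G, ∀ g' ∈ G, dist (g • z) p ≤ dist (g' • g • z) p := by
  have hne : {g : PSL2R | g ∈ G ∧ dist p (g • z) ≤ dist p z}.Nonempty :=
    ⟨1, G.one_mem, by rw [one_smul]⟩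
  obtain ⟨g, ⟨hg, hgd⟩, hmin⟩ :=
    Set.exists_min_image _ (fun g : PSL2R => dist (g • z) p) (hG z p (dist p z)) hne
  refine ⟨g, hg, fun g' hg' => ?_⟩
  rw [← mul_smul]
  by_cases h : dist p ((g' * g) • z) ≤ dist p z
  · exact hmin _ ⟨G.mul_mem hg' hg, h⟩
  · rw [dist_comm, dist_comm _ p]
    linarith

/-! ### Tubes and cores in terms of `disp`. -/

theorem disp_lt_disp_iff {T T' : PSL2R} {z w : ℍ} :
    disp T z < disp T' w ↔ displacement T z < displacement T' w := by
  unfold disp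
  have h1 := Real.sinh_nonneg_iff.2 (div_nonneg (displacement_nonneg T z) zero_le_two)
  have h2 := Real.sinh_nonneg_iff.2 (div_nonneg (displacement_nonneg T' w) zero_le_two)
  rw [sq_lt_sq₀ h1 h2, Real.sinh_lt_sinh]
  constructor <;> intro h <;> linarith

theorem core_eq (T : PSL2R) : core T = {z | ∀ w, disp T z ≤ disp T w} := by
  ext z
  simp only [core, Set.mem_ofPred_eq]
  refine forall_congr' fun w => ?_
  rw [← not_lt, ← not_lt, disp_lt_disp_iff]

theorem exists_tube_eq (T : PSL2R) (ε : ℝ) :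
    ∃ δ, tube T δ = {z | disp T z < ε} := by
  refine ⟨2 * Real.arsinh √ε, ?_⟩
  ext z
  simp only [tube, disp, Set.mem_ofPred_eq]
  have h1 : 0 ≤ Real.sinh (displacement T z / 2) :=
    Real.sinh_nonneg_iff.2 (div_nonneg (displacement_nonneg T z) zero_le_two)
  rw [← Real.lt_sqrt h1, ← Real.sinh_arsinh √ε, Real.sinh_lt_sinh, Real.sinh_arsinh]
  constructor <;> intro h <;> linarith

theorem displacement_conj (h T : PSL2R) (z : ℍ) :
    displacement (h * T * h⁻¹) (h • z) = displacement T z := by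
  simp only [displacement, mul_smul, inv_smul_smul, dist_smul_smul]

theorem disp_conj (h T : PSL2R) (z : ℍ) : disp (h * T * h⁻¹) (h • z) = disp T z := by
  rw [disp, displacement_conj, disp]

theorem disp_pow_comm (T k : PSL2R) (hk : k * T = T * k) (z : ℍ) :
    disp T (k • z) = disp T z := by
  have : k * T * k⁻¹ = T := by rw [hk, mul_assoc, mul_inv_cancel, mul_one]
  rw [← disp_conj k T z, this]

theorem continuous_displacement (T : PSL2R) : Continuous (displacement T) :=
  continuous_id.dist (continuous_smul_psl T)

theorem continuous_disp (T : PSL2R) : Continuous (disp T) := by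
  have := continuous_displacement T
  unfold disp
  exact (Real.continuous_sinh.comp (this.div_const 2)).pow 2

/-! ### The quotient surface and its invariance under conjugation. -/

theorem proj_eq_proj {G : Subgroup PSL2R} {z w : ℍ} :
    proj G z = proj G w ↔ ∃ g ∈ G, g • w = z := by
  unfold proj
  rw [Quotient.eq, MulAction.orbitRel_apply, MulAction.mem_orbit_iff]
  exact ⟨fun ⟨g, hg⟩ => ⟨g, g.2, hg⟩, fun ⟨g, hg, h⟩ => ⟨⟨g, hg⟩, h⟩⟩

theorem proj_smul {G : Subgroup PSL2R} {g : PSL2R} (hg : g ∈ G) (z : ℍ) :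
    proj G (g • z) = proj G z :=
  proj_eq_proj.2 ⟨g, hg, rfl⟩

theorem proj_surjective (G : Subgroup PSL2R) : Function.Surjective (proj G) :=
  Quotient.mk_surjective

theorem continuous_proj (G : Subgroup PSL2R) : Continuous (proj G) := continuous_quot_mk

instance (G : Subgroup PSL2R) : ContinuousConstSMul G ℍ := ⟨fun g => continuous_smul_psl g⟩

theorem isOpenMap_proj (G : Subgroup PSL2R) : IsOpenMap (proj G) := isOpenMap_quotient_mk'_mul

section Conj

variable {G G' : Subgroup PSL2R} {h : PSL2R}

/-- Conjugate groups have homeomorphic quotients. -/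
noncomputable def surfaceConj (hG : ∀ g, h * g * h⁻¹ ∈ G' ↔ g ∈ G) : Surface G ≃ₜ Surface G' where
  toFun := Quotient.lift (fun z => proj G' (h • z)) (by
    intro a b hab
    obtain ⟨g, hg, rfl⟩ := proj_eq_proj.1 (Quotient.sound hab : proj G a = proj G b)
    refine proj_eq_proj.2 ⟨h * g * h⁻¹, (hG g).2 hg, ?_⟩
    simp [mul_smul])
  invFun := Quotient.lift (fun z => proj G (h⁻¹ • z)) (by
    intro a b hab
    obtain ⟨g, hg, rfl⟩ := proj_eq_proj.1 (Quotient.sound hab : proj G' a = proj G' b)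
    refine proj_eq_proj.2 ⟨h⁻¹ * g * h, (hG _).1 ?_, ?_⟩
    · convert hg using 1; group
    · simp [mul_smul])
  left_inv := by
    intro x
    obtain ⟨z, rfl⟩ := proj_surjective G x
    change proj G (h⁻¹ • h • z) = _
    rw [inv_smul_smul]
  right_inv := by
    intro x
    obtain ⟨z, rfl⟩ := proj_surjective G' x
    change proj G' (h • h⁻¹ • z) = _
    rw [smul_inv_smul]
  continuous_toFun := ((continuous_proj G').comp (continuous_smul_psl h)).quotient_lift _
  continuous_invFun := ((continuous_proj G).comp (continuous_smul_psl h⁻¹)).quotient_lift _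

theorem surfaceConj_proj (hG : ∀ g, h * g * h⁻¹ ∈ G' ↔ g ∈ G) (z : ℍ) :
    surfaceConj hG (proj G z) = proj G' (h • z) := rfl

theorem preimage_surfaceConj (hG : ∀ g, h * g * h⁻¹ ∈ G' ↔ g ∈ G) (A : Set ℍ) :
    surfaceConj hG ⁻¹' (proj G' '' A) = proj G '' ((h • ·) ⁻¹' A) := by
  ext x
  obtain ⟨z, rfl⟩ := proj_surjective G x
  constructor
  · rintro ⟨w, hw, hwz⟩
    refine ⟨h⁻¹ • w, by simpa using hw, ?_⟩
    apply (surfaceConj hG).injective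
    rw [surfaceConj_proj, smul_inv_smul, hwz]
  · rintro ⟨w, hw, hwz⟩
    exact ⟨h • w, hw, by rw [← hwz, surfaceConj_proj]⟩

theorem HasType.of_conj {P : PSL2R} {x : Boundary} (hP : HasType P x) :
    HasType (h⁻¹ * P * h) x := by
  have htr : tr (h⁻¹ * P * h) = tr P := by simpa using tr_conj h⁻¹ P
  cases x with
  | geodesic ℓ =>
    obtain ⟨h1, h2, h3⟩ := hP
    refine ⟨fun h0 => h1 ?_, ?_, ?_⟩
    · rw [mul_assoc, inv_mul_eq_one, eq_comm] at h0
      simpa using h0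
    · rwa [IsElliptic, htr]
    · convert h3 using 1
      ext r
      constructor
      · rintro ⟨z, rfl⟩
        refine ⟨h • z, ?_⟩
        rw [← displacement_conj h⁻¹ P]
        simp
      · rintro ⟨z, rfl⟩
        refine ⟨h⁻¹ • z, ?_⟩
        rw [← displacement_conj h⁻¹ P z]
        simp
  | ellipticPoint t =>
    exact ⟨by rw [IsElliptic, htr]; exact hP.1, by rw [htr]; exact hP.2⟩

/-- Everything in the definition is expressed by displacements, projections and topology, all of
which an isometry transports. This permits working in normal form. -/
theorem ContainsYPiece.of_conj (hG : ∀ g, h * g * h⁻¹ ∈ G' ↔ g ∈ G) {x y z : Boundary}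
    (hY : ContainsYPiece G' x y z) : ContainsYPiece G x y z := by
  obtain ⟨S, hS, hell, ⟨e⟩, P, δ, hP, hdis, hfr, hne, hcpt⟩ := hY
  let Φ := surfaceConj hG
  have hdisp : ∀ i w, displacement (h⁻¹ * P i * h) w = displacement (P i) (h • w) := by
    intro i w
    have := displacement_conj h⁻¹ (P i) (h • w)
    simpa using this
  have htube : ∀ i, tube (h⁻¹ * P i * h) (δ i) = (h • ·) ⁻¹' tube (P i) (δ i) := by
    intro i; ext w; simp only [tube, Set.mem_ofPred_eq, Set.mem_preimage, hdisp]
  have hcore : ∀ i, core (h⁻¹ * P i * h) = (h • ·) ⁻¹' core (P i) := by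
    intro i; ext w
    simp only [core, Set.mem_ofPred_eq, Set.mem_preimage, hdisp]
    exact ⟨fun H v => by simpa using H (h⁻¹ • v), fun H v => H _⟩
  have hpt : ∀ i, proj G '' tube (h⁻¹ * P i * h) (δ i) = Φ ⁻¹' (proj G' '' tube (P i) (δ i)) := by
    intro i; rw [htube, preimage_surfaceConj]
  have hconj : ∀ g : PSL2R, h * (h⁻¹ * g * h) * h⁻¹ = g := fun g => by group
  refine ⟨Φ ⁻¹' S, hS.preimage Φ.continuous, ?_,
    ⟨(Φ.subtype (p := (· ∈ Φ ⁻¹' S)) (q := (· ∈ S)) fun _ => Iff.rfl).trans e⟩,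
    fun i => h⁻¹ * P i * h, δ, ?_, ?_, ?_, ?_, ?_⟩
  · intro w hw g hg hgw
    have := hell (h • w) hw (h * g * h⁻¹) ((hG g).2 hg) (by simp [mul_smul, hgw])
    simpa using this
  · intro i
    refine ⟨?_, (hP i).hasType.of_conj, ?_, ?_⟩
    · rw [← hG, hconj]; exact (hP i).mem
    · obtain ⟨w, hw⟩ := (hP i).nonempty
      exact ⟨h⁻¹ • w, by rw [htube]; simpa using hw⟩
    · intro g hg w hw hgw
      rw [htube] at hw hgw
      have := (hP i).precise (h * g * h⁻¹) ((hG g).2 hg) (h • w) hw (by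
        simpa [mul_smul] using hgw)
      obtain ⟨n, hn⟩ := this
      refine ⟨n, ?_⟩
      have h2 := congrArg (fun t => h⁻¹ * t * h) hn
      simp only at h2
      have h3 : h⁻¹ * P i ^ n * h = (h⁻¹ * P i * h) ^ n := by
        simpa using (conj_zpow (a := h⁻¹) (b := P i) (i := n)).symm
      change (h⁻¹ * P i * h) ^ n = g
      rw [← h3, h2]; group
  · intro i j hij
    rw [hpt, hpt]
    exact (hdis i j hij).preimage _
  · rw [← Φ.preimage_frontier, hfr, Set.preimage_iUnion]
    refine Set.iUnion_congr fun i => ?_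
    rw [hcore, preimage_surfaceConj]
  · intro i
    rw [hpt, ← Set.preimage_inter]
    exact (hne i).preimage Φ.surjective
  · have : Φ ⁻¹' S \ ⋃ i, proj G '' tube (h⁻¹ * P i * h) (δ i) =
        Φ ⁻¹' (S \ ⋃ i, proj G' '' tube (P i) (δ i)) := by
      rw [Set.preimage_sdiff, Set.preimage_iUnion]
      simp only [hpt]
    rw [this]
    exact Φ.isCompact_preimage.2 hcpt

end Conj

/-! ### Reduced words and ping-pong. -/

section

/-- Normal form of a word in the free product of two subgroups; the Boolean tells to which of the
two subgroups the first letter belongs. -/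
inductive IsReduced {H : Type*} [Group H] (K L : Subgroup H) : Bool → H → Prop
  | left {k : H} : k ∈ K → k ≠ 1 → IsReduced K L true k
  | right {l : H} : l ∈ L → l ≠ 1 → IsReduced K L false l
  | cons_left {k g : H} : k ∈ K → k ≠ 1 → IsReduced K L false g → IsReduced K L true (k * g)
  | cons_right {l g : H} : l ∈ L → l ≠ 1 → IsReduced K L true g → IsReduced K L false (l * g)

theorem IsReduced.swap {H : Type*} [Group H] {K L : Subgroup H} {b : Bool} {g : H}
    (h : IsReduced K L b g) : IsReduced L K (!b) g := by
  induction h with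
  | left h1 h2 => exact .right h1 h2
  | right h1 h2 => exact .left h1 h2
  | cons_left h1 h2 _ ih => exact .cons_right h1 h2 ih
  | cons_right h1 h2 _ ih => exact .cons_left h1 h2 ih

theorem IsReduced.mul_left {H : Type*} [Group H] {K L : Subgroup H} {b : Bool} {k g : H}
    (hk : k ∈ K) (h : IsReduced K L b g) : k * g = 1 ∨ ∃ b, IsReduced K L b (k * g) := by
  by_cases hk1 : k = 1
  · right; exact ⟨b, by rwa [hk1, one_mul]⟩
  cases h with
  | @left k' h1 h2 =>
    by_cases h : k * g = 1
    · exact .inl h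
    · exact .inr ⟨true, .left (K.mul_mem hk h1) h⟩
  | right h1 h2 => exact .inr ⟨true, .cons_left hk hk1 (.right h1 h2)⟩
  | @cons_left k' g' h1 h2 h3 =>
    right
    rw [← mul_assoc]
    by_cases h : k * k' = 1
    · exact ⟨false, by rwa [h, one_mul]⟩
    · exact ⟨true, .cons_left (K.mul_mem hk h1) h h3⟩
  | cons_right h1 h2 h3 => exact .inr ⟨true, .cons_left hk hk1 (.cons_right h1 h2 h3)⟩

theorem exists_isReduced {H : Type*} [Group H] {K L : Subgroup H} {g : H} (hg : g ∈ K ⊔ L) :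
    g = 1 ∨ ∃ b, IsReduced K L b g := by
  rw [Subgroup.sup_eq_closure] at hg
  have step : ∀ x ∈ (K : Set H) ∪ L, ∀ y : H, (y = 1 ∨ ∃ b, IsReduced K L b y) →
      (x * y = 1 ∨ ∃ b, IsReduced K L b (x * y)) := by
    rintro x hx y (rfl | ⟨b, hb⟩)
    · rw [mul_one]
      by_cases h1 : x = 1
      · exact .inl h1
      · rcases hx with hx | hx
        · exact .inr ⟨_, .left hx h1⟩
        · exact .inr ⟨_, .right hx h1⟩
    · rcases hx with hx | hx
      · exact hb.mul_left hx
      · rcases hb.swap.mul_left hx with h | ⟨b', h⟩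
        · exact .inl h
        · exact .inr ⟨_, h.swap⟩
  induction hg using Subgroup.closure_induction_left with
  | one => exact .inl rfl
  | mul_left x hx y _ ih => exact step x hx y ih
  | inv_mul_cancel x hx y _ ih =>
    refine step x⁻¹ ?_ y ih
    rcases hx with hx | hx
    · exact .inl (K.inv_mem hx)
    · exact .inr (L.inv_mem hx)

/-- Ping-pong for two fundamental domains `P`, `Q` with interiors `P'`, `Q'`: an element of the
group generated by `K` and `L` that maps a point of the intersection of the domains to such a point
lies in `K` or in `L`. -/
theorem IsReduced.pingpong {H X : Type*} [Group H] [MulAction H X] {K L : Subgroup H}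
    {P P' Q Q' : X → Prop}
    (hK : ∀ k ∈ K, k ≠ 1 → ∀ z, P z → ¬ P' (k • z))
    (hK' : ∀ k ∈ K, k ≠ 1 → ∀ z, P' z → ¬ P (k • z))
    (hL : ∀ l ∈ L, l ≠ 1 → ∀ z, Q z → ¬ Q' (l • z))
    (hL' : ∀ l ∈ L, l ≠ 1 → ∀ z, Q' z → ¬ Q (l • z))
    (hP : ∀ z, P' z → P z) (hQ : ∀ z, Q' z → Q z) (hPQ : ∀ z, P' z ∨ Q' z) {b : Bool} {g : H} (h : IsReduced K L b g) :
    (∀ z, P z → Q z → if b then ¬ P' (g • z) else ¬ Q' (g • z)) ∧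
      ((if b then g ∈ K else g ∈ L) ∨
        ∀ z, P z → Q z → if b then ¬ P (g • z) else ¬ Q (g • z)) := by
  induction h with
  | left h1 h2 => exact ⟨fun z hz _ => hK _ h1 h2 z hz, .inl h1⟩
  | right h1 h2 => exact ⟨fun z _ hz => hL _ h1 h2 z hz, .inl h1⟩
  | @cons_left k g h1 h2 _ ih =>
    simp only [Bool.false_eq_true, if_false, if_true] at ih ⊢
    have : ∀ z, P z → Q z → ¬ P ((k * g) • z) := fun z hz hz' => by
      rw [mul_smul]
      -- The shorter word has moved the point out of `Q'`, hence into `P'`, and a nontrivial letter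
      -- from `K` moves `P'` off the closed domain `P`. So words of length at least two never return
      -- even to the boundary.
      exact hK' _ h1 h2 _ ((hPQ _).resolve_right (ih.1 z hz hz'))
    exact ⟨fun z hz hz' h => this z hz hz' (hP _ h), .inr this⟩
  | @cons_right l g h1 h2 _ ih =>
    simp only [Bool.false_eq_true, if_false, if_true] at ih ⊢
    have : ∀ z, P z → Q z → ¬ Q ((l * g) • z) := fun z hz hz' => by
      rw [mul_smul]
      exact hL' _ h1 h2 _ ((hPQ _).resolve_left (ih.1 z hz hz'))
    exact ⟨fun z hz hz' h => this z hz hz' (hQ _ h), .inr this⟩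

/-! ### Elements with equal diagonal entries, translations, and isometric circles. -/

/-- The elements `[d, κ c; c, d]` with `κ = m ^ 2 - 1`, which commute with each other. -/
def rot (m c d : ℝ) (h : d ^ 2 - (m ^ 2 - 1) * c ^ 2 = 1) : PSL2R :=
  cls d ((m ^ 2 - 1) * c) c d (by linarith)

/-- The element `[m, m ^ 2 - 1; 1, m]`. -/
def rotGen (m : ℝ) : PSL2R := rot m 1 m (by ring)

/-- The translation `z ↦ z + t`. -/
def shift (t : ℝ) : PSL2R := cls 1 t 0 1 (by ring)

theorem shift_re (t : ℝ) (z : ℍ) : (shift t • z).re = z.re + t := by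
  rw [shift, re_cls_smul]; simp

theorem shift_im (t : ℝ) (z : ℍ) : (shift t • z).im = z.im := by
  rw [shift, im_cls_smul]; simp

theorem shift_mul (s t : ℝ) : shift s * shift t = shift (s + t) := by
  rw [shift, shift, cls_mul, shift]
  apply cls_congr <;> ring

theorem shift_zero : shift 0 = 1 := by
  rw [← cls_one]; rfl

theorem shift_inv (t : ℝ) : (shift t)⁻¹ = shift (-t) := by
  rw [inv_eq_iff_mul_eq_one, shift_mul, add_neg_cancel, shift_zero]

theorem shift_pow (t : ℝ) (n : ℕ) : shift t ^ n = shift (n * t) := by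
  induction n with
  | zero => simp [shift_zero]
  | succ n ih => rw [pow_succ, ih, shift_mul]; congr 1; push_cast; ring

theorem shift_zpow (t : ℝ) (n : ℤ) : shift t ^ n = shift (n * t) := by
  cases n with
  | ofNat n => simpa using shift_pow t n
  | negSucc n =>
    rw [zpow_negSucc, shift_pow, shift_inv]; congr 1; push_cast; ring

theorem shift_ne_one {t : ℝ} (ht : t ≠ 0) : shift t ≠ 1 := by
  intro h
  have := shift_re t UpperHalfPlane.I
  rw [h, one_smul] at this
  exact ht (by linarith)

variable {m c d : ℝ} {h : d ^ 2 - (m ^ 2 - 1) * c ^ 2 = 1}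

theorem rot_mul (m c d c' d' : ℝ) (h : d ^ 2 - (m ^ 2 - 1) * c ^ 2 = 1)
    (h' : d' ^ 2 - (m ^ 2 - 1) * c' ^ 2 = 1) :
    rot m c d h * rot m c' d' h' = rot m (c * d' + d * c') (d * d' + (m ^ 2 - 1) * c * c')
      (by linear_combination (d' ^ 2 - (m ^ 2 - 1) * c' ^ 2) * h + h') := by
  rw [rot, rot, cls_mul, rot]
  apply cls_congr <;> ring

theorem rot_inv (m c d : ℝ) (h : d ^ 2 - (m ^ 2 - 1) * c ^ 2 = 1) :
    (rot m c d h)⁻¹ = rot m (-c) d (by linarith) := by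
  rw [rot, cls_inv, rot]
  apply cls_congr <;> ring

theorem rot_neg (m c d : ℝ) (h : d ^ 2 - (m ^ 2 - 1) * c ^ 2 = 1) :
    rot m (-c) (-d) (by linarith) = rot m c d h := by
  rw [rot, rot, ← cls_neg]
  apply cls_congr <;> ring

theorem rot_comm (m c d c' d' : ℝ) (h : d ^ 2 - (m ^ 2 - 1) * c ^ 2 = 1)
    (h' : d' ^ 2 - (m ^ 2 - 1) * c' ^ 2 = 1) :
    rot m c d h * rot m c' d' h' = rot m c' d' h' * rot m c d h := by
  rw [rot_mul, rot_mul]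
  unfold rot
  apply cls_congr <;> ring

theorem rot_congr {m c d c' d' : ℝ} {h : d ^ 2 - (m ^ 2 - 1) * c ^ 2 = 1}
    {h' : d' ^ 2 - (m ^ 2 - 1) * c' ^ 2 = 1} (hc : c = c') (hd : d = d') :
    rot m c d h = rot m c' d' h' := by
  subst hc hd; rfl

/-- The square of the Euclidean absolute value. -/
noncomputable def nsq (z : ℍ) : ℝ := z.re ^ 2 + z.im ^ 2

theorem rot_denom (h : d ^ 2 - (m ^ 2 - 1) * c ^ 2 = 1) (z : ℍ) :
    (c * z.re + d) ^ 2 + (c * z.im) ^ 2 =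
      1 + c ^ 2 * (nsq z + (m ^ 2 - 1)) + 2 * c * d * z.re := by
  unfold nsq
  linear_combination h

theorem rot_denom_pos (h : d ^ 2 - (m ^ 2 - 1) * c ^ 2 = 1) (z : ℍ) :
    0 < 1 + c ^ 2 * (nsq z + (m ^ 2 - 1)) + 2 * c * d * z.re := by
  rw [← rot_denom h]
  exact sq_norm_denom_pos d ((m ^ 2 - 1) * c) c d (by linarith) z

theorem rot_im (h : d ^ 2 - (m ^ 2 - 1) * c ^ 2 = 1) (z : ℍ) :
    (rot m c d h • z).im = z.im / (1 + c ^ 2 * (nsq z + (m ^ 2 - 1)) + 2 * c * d * z.re) := by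
  rw [rot, im_cls_smul, rot_denom h]

theorem rot_re (h : d ^ 2 - (m ^ 2 - 1) * c ^ 2 = 1) (z : ℍ) :
    c * (rot m c d h • z).re =
      d - (c * z.re + d) / (1 + c ^ 2 * (nsq z + (m ^ 2 - 1)) + 2 * c * d * z.re) := by
  have hp := (rot_denom_pos h z).ne'
  rw [rot, re_cls_smul, rot_denom h, eq_sub_iff_add_eq, ← mul_div_assoc, ← add_div,
    div_eq_iff hp, nsq]
  linear_combination (-c * z.re) * h

theorem disp_rot (h : d ^ 2 - (m ^ 2 - 1) * c ^ 2 = 1) (z : ℍ) :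
    disp (rot m c d h) z =
      c ^ 2 * ((m ^ 2 - 1) + (nsq z - (m ^ 2 - 1)) ^ 2 / (4 * z.im ^ 2)) := by
  have := z.im_pos
  rw [rot, disp_cls, nsq]
  field_simp
  ring

theorem disp_shift (t : ℝ) (z : ℍ) : disp (shift t) z = t ^ 2 / (4 * z.im ^ 2) := by
  rw [shift, disp_cls]
  congr 1
  ring

/-- The region outside of the isometric circles of `rotGen m` and its inverse. -/
def OutCircles (m : ℝ) (z : ℍ) : Prop := 2 * m * |z.re| ≤ nsq z + (m ^ 2 - 1)

/-- The right-hand side is `|c z + d| ^ 2 - 1`. From `1 ≤ c ^ 2` one gets `|d| ≤ m |c|`, so outside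
the two unit circles both summands on the left are nonnegative: the isometric circle of every such
element lies within the discs of the generator and its inverse. -/
theorem rot_denom_lower (hm : 0 ≤ m) (z : ℍ) (h : d ^ 2 - (m ^ 2 - 1) * c ^ 2 = 1)
    (hc : 1 ≤ c ^ 2) :
    c ^ 2 * (nsq z + (m ^ 2 - 1) - 2 * m * |z.re|) +
      2 * |z.re| * (|c| * (m * |c| - |d|)) ≤
        c ^ 2 * (nsq z + (m ^ 2 - 1)) + 2 * c * d * z.re ∧ 0 ≤ m * |c| - |d| := by
  have h2 : |d| ≤ m * |c| := by
    apply abs_le_of_sq_le_sq' _ (by positivity) |>.2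
    rw [mul_pow, sq_abs, sq_abs]
    nlinarith
  have h3 : -(|c| * |d| * |z.re|) ≤ c * d * z.re := by
    rw [← abs_mul, ← abs_mul]; exact neg_abs_le _
  refine ⟨?_, by linarith⟩
  have h4 : c ^ 2 = |c| * |c| := by rw [← sq_abs, sq]
  rw [h4]
  nlinarith

/-- Outside the circles no element raises the imaginary part; applied to the element and to its
inverse this forces `|c z + d| = 1`. Equality in `rot_denom_lower` then puts `z` on a circle and,
off the imaginary axis, leaves only the generator and its inverse. -/
theorem rot_smul_of_outCircles (hm : 0 ≤ m) (h : d ^ 2 - (m ^ 2 - 1) * c ^ 2 = 1)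
    (hc : 1 ≤ c ^ 2) {z : ℍ} (hz : OutCircles m z) (hz' : OutCircles m (rot m c d h • z)) :
    (rot m c d h • z).re = -z.re ∧ (rot m c d h • z).im = z.im ∧
      nsq z + (m ^ 2 - 1) = 2 * m * |z.re| ∧ (0 < z.re → rot m c d h = (rotGen m)⁻¹) ∧
      (z.re < 0 → rot m c d h = rotGen m) := by
  have hc0 : c ≠ 0 := by rintro rfl; norm_num at hc
  have hc1 : 0 < |c| := abs_pos.2 hc0
  set M := 1 + c ^ 2 * (nsq z + (m ^ 2 - 1)) + 2 * c * d * z.re with hM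
  have hMp : 0 < M := rot_denom_pos h z
  have hx0 := abs_nonneg z.re
  obtain ⟨e1, e2⟩ := rot_denom_lower hm z h hc
  have hz0 : 0 ≤ nsq z + (m ^ 2 - 1) - 2 * m * |z.re| := by have := hz; unfold OutCircles at this; linarith
  have t1 : 0 ≤ c ^ 2 * (nsq z + (m ^ 2 - 1) - 2 * m * |z.re|) := by positivity
  have t2 : 0 ≤ 2 * |z.re| * (|c| * (m * |c| - |d|)) := by positivity
  have hM1 : 1 ≤ M := by linarith
  have him := rot_im h z
  have hinv : (rot m c d h)⁻¹ • rot m c d h • z = z := inv_smul_smul _ _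
  have h' : d ^ 2 - (m ^ 2 - 1) * (-c) ^ 2 = 1 := by linarith
  have him' : z.im = (rot m c d h • z).im / (1 + (-c) ^ 2 * (nsq (rot m c d h • z) + (m ^ 2 - 1)) +
      2 * (-c) * d * (rot m c d h • z).re) := by
    rw [← rot_im h', ← rot_inv m c d h, hinv]
  obtain ⟨e1', e2'⟩ := rot_denom_lower hm (rot m c d h • z) h' (by linarith)
  have hp' := rot_denom_pos h' (rot m c d h • z)
  have hM1' : 1 ≤ (1 + (-c) ^ 2 * (nsq (rot m c d h • z) + (m ^ 2 - 1)) +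
      2 * (-c) * d * (rot m c d h • z).re) := by
    have hx0 := abs_nonneg (rot m c d h • z).re
    have hz0 : 0 ≤ nsq (rot m c d h • z) + (m ^ 2 - 1) - 2 * m * |(rot m c d h • z).re| := by
      have := hz'; unfold OutCircles at this; linarith
    have t1 : 0 ≤ (-c) ^ 2 * (nsq (rot m c d h • z) + (m ^ 2 - 1) - 2 * m * |(rot m c d h • z).re|) := by
      positivity
    have t2 : 0 ≤ 2 * |(rot m c d h • z).re| * (|-c| * (m * |-c| - |d|)) := by positivity
    linarith
  have hy := z.im_pos
  have hle : z.im ≤ (rot m c d h • z).im := by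
    rw [him']
    exact div_le_self (rot m c d h • z).im_pos.le hM1'
  have hM1'' : M = 1 := by
    rw [him, le_div_iff₀ hMp] at hle
    nlinarith
  have hre := rot_re h z
  rw [← hM, hM1''] at hre him
  have f1 : c ^ 2 * (nsq z + (m ^ 2 - 1) - 2 * m * |z.re|) = 0 := by linarith
  have f2 : 2 * |z.re| * (|c| * (m * |c| - |d|)) = 0 := by linarith
  have f3 : nsq z + (m ^ 2 - 1) - 2 * m * |z.re| = 0 := by
    rcases mul_eq_zero.1 f1 with f | f
    · exact absurd f (by positivity)
    · exact f
  -- On the imaginary axis the second summand vanishes for free. This is the elliptic fixed point,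
  -- where the element cannot be determined.
  have f4 : z.re ≠ 0 → m * |c| = |d| := by
    intro hx
    have hx : 0 < |z.re| := abs_pos.2 hx
    rcases mul_eq_zero.1 f2 with f | f
    · linarith
    · rcases mul_eq_zero.1 f with f | f <;> linarith
  have f5 : z.re ≠ 0 → c ^ 2 = 1 := by
    intro hx
    have := congrArg (· ^ 2) (f4 hx)
    simp only [mul_pow, sq_abs] at this
    linarith
  have f6 : z.re ≠ 0 → m * |z.re| + c * d * z.re = 0 := by
    intro hx
    have g1 : nsq z + (m ^ 2 - 1) = 2 * m * |z.re| := by linarith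
    rw [f5 hx, g1] at hM
    linarith
  have f7 : z.re ≠ 0 → c = 1 ∨ c = -1 := fun hx => by simpa using f5 hx
  refine ⟨mul_left_cancel₀ hc0 (by linarith), by simpa using him, by linarith, fun hx => ?_,
    fun hx => ?_⟩
  · have g := f6 hx.ne'
    rw [abs_of_pos hx] at g
    have g : m + c * d = 0 := by
      rcases mul_eq_zero.1 (show (m + c * d) * z.re = 0 by linarith) with g | g
      · exact g
      · exact absurd g hx.ne'
    rw [rotGen, rot_inv]
    rcases f7 hx.ne' with rfl | rfl
    · rw [← rot_neg]; apply rot_congr <;> linarith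
    · apply rot_congr <;> linarith
  · have g := f6 hx.ne
    rw [abs_of_neg hx] at g
    have g : m - c * d = 0 := by
      rcases mul_eq_zero.1 (show (m - c * d) * z.re = 0 by linarith) with g | g
      · exact g
      · exact absurd g hx.ne
    rw [rotGen]
    rcases f7 hx.ne with rfl | rfl
    · apply rot_congr <;> linarith
    · rw [← rot_neg]; apply rot_congr <;> linarith

end

/-! ### The group in normal form and uniqueness in its fundamental domain. -/

/-- The group `G` is generated by a discrete group `K` of elements `[d, κ c; c, d]`, with
`κ = m ^ 2 - 1` and smallest entry `c = 1`, and by a translation of large length `2 * q`. -/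
structure Setup (m q : ℝ) (K G : Subgroup PSL2R) : Prop where
  nonneg : 0 ≤ m
  ne_one : m ≠ 1
  lt : m + 1 < q
  form : ∀ k ∈ K, k ≠ 1 → ∃ c d h, 1 ≤ c ^ 2 ∧ k = rot m c d h
  gen_mem : rotGen m ∈ K
  eq_sup : G = K ⊔ Subgroup.zpowers (shift (2 * q))
  fin : OrbitFinite G

/-- The fundamental domain of `G`. -/
def Fund (m q : ℝ) (z : ℍ) : Prop := |z.re| ≤ q ∧ OutCircles m z

/-- The sides of the fundamental domain that are paired by reflection in the imaginary axis. -/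
def Side (m q : ℝ) (z : ℍ) : Prop := |z.re| = q ∨ nsq z + (m ^ 2 - 1) = 2 * m * |z.re|

theorem nsq_congr {z w : ℍ} (h1 : w.re = -z.re) (h2 : w.im = z.im) : nsq w = nsq z := by
  rw [nsq, nsq, h1, h2, neg_sq]

theorem nsq_pos (z : ℍ) : 0 < nsq z := by
  have := z.im_pos
  unfold nsq; positivity

theorem abs_re_lt_of_not_outCircles {m : ℝ} {z : ℍ} (hz : nsq z + (m ^ 2 - 1) ≤ 2 * m * |z.re|) :
    |z.re| < m + 1 := by
  have hy := z.im_pos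
  unfold nsq at hz
  rw [← sq_abs z.re] at hz
  have : (|z.re| - m) ^ 2 < 1 := by nlinarith
  have := (abs_lt.1 ((sq_lt_one_iff_abs_lt_one _).1 this)).2
  linarith

namespace Setup

variable {m q : ℝ} {K G : Subgroup PSL2R}

theorem q_pos (S : Setup m q K G) : 0 < q := by linarith [S.nonneg, S.lt]

theorem K_le (S : Setup m q K G) : K ≤ G := S.eq_sup ▸ le_sup_left

theorem shift_mem (S : Setup m q K G) : shift (2 * q) ∈ G :=
  S.eq_sup ▸ (le_sup_right : Subgroup.zpowers (shift (2 * q)) ≤ _) (Subgroup.mem_zpowers _)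

theorem gen_mem' (S : Setup m q K G) : rotGen m ∈ G := S.K_le S.gen_mem

theorem K_unique (S : Setup m q K G) {k : PSL2R} (hk : k ∈ K) (hk1 : k ≠ 1) {z : ℍ}
    (hz : OutCircles m z) (hz' : OutCircles m (k • z)) :
    (k • z).re = -z.re ∧ (k • z).im = z.im ∧
      nsq z + (m ^ 2 - 1) = 2 * m * |z.re| ∧ (0 < z.re → k = (rotGen m)⁻¹) ∧
      (z.re < 0 → k = rotGen m) := by
  obtain ⟨c, d, h, hc, rfl⟩ := S.form k hk hk1
  exact rot_smul_of_outCircles S.nonneg h hc hz hz'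

theorem mul_comm_K (S : Setup m q K G) {k l : PSL2R} (hk : k ∈ K) (hl : l ∈ K) :
    k * l = l * k := by
  by_cases hk1 : k = 1
  · simp [hk1]
  by_cases hl1 : l = 1
  · simp [hl1]
  obtain ⟨c, d, h, hc, rfl⟩ := S.form k hk hk1
  obtain ⟨c', d', h', hc', rfl⟩ := S.form l hl hl1
  exact rot_comm _ _ _ _ _ _ _

theorem shift_unique (S : Setup m q K G) {l : PSL2R} (hl : l ∈ Subgroup.zpowers (shift (2 * q)))
    (hl1 : l ≠ 1) {z : ℍ} (hz : |z.re| ≤ q) (hz' : |(l • z).re| ≤ q) :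
    (l • z).re = -z.re ∧ (l • z).im = z.im ∧ |z.re| = q ∧
      (0 < z.re → l = (shift (2 * q))⁻¹) ∧ (z.re < 0 → l = shift (2 * q)) := by
  obtain ⟨n, rfl⟩ := hl
  have hn : n ≠ 0 := by rintro rfl; exact hl1 (by simp)
  have hq := S.q_pos
  simp only [shift_zpow, shift_inv] at *
  rw [shift_re] at *
  rw [shift_im]
  rw [abs_le] at hz hz'
  rcases lt_or_gt_of_ne hn with hn | hn
  · have h1 : (n : ℝ) ≤ -1 := by exact_mod_cast Int.le_sub_one_of_lt hn
    have h2 : n = -1 := by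
      have : (-1 : ℝ) ≤ n := by nlinarith
      have : -1 ≤ n := by exact_mod_cast this
      omega
    subst h2
    push_cast at *
    have h3 : z.re = q := by linarith
    rw [h3]
    refine ⟨by ring, rfl, abs_of_pos hq, fun _ => by congr 1; ring, fun h => by linarith⟩
  · have h1 : (1 : ℝ) ≤ n := by exact_mod_cast hn
    have h2 : n = 1 := by
      have : (n : ℝ) ≤ 1 := by nlinarith
      have : n ≤ 1 := by exact_mod_cast this
      omega
    subst h2
    push_cast at *
    have h3 : z.re = -q := by linarith
    rw [h3]
    refine ⟨by ring, rfl, by rw [abs_neg, abs_of_pos hq], fun h => by linarith,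
      fun h => by congr 1; ring⟩

/-- Two points of the fundamental domain in the same orbit are equal, or lie on paired sides. -/
theorem unique (S : Setup m q K G) {g : PSL2R} (hg : g ∈ G) {z : ℍ} (hz : Fund m q z)
    (hz' : Fund m q (g • z)) :
    g = 1 ∨ ((g • z).re = -z.re ∧ (g • z).im = z.im ∧ Side m q z ∧
      (0 < z.re → g = (shift (2 * q))⁻¹ ∨ g = (rotGen m)⁻¹) ∧
      (z.re < 0 → g = shift (2 * q) ∨ g = rotGen m) ∧ (|z.re| < q → g ∈ K) ∧
      (2 * m * |z.re| < nsq z + (m ^ 2 - 1) → g ∈ Subgroup.zpowers (shift (2 * q)))) := by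
  by_cases hg1 : g = 1
  · exact .inl hg1
  right
  have hg' := hg
  rw [S.eq_sup] at hg'
  obtain ⟨b, hb⟩ := (exists_isReduced hg').resolve_left hg1
  have hL : g ∈ Subgroup.zpowers (shift (2 * q)) → ((g • z).re = -z.re ∧ (g • z).im = z.im ∧
      Side m q z ∧ (0 < z.re → g = (shift (2 * q))⁻¹ ∨ g = (rotGen m)⁻¹) ∧
      (z.re < 0 → g = shift (2 * q) ∨ g = rotGen m) ∧ (|z.re| < q → g ∈ K) ∧
      (2 * m * |z.re| < nsq z + (m ^ 2 - 1) → g ∈ Subgroup.zpowers (shift (2 * q)))) := fun h => by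
    obtain ⟨h1, h2, h3, h4, h5⟩ := S.shift_unique h hg1 hz.1 hz'.1
    exact ⟨h1, h2, .inl h3, fun h => .inl (h4 h), fun h => .inl (h5 h),
      fun h => by linarith, fun _ => h⟩
  have hK : g ∈ K → ((g • z).re = -z.re ∧ (g • z).im = z.im ∧
      Side m q z ∧ (0 < z.re → g = (shift (2 * q))⁻¹ ∨ g = (rotGen m)⁻¹) ∧
      (z.re < 0 → g = shift (2 * q) ∨ g = rotGen m) ∧ (|z.re| < q → g ∈ K) ∧
      (2 * m * |z.re| < nsq z + (m ^ 2 - 1) → g ∈ Subgroup.zpowers (shift (2 * q)))) := fun h => by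
    obtain ⟨h1, h2, h3, h4, h5⟩ := S.K_unique h hg1 hz.2 hz'.2
    exact ⟨h1, h2, .inr h3, fun h => .inr (h4 h), fun h => .inr (h5 h),
      fun _ => h, fun h => by linarith⟩
  have key := hb.pingpong (X := ℍ) (P := OutCircles m)
    (P' := fun z => 2 * m * |z.re| < nsq z + (m ^ 2 - 1)) (Q := fun z => |z.re| ≤ q)
    (Q' := fun z => |z.re| < q) ?_ ?_ ?_ ?_ (fun z hz => le_of_lt hz) (fun z hz => le_of_lt hz) ?_
  · rcases key.2 with h | h
    · cases b
      · exact hL (by simpa using h)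
      · exact hK (by simpa using h)
    · have := h z hz.2 hz.1
      cases b
      · exact absurd hz'.1 (by simpa using this)
      · exact absurd hz'.2 (by simpa using this)
  · intro k hk hk1 z hz hz'
    have hkz : k⁻¹ • k • z = z := inv_smul_smul _ _
    have := (S.K_unique (K.inv_mem hk) (inv_ne_one.2 hk1) hz'.le (hkz.symm ▸ hz)).2.2.1
    linarith
  · intro k hk hk1 z hz hz'
    have := (S.K_unique hk hk1 hz.le hz').2.2.1
    linarith
  · intro k hk hk1 z hz hz'
    have hkz : k⁻¹ • k • z = z := inv_smul_smul _ _
    have := (S.shift_unique (Subgroup.inv_mem _ hk) (inv_ne_one.2 hk1) hz'.le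
      (by rw [hkz]; exact hz)).2.2.1
    linarith
  · intro k hk hk1 z hz hz'
    have := (S.shift_unique hk hk1 hz.le hz').2.2.1
    linarith
  · intro z
    -- The closed discs lie in `|re z| < m + 1 < q`, so a point that is not outside the circles is
    -- in the open strip.
    by_cases h : 2 * m * |z.re| < nsq z + (m ^ 2 - 1)
    · exact .inl h
    · exact .inr ((abs_re_lt_of_not_outCircles (not_lt.1 h)).trans S.lt)

end Setup

/-! ### The fundamental domain as a Dirichlet domain, and functions on the quotient. -/

/-- A base point on the imaginary axis. -/
noncomputable def basePt : ℍ := ⟨⟨0, 2⟩, by norm_num⟩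

theorem dist_basePt_le_iff (z w : ℍ) : dist z basePt ≤ dist w basePt ↔
    (z.re ^ 2 + (z.im - 2) ^ 2) * w.im ≤ (w.re ^ 2 + (w.im - 2) ^ 2) * z.im := by
  have hz := z.im_pos
  have hw := w.im_pos
  rw [← abs_of_nonneg (dist_nonneg (x := z) (y := basePt)),
    ← abs_of_nonneg (dist_nonneg (x := w) (y := basePt)), ← Real.cosh_le_cosh,
    UpperHalfPlane.cosh_dist, UpperHalfPlane.cosh_dist, Complex.dist_eq, Complex.dist_eq,
    Complex.sq_norm, Complex.sq_norm, Complex.normSq_apply, Complex.normSq_apply]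
  have e1 : basePt.im = 2 := rfl
  have e2 : basePt.re = 0 := rfl
  simp only [Complex.sub_re, Complex.sub_im, e1, e2, sub_zero, UpperHalfPlane.coe_re,
    UpperHalfPlane.coe_im, add_le_add_iff_left]
  rw [div_le_div_iff₀ (by positivity) (by positivity)]
  constructor <;> intro h <;> nlinarith

theorem dist_basePt_congr {z w : ℍ} (h1 : w.re = -z.re) (h2 : w.im = z.im) :
    dist w basePt = dist z basePt := by
  apply le_antisymm <;> rw [dist_basePt_le_iff, h1, h2, neg_sq]

/-- For `c ^ 2 = 1` the element is the inversion in its isometric circle followed by the reflection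
in the imaginary axis, which fixes `basePt`. So the isometric circle is a perpendicular bisector,
and being nearest to `basePt` means lying outside it. -/
theorem one_le_denom_of_dist_le {m c d : ℝ} (h : d ^ 2 - (m ^ 2 - 1) * c ^ 2 = 1) (hc : c ^ 2 = 1)
    {z : ℍ} (hz : dist z basePt ≤ dist (rot m c d h • z) basePt) :
    0 ≤ nsq z + (m ^ 2 - 1) + 2 * c * d * z.re := by
  rw [dist_basePt_le_iff] at hz
  have hM := rot_denom_pos h z
  have h1 := rot_re h z
  rw [rot_im] at hz
  have hre2 : (rot m c d h • z).re ^ 2 = (d - (c * z.re + d) /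
      (1 + c ^ 2 * (nsq z + (m ^ 2 - 1)) + 2 * c * d * z.re)) ^ 2 := by
    rw [← h1, mul_pow, hc, one_mul]
  rw [hre2] at hz
  have hm := h
  rw [hc] at hm
  rw [hc, one_mul] at hz hM
  have hy := z.im_pos
  set M := 1 + (nsq z + (m ^ 2 - 1)) + 2 * c * d * z.re with hMd
  have hz2 : (z.re ^ 2 + (z.im - 2) ^ 2) * M ≤ (d * M - (c * z.re + d)) ^ 2 + (z.im - 2 * M) ^ 2 := by
    have e : ((d - (c * z.re + d) / M) ^ 2 + (z.im / M - 2) ^ 2) * z.im =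
      ((d * M - (c * z.re + d)) ^ 2 + (z.im - 2 * M) ^ 2) * z.im / M ^ 2 := by
      field_simp
    rw [e, ← mul_div_assoc, div_le_div_iff₀ hM (by positivity)] at hz
    have := mul_pos hM hy
    refine le_of_mul_le_mul_right ?_ this
    nlinarith
  have hMN : M = (c * z.re + d) ^ 2 + z.im ^ 2 := by
    rw [hMd, nsq]
    linear_combination -z.re ^ 2 * hc - hm
  have hd : d ^ 2 = m ^ 2 := by linarith
  have hMd' : M = z.re ^ 2 + z.im ^ 2 + d ^ 2 + 2 * c * d * z.re := by
    rw [hMd, nsq]; linarith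
  -- The factor `(m ^ 2 - 1) + 4` is positive because the height `2` of the base point exceeds `1`:
  -- the base point is outside the isometric circle for every `m`.
  have hid : (d * M - (c * z.re + d)) ^ 2 + (z.im - 2 * M) ^ 2 - (z.re ^ 2 + (z.im - 2) ^ 2) * M =
      M * (((m ^ 2 - 1) + 4) * (M - 1)) := by
    linear_combination -hMN + M * hMd' + M * (M - 1) * hd
  have : 0 ≤ M * (((m ^ 2 - 1) + 4) * (M - 1)) := by linarith
  have h3 := nonneg_of_mul_nonneg_right this hM
  have h4 := nonneg_of_mul_nonneg_right h3 (by nlinarith)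
  linarith

theorem outCircles_of_dist_le {m : ℝ} {z : ℍ}
    (h1 : dist z basePt ≤ dist (rotGen m • z) basePt)
    (h2 : dist z basePt ≤ dist ((rotGen m)⁻¹ • z) basePt) : OutCircles m z := by
  rw [rotGen, rot_inv] at h2
  have e1 := one_le_denom_of_dist_le _ (by norm_num) h1
  have e2 := one_le_denom_of_dist_le _ (by norm_num) h2
  unfold OutCircles
  rcases abs_cases z.re with ⟨h, -⟩ | ⟨h, -⟩ <;> rw [h] <;> linarith

theorem abs_re_le_of_dist_le {q : ℝ} (hq : 0 < q) {z : ℍ}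
    (h1 : dist z basePt ≤ dist (shift (2 * q) • z) basePt)
    (h2 : dist z basePt ≤ dist ((shift (2 * q))⁻¹ • z) basePt) : |z.re| ≤ q := by
  rw [shift_inv] at h2
  rw [dist_basePt_le_iff, shift_re, shift_im] at h1 h2
  have hy := z.im_pos
  have e1 := le_of_mul_le_mul_right h1 hy
  have e2 := le_of_mul_le_mul_right h2 hy
  rw [abs_le]
  constructor
  · by_contra! h; nlinarith
  · by_contra! h; nlinarith

namespace Setup

variable {m q : ℝ} {K G : Subgroup PSL2R}

theorem exists_fund (S : Setup m q K G) (z : ℍ) : ∃ g ∈ G, Fund m q (g • z) ∧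
    ∀ g' ∈ G, dist (g • z) basePt ≤ dist (g' • g • z) basePt := by
  obtain ⟨g, hg, hmin⟩ := S.fin.exists_closest z basePt
  exact ⟨g, hg, ⟨abs_re_le_of_dist_le S.q_pos (hmin _ S.shift_mem) (hmin _ (inv_mem S.shift_mem)),
    outCircles_of_dist_le (hmin _ S.gen_mem') (hmin _ (inv_mem S.gen_mem'))⟩, hmin⟩

theorem exists_outCircles (S : Setup m q K G) (z : ℍ) : ∃ k ∈ K, OutCircles m (k • z) := by
  obtain ⟨g, hg, hmin⟩ := (S.fin.mono S.K_le).exists_closest z basePt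
  exact ⟨g, hg, outCircles_of_dist_le (hmin _ S.gen_mem) (hmin _ (inv_mem S.gen_mem))⟩

/-- The nearest orbit point in the domain is the given point or its mirror image, by `unique`, and
`basePt` is equidistant from these. -/
theorem dist_le (S : Setup m q K G) {z : ℍ} (hz : Fund m q z) {g : PSL2R} (hg : g ∈ G) :
    dist z basePt ≤ dist (g • z) basePt := by
  obtain ⟨g₀, hg₀, hF, hmin⟩ := S.exists_fund z
  have h1 : dist (g₀ • z) basePt = dist z basePt := by
    rcases S.unique hg₀ hz hF with rfl | ⟨h1, h2, -⟩
    · rw [one_smul]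
    · exact dist_basePt_congr h1 h2
  have h2 := hmin (g * g₀⁻¹) (mul_mem hg (inv_mem hg₀))
  rwa [← mul_smul, inv_mul_cancel_right, h1] at h2

theorem isClosed_fund (m q : ℝ) : IsClosed {z | Fund m q z} := by
  have h1 := UpperHalfPlane.continuous_re
  have h2 := UpperHalfPlane.continuous_im
  have h3 : IsClosed {z : ℍ | |z.re| ≤ q} := isClosed_le (by fun_prop) (by fun_prop)
  have h4 : IsClosed {z : ℍ | 2 * m * |z.re| ≤ z.re ^ 2 + z.im ^ 2 + (m ^ 2 - 1)} :=
    isClosed_le (by fun_prop) (by fun_prop)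
  exact h3.inter h4

/-- If `w` is near `z` and `g • w` lies in the domain, then `g⁻¹ • basePt` is no farther from `w`
than `basePt` is. So `g⁻¹` moves `basePt` into a fixed ball about `z`, which only finitely many
elements do. -/
theorem locallyFinite (S : Setup m q K G) :
    LocallyFinite fun g : G => {z : ℍ | Fund m q (g • z)} := by
  intro z
  refine ⟨Metric.ball z 1, Metric.ball_mem_nhds z one_pos, ?_⟩
  have hfin := (S.fin basePt z (2 + dist z basePt)).image fun g : PSL2R => g⁻¹
  have : Set.InjOn (Subtype.val : G → PSL2R) (Subtype.val ⁻¹'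
      ((fun g : PSL2R => g⁻¹) '' {g | g ∈ G ∧ dist z (g • basePt) ≤ 2 + dist z basePt})) :=
    Subtype.val_injective.injOn
  refine (hfin.preimage this).subset ?_
  rintro g ⟨w, hw, hwz⟩
  refine ⟨(g : PSL2R)⁻¹, ⟨inv_mem g.2, ?_⟩, inv_inv _⟩
  have h1 := S.dist_le hw (inv_mem g.2)
  have h2 : (g : PSL2R)⁻¹ • g • w = w := inv_smul_smul (g : PSL2R) w
  rw [h2] at h1
  have h3 : dist w ((g : PSL2R)⁻¹ • basePt) = dist (g • w) basePt := by
    rw [← dist_smul_smul (g : PSL2R), smul_inv_smul]; rfl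
  rw [Metric.mem_ball] at hwz
  have h4 := dist_triangle z w ((g : PSL2R)⁻¹ • basePt)
  have h5 := dist_triangle w z basePt
  rw [dist_comm z w] at h4
  linarith

/-- A continuous function on the fundamental domain that agrees on paired sides gives a
continuous function on the quotient. -/
theorem exists_lift (S : Setup m q K G) {Y : Type*} [TopologicalSpace Y] (φ : ℍ → Y)
    (hφ : ContinuousOn φ {z | Fund m q z})
    (hside : ∀ z w, w.re = -z.re → w.im = z.im → Fund m q z → Side m q z → φ w = φ z) :
    ∃ f : Surface G → Y, Continuous f ∧ ∀ z, Fund m q z → f (proj G z) = φ z := by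
  have hrep : ∀ x : Surface G, ∃ z, Fund m q z ∧ proj G z = x := by
    intro x
    obtain ⟨z, rfl⟩ := proj_surjective G x
    obtain ⟨g, hg, hF, -⟩ := S.exists_fund z
    exact ⟨g • z, hF, proj_smul hg z⟩
  choose r hr hrx using hrep
  have key : ∀ z, Fund m q z → φ (r (proj G z)) = φ z := by
    intro z hz
    obtain ⟨g, hg, hgz⟩ := proj_eq_proj.1 (hrx (proj G z))
    have h := S.unique hg hz (by rw [hgz]; exact hr _)
    rw [hgz] at h
    rcases h with rfl | ⟨h1, h2, h3, -⟩
    · rw [← hgz, one_smul]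
    · exact hside _ _ h1 h2 hz h3
  -- By `key` the choice of representatives is irrelevant. Continuity is checked on the locally
  -- finite closed cover by translates of the domain.
  refine ⟨fun x => φ (r x), ?_, key⟩
  refine continuous_coinduced_dom.2 ?_
  change Continuous fun z => φ (r (proj G z))
  refine S.locallyFinite.continuous ?_ ?_ ?_
  · refine Set.eq_univ_of_forall fun z => ?_
    obtain ⟨g, hg, hF, -⟩ := S.exists_fund z
    exact Set.mem_iUnion.2 ⟨⟨g, hg⟩, hF⟩
  · intro g
    exact (isClosed_fund m q).preimage (continuous_smul_psl g)
  · intro g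
    have : ContinuousOn (fun z : ℍ => φ (g • z)) {z : ℍ | Fund m q (g • z)} :=
      hφ.comp (continuous_smul_psl g).continuousOn fun z hz => hz
    refine this.congr fun z hz => ?_
    have h := key _ hz
    rwa [show proj G (g • z) = proj G z from proj_smul g.2 z] at h

/-- Two points of the fundamental domain with the same image in the quotient have the same
absolute value of the real part, and the same imaginary part. -/
theorem eq_of_proj_eq (S : Setup m q K G) {z w : ℍ} (hz : Fund m q z) (hw : Fund m q w)
    (h : proj G z = proj G w) : |z.re| = |w.re| ∧ z.im = w.im := by
  obtain ⟨g, hg, rfl⟩ := proj_eq_proj.1 h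
  rcases S.unique hg hw hz with rfl | ⟨h1, h2, -⟩
  · rw [one_smul]; exact ⟨rfl, rfl⟩
  · rw [h1, h2, abs_neg]; exact ⟨rfl, rfl⟩

/-- Reflection in the imaginary axis pairs the sides of the fundamental domain. -/
theorem proj_eq_of_side (S : Setup m q K G) {z w : ℍ} (h1 : w.re = -z.re) (h2 : w.im = z.im)
    (h : Side m q z) : proj G w = proj G z := by
  rcases h with h | h
  · rcases abs_cases z.re with ⟨h3, -⟩ | ⟨h3, -⟩
    · refine proj_eq_proj.2 ⟨(shift (2 * q))⁻¹, inv_mem S.shift_mem, ?_⟩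
      rw [shift_inv]
      apply UpperHalfPlane.ext_re_im
      · rw [shift_re, h1]; linarith
      · rw [shift_im, h2]
    · refine proj_eq_proj.2 ⟨shift (2 * q), S.shift_mem, ?_⟩
      apply UpperHalfPlane.ext_re_im
      · rw [shift_re, h1]; linarith
      · rw [shift_im, h2]
  · rcases abs_cases z.re with ⟨h3, -⟩ | ⟨h3, -⟩
    · refine proj_eq_proj.2 ⟨(rotGen m)⁻¹, inv_mem S.gen_mem', ?_⟩
      rw [rotGen, rot_inv]
      have hM : 1 + (-1) ^ 2 * (nsq z + (m ^ 2 - 1)) + 2 * (-1) * m * z.re = 1 := by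
        rw [h, h3]; ring
      apply UpperHalfPlane.ext_re_im
      · have := rot_re (c := -1) (d := m) (m := m) (by ring) z
        rw [hM] at this
        rw [h1]; linarith
      · rw [rot_im, hM, h2, div_one]
    · refine proj_eq_proj.2 ⟨rotGen m, S.gen_mem', ?_⟩
      rw [rotGen]
      have hM : 1 + 1 ^ 2 * (nsq z + (m ^ 2 - 1)) + 2 * 1 * m * z.re = 1 := by
        rw [h, h3]; ring
      apply UpperHalfPlane.ext_re_im
      · have := rot_re (c := 1) (d := m) (m := m) (by ring) z
        rw [hM] at this
        rw [h1]; linarith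
      · rw [rot_im, hM, h2, div_one]

end Setup

/-! ### The chart in elliptic coordinates. -/

section

/-- In the coordinates `x = |re z|` and `|z| ^ 2`, in which geodesics are straight lines, the
half of a Y-piece lies above the graph of this function. -/
noncomputable def lowBd (m q x : ℝ) : ℝ :=
  max (m ^ 2 - 1) (max (2 * m * x - (m ^ 2 - 1)) (2 * q * x - 2 * q * m + (m ^ 2 - 1)))

/-- The left end of the middle part of the graph of `lowBd`. -/
noncomputable def leftEnd (m : ℝ) : ℝ := max ((m ^ 2 - 1) / m) 0

/-- The right end of the middle part of the graph of `lowBd`. -/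
noncomputable def rightEnd (m q : ℝ) : ℝ := m + 1 / (q - m)

/-- The function that is linear from `0` to `1` on the middle part, and constant outside. -/
noncomputable def ramp (m q x : ℝ) : ℝ :=
  max 0 (min 1 ((x - leftEnd m) / (rightEnd m q - leftEnd m)))

/-- The height above the graph of `lowBd`. -/
noncomputable def hgt (m q : ℝ) (z : ℍ) : ℝ := max (nsq z - lowBd m q |z.re|) 0

/-- A family of functions from `[0, q]` to `[0, 1]`, strictly increasing for `0 < n`. -/
noncomputable def slide (m q n x : ℝ) : ℝ := (ramp m q x + n * (x / q)) / (1 + n)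

/-- The second elliptic coordinate. -/
noncomputable def ang (m q : ℝ) (z : ℍ) : ℝ := slide m q (hgt m q z) |z.re|

/-- The absolute value of the imaginary part of `chart`. -/
noncomputable def chartIm (m q : ℝ) (z : ℍ) : ℝ :=
  2 * √(hgt m q z * (hgt m q z + 1) * (ang m q z * (1 - ang m q z)))

/-- The map from the fundamental domain to the complex plane with `hgt` and `ang` as elliptic
coordinates with foci `0` and `1`. -/
noncomputable def chart (m q : ℝ) (z : ℍ) : ℂ :=
  ⟨(1 + (2 * hgt m q z + 1) * (2 * ang m q z - 1)) / 2,
    if 0 ≤ z.re then chartIm m q z else -chartIm m q z⟩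

variable {m q : ℝ}

section Ends

theorem leftEnd_nonneg (m : ℝ) : 0 ≤ leftEnd m := le_max_right _ _

theorem leftEnd_le (hm : 0 ≤ m) : leftEnd m ≤ m := by
  refine max_le ?_ hm
  rcases hm.eq_or_lt with rfl | hm
  · simp
  · rw [div_le_iff₀ hm]; nlinarith

theorem le_leftEnd {x : ℝ} (hm : 0 < m) (hx : m * x ≤ m ^ 2 - 1) : x ≤ leftEnd m :=
  (by rw [le_div_iff₀ hm]; linarith : x ≤ (m ^ 2 - 1) / m).trans (le_max_left _ _)

theorem lt_rightEnd (hq : m + 1 < q) : m < rightEnd m q := by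
  have : 0 < 1 / (q - m) := by apply one_div_pos.2; linarith
  unfold rightEnd; linarith

theorem rightEnd_lt (hq : m + 1 < q) : rightEnd m q < q := by
  have : 1 / (q - m) < 1 := by rw [div_lt_one] <;> linarith
  unfold rightEnd; linarith

/-- The abscissa `rightEnd` is where the line of the isometric circle crosses the line of the axis
of `genV`; the slopes differ by `2 * (q - m)`. -/
theorem right_line (hq : m + 1 < q) (x : ℝ) :
    2 * m * x - (m ^ 2 - 1) - (2 * q * x - 2 * q * m + (m ^ 2 - 1)) =
      2 * (q - m) * (rightEnd m q - x) := by
  have : q - m ≠ 0 := by linarith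
  unfold rightEnd
  field_simp
  ring

theorem width_pos (hm : 0 ≤ m) (hq : m + 1 < q) : 0 < rightEnd m q - leftEnd m := by
  linarith [leftEnd_le hm, lt_rightEnd hq]

theorem ramp_eq_zero_iff (hm : 0 ≤ m) (hq : m + 1 < q) {x : ℝ} :
    ramp m q x = 0 ↔ x ≤ leftEnd m := by
  have hw := width_pos hm hq
  unfold ramp
  rw [max_eq_left_iff, min_le_iff, div_le_iff₀ hw, zero_mul]
  constructor
  · rintro (h | h) <;> linarith
  · intro h; right; linarith

theorem ramp_eq_one_iff (hm : 0 ≤ m) (hq : m + 1 < q) {x : ℝ} :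
    ramp m q x = 1 ↔ rightEnd m q ≤ x := by
  have hw := width_pos hm hq
  unfold ramp
  constructor
  · intro h
    by_contra! hx
    have : (x - leftEnd m) / (rightEnd m q - leftEnd m) < 1 := by
      rw [div_lt_one hw]; linarith
    have h2 : max 0 (min 1 ((x - leftEnd m) / (rightEnd m q - leftEnd m))) < 1 :=
      max_lt one_pos ((min_le_right _ _).trans_lt this)
    linarith
  · intro h
    have : 1 ≤ (x - leftEnd m) / (rightEnd m q - leftEnd m) := by
      rw [one_le_div hw]; linarith
    rw [min_eq_left this, max_eq_right zero_le_one]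

theorem ramp_mono (hm : 0 ≤ m) (hq : m + 1 < q) : Monotone (ramp m q) := by
  intro x y hxy
  have hw := width_pos hm hq
  unfold ramp
  gcongr

theorem ramp_of_mem {x : ℝ} (h0 : 0 < ramp m q x) (h1 : ramp m q x < 1) :
    ramp m q x = (x - leftEnd m) / (rightEnd m q - leftEnd m) := by
  unfold ramp at *
  rcases max_choice 0 (min 1 ((x - leftEnd m) / (rightEnd m q - leftEnd m))) with h | h
  · linarith
  · rw [h] at h0 h1 ⊢
    rcases min_choice 1 ((x - leftEnd m) / (rightEnd m q - leftEnd m)) with h' | h'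
    · linarith
    · rw [h']

theorem continuous_ramp (m q : ℝ) : Continuous (ramp m q) := by
  unfold ramp; fun_prop

theorem slide_zero (m q x : ℝ) : slide m q 0 x = ramp m q x := by simp [slide]

theorem slide_left (hm : 0 ≤ m) (hq : m + 1 < q) (n : ℝ) : slide m q n 0 = 0 := by
  rw [slide, (ramp_eq_zero_iff hm hq).2 (leftEnd_nonneg m)]; simp

theorem slide_right (hm : 0 ≤ m) (hq : m + 1 < q) {n : ℝ} (hn : 0 ≤ n) : slide m q n q = 1 := by
  rw [slide, (ramp_eq_one_iff hm hq).2 (rightEnd_lt hq).le, div_self (by linarith), mul_one,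
    div_self (by linarith)]

theorem slide_mono (hm : 0 ≤ m) (hq : m + 1 < q) {n : ℝ} (hn : 0 ≤ n) :
    Monotone (slide m q n) := by
  intro x y hxy
  have := ramp_mono hm hq hxy
  have hq0 : 0 < q := by linarith
  unfold slide
  gcongr

theorem slide_strictMono (hm : 0 ≤ m) (hq : m + 1 < q) {n : ℝ} (hn : 0 < n) :
    StrictMono (slide m q n) := by
  intro x y hxy
  have := ramp_mono hm hq hxy.le
  have hq0 : 0 < q := by linarith
  have h2 : n * (x / q) < n * (y / q) := by gcongr
  unfold slide
  gcongr ?_ / _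
  linarith

theorem slide_mem (hm : 0 ≤ m) (hq : m + 1 < q) {n x : ℝ} (hn : 0 ≤ n) (hx : 0 ≤ x)
    (hxq : x ≤ q) : 0 ≤ slide m q n x ∧ slide m q n x ≤ 1 := by
  have h1 := slide_mono hm hq hn hx
  have h2 := slide_mono hm hq hn hxq
  rw [slide_left hm hq] at h1
  rw [slide_right hm hq hn] at h2
  exact ⟨h1, h2⟩

/-- At `n = 0` the function is `ramp`, which is constant on both outer parts of the graph; this is
what collapses the parts beyond `u` and `v`. Injectivity there holds only for values strictly
between `0` and `1`. -/
theorem slide_inj (hm : 0 ≤ m) (hq : m + 1 < q) {n x y : ℝ} (hn : 0 ≤ n)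
    (h : n = 0 → 0 < slide m q n x ∧ slide m q n x < 1) (hxy : slide m q n x = slide m q n y) :
    x = y := by
  rcases hn.eq_or_lt with rfl | hn
  · obtain ⟨h0, h1⟩ := h rfl
    have h0' := h0
    have h1' := h1
    rw [hxy] at h0' h1'
    rw [slide_zero] at *
    rw [slide_zero] at *
    rw [ramp_of_mem h0 h1, ramp_of_mem h0' h1',
      div_left_inj' (width_pos hm hq).ne'] at hxy
    linarith
  · exact (slide_strictMono hm hq hn).injective hxy

theorem exists_slide (hm : 0 ≤ m) (hq : m + 1 < q) {n a : ℝ} (hn : 0 ≤ n) (ha : 0 ≤ a)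
    (ha1 : a ≤ 1) : ∃ x, 0 ≤ x ∧ x ≤ q ∧ slide m q n x = a := by
  have hc : Continuous (slide m q n) := by
    have := continuous_ramp m q
    unfold slide; fun_prop
  have := intermediate_value_Icc (f := slide m q n) (show (0 : ℝ) ≤ q by linarith) hc.continuousOn
  rw [slide_left hm hq, slide_right hm hq hn] at this
  obtain ⟨x, hx, h⟩ := this ⟨ha, ha1⟩
  exact ⟨x, hx.1, hx.2, h⟩

/-- The region above the graph of `lowBd` lies in the hyperbolic plane. -/
theorem sq_lt_lowBd (hm : 0 ≤ m) (hm1 : m ≠ 1) (hq : m + 1 < q) {x : ℝ} (hx : 0 ≤ x)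
    (hxq : x ≤ q) : x ^ 2 < lowBd m q x := by
  unfold lowBd
  rw [lt_max_iff, lt_max_iff]
  -- The real line is the parabola `x ^ 2` in these coordinates. The isometric circle exceeds it for
  -- `|x - m| < 1`, the axis of `genV` for `x ≥ m + 1`, and the axis of `rotGen m` for `x ≤ m - 1`.
  -- The last needs `m ≠ 1`: in the parabolic case the graph touches the parabola at `0`.
  rcases lt_or_ge (|x - m|) 1 with h | h
  · right; left
    have := (sq_lt_one_iff_abs_lt_one _).2 h
    nlinarith
  · rcases le_abs.1 h with h | h
    · right; right
      nlinarith
    · left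
      rcases lt_or_gt_of_ne hm1 with h1 | h1
      · linarith
      · nlinarith

end Ends

theorem hgt_nonneg (m q : ℝ) (z : ℍ) : 0 ≤ hgt m q z := le_max_right _ _

section Chart

/-- These are the distances to the foci `0` and `1`. They determine the height and the angle, and
conversely the value of the chart up to complex conjugation. -/
theorem chart_normSq (hm : 0 ≤ m) (hq : m + 1 < q) {z : ℍ} (hz : |z.re| ≤ q) :
    ‖chart m q z‖ = hgt m q z + ang m q z ∧ ‖chart m q z - 1‖ = hgt m q z + 1 - ang m q z := by
  have hn := hgt_nonneg m q z
  obtain ⟨ha, ha1⟩ : 0 ≤ ang m q z ∧ ang m q z ≤ 1 := slide_mem hm hq hn (abs_nonneg _) hz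
  have hY : (if 0 ≤ z.re then chartIm m q z else -chartIm m q z) ^ 2 =
      4 * (hgt m q z * (hgt m q z + 1) * (ang m q z * (1 - ang m q z))) := by
    have : chartIm m q z ^ 2 = 4 * (hgt m q z * (hgt m q z + 1) * (ang m q z * (1 - ang m q z))) := by
      rw [chartIm, mul_pow, Real.sq_sqrt]
      · ring
      · have : 0 ≤ 1 - ang m q z := by linarith
        positivity
    split_ifs
    · exact this
    · rw [neg_sq, this]
  constructor
  · rw [← abs_of_nonneg (norm_nonneg (chart m q z)), ← abs_of_nonneg (by positivity : 0 ≤ hgt m q z + ang m q z), ← sq_eq_sq_iff_abs_eq_abs,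
      Complex.sq_norm, Complex.normSq_apply, ← sq, ← sq]
    simp only [chart]
    rw [hY]; ring
  · have h3 : 0 ≤ hgt m q z + 1 - ang m q z := by linarith
    rw [← abs_of_nonneg (norm_nonneg (chart m q z - 1)), ← abs_of_nonneg h3, ← sq_eq_sq_iff_abs_eq_abs,
      Complex.sq_norm, Complex.normSq_apply, ← sq, ← sq]
    simp only [chart, Complex.sub_re, Complex.sub_im, Complex.one_re, Complex.one_im, sub_zero]
    rw [hY]; ring

theorem continuous_hgt (m q : ℝ) : Continuous (hgt m q) := by
  have h1 := UpperHalfPlane.continuous_re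
  have h2 := UpperHalfPlane.continuous_im
  unfold hgt nsq lowBd
  fun_prop

theorem continuous_ang (m q : ℝ) : Continuous (ang m q) := by
  have h1 := UpperHalfPlane.continuous_re
  have h2 := continuous_hgt m q
  have h3 := continuous_ramp m q
  unfold ang slide
  refine Continuous.div ?_ (by fun_prop) fun z => ?_
  · exact (h3.comp h1.abs).add (h2.mul (h1.abs.div_const q))
  · have := hgt_nonneg m q z; positivity

theorem chartIm_of_re_eq_zero (hm : 0 ≤ m) (hq : m + 1 < q) {z : ℍ} (hz : z.re = 0) :
    chartIm m q z = 0 := by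
  unfold chartIm ang
  rw [hz, abs_zero, slide_left hm hq]; simp

theorem continuous_chart (hm : 0 ≤ m) (hq : m + 1 < q) : Continuous (chart m q) := by
  have h1 := UpperHalfPlane.continuous_re
  have h2 := continuous_hgt m q
  have h3 := continuous_ang m q
  have h4 : Continuous (chartIm m q) := by unfold chartIm; fun_prop
  have h5 : Continuous fun z : ℍ => if 0 ≤ z.re then chartIm m q z else -chartIm m q z :=
    Continuous.if_le h4 h4.neg continuous_const h1 fun z hz => by
      rw [chartIm_of_re_eq_zero hm hq hz.symm, neg_zero]
  have h6 : Continuous fun z : ℍ => (1 + (2 * hgt m q z + 1) * (2 * ang m q z - 1)) / 2 := by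
    fun_prop
  have h7 : Continuous fun z : ℍ => (((1 + (2 * hgt m q z + 1) * (2 * ang m q z - 1)) / 2 : ℝ) : ℂ) +
      ((if 0 ≤ z.re then chartIm m q z else -chartIm m q z : ℝ) : ℂ) * Complex.I :=
    (Complex.continuous_ofReal.comp h6).add
      ((Complex.continuous_ofReal.comp h5).mul continuous_const)
  convert h7 using 2 with z
  rw [← Complex.mk_eq_add_mul_I]; rfl

theorem hgt_congr {z w : ℍ} (h1 : |w.re| = |z.re|) (h2 : w.im = z.im) : hgt m q w = hgt m q z := by
  unfold hgt nsq
  rw [← sq_abs w.re, h1, h2, sq_abs]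

theorem ang_congr {z w : ℍ} (h1 : |w.re| = |z.re|) (h2 : w.im = z.im) : ang m q w = ang m q z := by
  unfold ang
  rw [hgt_congr h1 h2, h1]

/-- A vertical side has angle `1` and goes to the ray from `1` to ∞; an arc of an isometric circle
has height `0` and goes to the segment `[0, 1]`. Thus the chart is real on paired sides and cannot
distinguish mirror images there. -/
theorem chartIm_of_side (hm : 0 ≤ m) (hq : m + 1 < q) {z : ℍ} (hz : Side m q z) :
    chartIm m q z = 0 := by
  unfold chartIm
  rcases hz with h | h
  · have : ang m q z = 1 := by rw [ang, h, slide_right hm hq (hgt_nonneg m q z)]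
    rw [this]; simp
  · have : hgt m q z = 0 := by
      unfold hgt
      refine max_eq_right (sub_nonpos.2 ?_)
      refine le_trans ?_ ((le_max_left _ _).trans (le_max_right _ _))
      linarith
    rw [this]; simp

theorem chart_of_side (hm : 0 ≤ m) (hq : m + 1 < q) {z w : ℍ} (h1 : w.re = -z.re)
    (h2 : w.im = z.im) (hz : Side m q z) : chart m q w = chart m q z := by
  have e : |w.re| = |z.re| := by rw [h1, abs_neg]
  have hw : Side m q w := by
    unfold Side at *
    rwa [e, nsq_congr h1 h2]
  unfold chart
  rw [chartIm_of_side hm hq hz, chartIm_of_side hm hq hw, hgt_congr e h2, ang_congr e h2]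
  simp

theorem chart_eq_zero_iff (hm : 0 ≤ m) (hq : m + 1 < q) {z : ℍ} (hz : |z.re| ≤ q) :
    chart m q z = 0 ↔ hgt m q z = 0 ∧ ang m q z = 0 := by
  have hn := hgt_nonneg m q z
  obtain ⟨ha, ha1⟩ : 0 ≤ ang m q z ∧ ang m q z ≤ 1 := slide_mem hm hq hn (abs_nonneg _) hz
  rw [← norm_eq_zero, (chart_normSq hm hq hz).1]
  constructor
  · intro h; constructor <;> linarith
  · rintro ⟨h, h'⟩; rw [h, h', add_zero]

theorem chart_eq_one_iff (hm : 0 ≤ m) (hq : m + 1 < q) {z : ℍ} (hz : |z.re| ≤ q) :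
    chart m q z = 1 ↔ hgt m q z = 0 ∧ ang m q z = 1 := by
  have hn := hgt_nonneg m q z
  obtain ⟨ha, ha1⟩ : 0 ≤ ang m q z ∧ ang m q z ≤ 1 := slide_mem hm hq hn (abs_nonneg _) hz
  rw [← sub_eq_zero, ← norm_eq_zero, (chart_normSq hm hq hz).2]
  constructor
  · intro h; constructor <;> linarith
  · rintro ⟨h, h'⟩; rw [h, h']; ring

/-- The part of the hyperbolic plane that lies beyond the side of length `u` of the half of the
Y-piece, or the elliptic fixed point. -/
def BeyondU (m : ℝ) (z : ℍ) : Prop :=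
  nsq z ≤ m ^ 2 - 1 ∨ (z.re = 0 ∧ nsq z + (m ^ 2 - 1) = 0)

/-- The part of the hyperbolic plane that lies beyond the side of length `v` of the half of the
Y-piece. -/
def BeyondV (m q : ℝ) (z : ℍ) : Prop := nsq z ≤ 2 * q * |z.re| - 2 * q * m + (m ^ 2 - 1)

theorem hgt_eq_zero_iff {z : ℍ} : hgt m q z = 0 ↔ nsq z ≤ lowBd m q |z.re| := by
  unfold hgt
  rw [max_eq_right_iff, sub_nonpos]

theorem chart_eq_zero_iff_beyondU (hm : 0 ≤ m) (hq : m + 1 < q) {z : ℍ}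
    (hz : Fund m q z) : chart m q z = 0 ↔ BeyondU m z := by
  obtain ⟨hz1, hz2⟩ := hz
  have hx0 := abs_nonneg z.re
  have hp := nsq_pos z
  unfold OutCircles at hz2
  rw [chart_eq_zero_iff hm hq hz1]
  constructor
  · rintro ⟨h1, h2⟩
    rw [ang, h1, slide_zero, ramp_eq_zero_iff hm hq] at h2
    rw [hgt_eq_zero_iff, lowBd, le_max_iff, le_max_iff] at h1
    have hr := right_line hq |z.re|
    have hr2 : 0 < 2 * (q - m) * (rightEnd m q - |z.re|) := by
      have := leftEnd_le hm
      have := lt_rightEnd hq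
      have : 0 < rightEnd m q - |z.re| := by linarith
      have : 0 < q - m := by linarith
      positivity
    rcases h1 with h1 | h1 | h1
    · exact .inl h1
    · unfold leftEnd at h2
      rcases le_max_iff.1 h2 with h2 | h2
      · rcases hm.eq_or_lt with rfl | hm
        · right
          rw [div_zero] at h2
          exact ⟨abs_eq_zero.1 (le_antisymm h2 hx0), by linarith⟩
        · rw [le_div_iff₀ hm] at h2
          left; linarith
      · right
        have : |z.re| = 0 := le_antisymm h2 hx0
        rw [this] at h1 hz2
        exact ⟨abs_eq_zero.1 this, by linarith⟩
    · linarith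
  · rintro (h | ⟨h, h'⟩)
    · have hm0 : 0 < m := by
        rcases hm.eq_or_lt with rfl | hm
        · norm_num at h; linarith
        · exact hm
      have h1 : hgt m q z = 0 := hgt_eq_zero_iff.2 (h.trans (le_max_left _ _))
      refine ⟨h1, ?_⟩
      rw [ang, h1, slide_zero, ramp_eq_zero_iff hm hq]
      exact le_leftEnd hm0 (by linarith)
    · have h1 : hgt m q z = 0 := by
        refine hgt_eq_zero_iff.2 (le_trans ?_ ((le_max_left _ _).trans (le_max_right _ _)))
        rw [h, abs_zero]; linarith
      refine ⟨h1, ?_⟩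
      rw [ang, h1, slide_zero, ramp_eq_zero_iff hm hq, h, abs_zero]
      exact leftEnd_nonneg m

theorem chart_eq_one_iff_beyondV (hm : 0 ≤ m) (hq : m + 1 < q) {z : ℍ}
    (hz : Fund m q z) : chart m q z = 1 ↔ BeyondV m q z := by
  obtain ⟨hz1, hz2⟩ := hz
  have hx0 := abs_nonneg z.re
  have hp := nsq_pos z
  unfold OutCircles at hz2
  rw [chart_eq_one_iff hm hq hz1]
  have hr := right_line hq |z.re|
  have hqm : 0 < q - m := by linarith
  constructor
  · rintro ⟨h1, h2⟩
    rw [ang, h1, slide_zero, ramp_eq_one_iff hm hq] at h2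
    rw [hgt_eq_zero_iff, lowBd, le_max_iff, le_max_iff] at h1
    have hr2 : 2 * (q - m) * (rightEnd m q - |z.re|) ≤ 0 :=
      mul_nonpos_of_nonneg_of_nonpos (by positivity) (by linarith)
    unfold BeyondV
    rcases h1 with h1 | h1 | h1
    · exfalso
      have := lt_rightEnd hq
      nlinarith
    · linarith
    · exact h1
  · intro h
    unfold BeyondV at h
    have h1 : hgt m q z = 0 :=
      hgt_eq_zero_iff.2 (h.trans ((le_max_right _ _).trans (le_max_right _ _)))
    refine ⟨h1, ?_⟩
    rw [ang, h1, slide_zero, ramp_eq_one_iff hm hq]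
    by_contra! hx
    have : 0 < 2 * (q - m) * (rightEnd m q - |z.re|) := by
      have : 0 < rightEnd m q - |z.re| := by linarith
      positivity
    linarith

end Chart

end

/-! ### Bijectivity and properness of the chart on the quotient. -/

section

variable {m q : ℝ}

/-- In the coordinates `(re z, nsq z)` the region is closed and bounded, and by `sq_lt_lowBd` it
stays strictly above the parabola representing the real line, so the coordinates can be inverted
continuously. -/
theorem isCompact_above (hm : 0 ≤ m) (hm1 : m ≠ 1) (hq : m + 1 < q) (R : ℝ) :
    IsCompact {z : ℍ | |z.re| ≤ q ∧ lowBd m q |z.re| ≤ nsq z ∧ nsq z ≤ R} := by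
  have hC : IsCompact {p : ℝ × ℝ | |p.1| ≤ q ∧ lowBd m q |p.1| ≤ p.2 ∧ p.2 ≤ R} := by
    have hclosed : IsClosed {p : ℝ × ℝ | |p.1| ≤ q ∧ lowBd m q |p.1| ≤ p.2 ∧ p.2 ≤ R} := by
      have h1 : IsClosed {p : ℝ × ℝ | |p.1| ≤ q} := isClosed_le (by fun_prop) (by fun_prop)
      have h2 : IsClosed {p : ℝ × ℝ | lowBd m q |p.1| ≤ p.2} := by
        unfold lowBd
        exact isClosed_le (by fun_prop) (by fun_prop)
      have h3 : IsClosed {p : ℝ × ℝ | p.2 ≤ R} := isClosed_le (by fun_prop) (by fun_prop)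
      exact h1.inter (h2.inter h3)
    refine (isCompact_Icc (a := ((-q, m ^ 2 - 1) : ℝ × ℝ)) (b := (q, R))).of_isClosed_subset
      hclosed ?_
    rintro ⟨x, N⟩ ⟨h1, h2, h3⟩
    have h4 := (le_max_left _ _).trans h2
    have h1 := abs_le.1 h1
    exact ⟨⟨h1.1, h4⟩, ⟨h1.2, h3⟩⟩
  rw [UpperHalfPlane.isOpenEmbedding_coe.isEmbedding.isCompact_iff]
  have hg : Continuous fun p : ℝ × ℝ => (p.1 : ℂ) + (√(p.2 - p.1 ^ 2) : ℝ) * Complex.I := by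
    fun_prop
  convert hC.image hg using 1
  ext ζ
  constructor
  · rintro ⟨z, ⟨h1, h2, h3⟩, rfl⟩
    refine ⟨(z.re, nsq z), ⟨h1, h2, h3⟩, ?_⟩
    have : √(nsq z - z.re ^ 2) = z.im := by
      rw [nsq, add_sub_cancel_left, Real.sqrt_sq z.im_pos.le]
    simp only [this]
    exact UpperHalfPlane.re_add_im z
  · rintro ⟨⟨x, N⟩, ⟨h1, h2, h3⟩, rfl⟩
    have h4 := sq_lt_lowBd hm hm1 hq (abs_nonneg x) h1
    rw [sq_abs] at h4
    have h5 : 0 < N - x ^ 2 := by simp only at h2; linarith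
    have hs := Real.sqrt_pos.2 h5
    refine ⟨⟨⟨x, √(N - x ^ 2)⟩, hs⟩, ?_, ?_⟩
    · have e1 : (⟨⟨x, √(N - x ^ 2)⟩, hs⟩ : ℍ).re = x := rfl
      have e2 : nsq (⟨⟨x, √(N - x ^ 2)⟩, hs⟩ : ℍ) = N := by
        change x ^ 2 + √(N - x ^ 2) ^ 2 = N
        rw [Real.sq_sqrt h5.le]; ring
      simp only [Set.mem_ofPred_eq, e1, e2]
      exact ⟨h1, h2, h3⟩
    · exact Complex.mk_eq_add_mul_I _ _

theorem lowBd_le_nsq {z : ℍ} (hz : OutCircles m z) (h1 : m ^ 2 - 1 ≤ nsq z)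
    (h2 : 2 * q * |z.re| - 2 * q * m + (m ^ 2 - 1) ≤ nsq z) : lowBd m q |z.re| ≤ nsq z := by
  unfold OutCircles at hz
  exact max_le h1 (max_le (by linarith) h2)

theorem lowBd_mono (hm : 0 ≤ m) (hq : m + 1 < q) : Monotone (lowBd m q) := by
  intro x y hxy
  have : 0 ≤ q := by linarith
  unfold lowBd
  gcongr

namespace Setup

variable {K G : Subgroup PSL2R}

theorem proj_eq_of_chart_eq (S : Setup m q K G) {z w : ℍ} (hz : Fund m q z) (hw : Fund m q w)
    (h : chart m q z = chart m q w) (h0 : chart m q z ≠ 0) (h1 : chart m q z ≠ 1) :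
    proj G z = proj G w := by
  have hm := S.nonneg
  have hq := S.lt
  have h0' : chart m q w ≠ 0 := h ▸ h0
  have h1' : chart m q w ≠ 1 := h ▸ h1
  have above : ∀ z, Fund m q z → chart m q z ≠ 0 → chart m q z ≠ 1 →
      hgt m q z = nsq z - lowBd m q |z.re| := fun z hz h0 h1 => by
    rw [Ne, chart_eq_zero_iff_beyondU hm hq hz, BeyondU, not_or, not_le] at h0
    rw [Ne, chart_eq_one_iff_beyondV hm hq hz, BeyondV, not_le] at h1
    exact max_eq_left (sub_nonneg.2 (lowBd_le_nsq hz.2 h0.1.le h1.le))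
  have e1 := (chart_normSq hm hq hz.1).1
  have e2 := (chart_normSq hm hq hz.1).2
  rw [h, (chart_normSq hm hq hw.1).1] at e1
  rw [h, (chart_normSq hm hq hw.1).2] at e2
  have hn : hgt m q z = hgt m q w := by linarith
  have ha : ang m q z = ang m q w := by linarith
  have hn0 := hgt_nonneg m q z
  have haz := slide_mem hm hq hn0 (abs_nonneg z.re) hz.1
  have hx : |z.re| = |w.re| := by
    refine slide_inj hm hq hn0 (fun hn1 => ?_) ?_
    · rw [Ne, chart_eq_zero_iff hm hq hz.1, not_and] at h0
      rw [Ne, chart_eq_one_iff hm hq hz.1, not_and] at h1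
      exact ⟨lt_of_le_of_ne haz.1 (Ne.symm (h0 hn1)), lt_of_le_of_ne haz.2 (h1 hn1)⟩
    · unfold ang at ha
      rw [← hn] at ha
      exact ha
  have hnz := above z hz h0 h1
  have hnw := above w hw h0' h1'
  have hN : nsq z = nsq w := by rw [hx] at hnz; linarith
  have him : z.im = w.im := by
    have : z.im ^ 2 = w.im ^ 2 := by
      unfold nsq at hN
      rw [← sq_abs z.re, ← sq_abs w.re, hx] at hN
      linarith
    exact (sq_eq_sq₀ z.im_pos.le w.im_pos.le).1 this
  rcases abs_eq_abs.1 hx with hre | hre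
  · rw [UpperHalfPlane.ext_re_im hre him]
  -- Mirror images in different halves have chart values with opposite imaginary parts, so equality
  -- makes both real. Away from the imaginary axis this happens only on the paired sides.
  · by_cases hx0 : w.re = 0
    · rw [UpperHalfPlane.ext_re_im (by rw [hre, hx0, neg_zero]) him]
    refine S.proj_eq_of_side hre him ?_
    have hYe : chartIm m q z = chartIm m q w := by unfold chartIm; rw [hn, ha]
    have hY : chartIm m q w = 0 := by
      have him2 := congrArg Complex.im h
      simp only [chart] at him2
      rw [hre, hYe] at him2
      rcases lt_or_gt_of_ne hx0 with h3 | h3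
      · rw [if_pos (by linarith), if_neg (by linarith)] at him2
        linarith
      · rw [if_neg (by linarith), if_pos (by linarith)] at him2
        linarith
    rw [← hYe] at hY
    have hprod : 0 ≤ hgt m q z * (hgt m q z + 1) * (ang m q z * (1 - ang m q z)) := by
      have : 0 ≤ 1 - ang m q z := by linarith [show ang m q z ≤ 1 from haz.2]
      have : 0 ≤ ang m q z := haz.1
      positivity
    have hxw : 0 < |z.re| := by rw [hx]; exact abs_pos.2 hx0
    have hn1 : hgt m q z = 0 → Side m q w := by
      intro h3
      have h5 : ang m q z ≠ 0 := fun h6 => h0 ((chart_eq_zero_iff hm hq hz.1).2 ⟨h3, h6⟩)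
      rw [← hn, h3] at hnw
      rw [Ne, chart_eq_zero_iff_beyondU hm hq hw, BeyondU, not_or, not_le] at h0'
      rw [Ne, chart_eq_one_iff_beyondV hm hq hw, BeyondV, not_le] at h1'
      right
      have : nsq w ≤ lowBd m q |w.re| := by linarith
      rw [lowBd, le_max_iff, le_max_iff] at this
      have h7 := hw.2
      unfold OutCircles at h7
      rcases this with h | h | h
      · linarith [h0'.1]
      · linarith
      · linarith
    have hnpos : ¬ hgt m q z = 0 → 0 < hgt m q z := fun h => lt_of_le_of_ne hn0 (Ne.symm h)
    unfold chartIm at hY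
    rw [mul_eq_zero, Real.sqrt_eq_zero hprod, mul_eq_zero, mul_eq_zero, mul_eq_zero] at hY
    by_cases h3 : hgt m q z = 0
    · exact hn1 h3
    have h4 := hnpos h3
    rcases hY with h | ((h | h) | (h | h))
    · norm_num at h
    · exact absurd h h3
    · linarith
    · exfalso
      rw [← slide_left hm hq (hgt m q z)] at h
      exact hxw.ne' ((slide_strictMono hm hq h4).injective h)
    · left
      have h : ang m q z = 1 := by linarith
      rw [← slide_right hm hq hn0] at h
      rw [← hx]
      exact (slide_strictMono hm hq h4).injective h

theorem exists_chart_eq (S : Setup m q K G) (ζ : ℂ) :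
    ∃ z, Fund m q z ∧ chart m q z = ζ ∧ lowBd m q |z.re| ≤ nsq z := by
  have hm := S.nonneg
  have hq := S.lt
  have t1 : 1 ≤ ‖ζ‖ + ‖ζ - 1‖ := by
    have := norm_sub_le ζ (ζ - 1)
    rwa [sub_sub_cancel, norm_one] at this
  have t2 : ‖ζ‖ ≤ ‖ζ - 1‖ + 1 := by
    have := norm_add_le (ζ - 1) 1
    rwa [sub_add_cancel, norm_one] at this
  have t3 : ‖ζ - 1‖ ≤ ‖ζ‖ + 1 := by
    have := norm_sub_le ζ 1
    rwa [norm_one] at this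
  -- Height and angle are found by solving `‖ζ‖ = n + a` and `‖ζ - 1‖ = n + 1 - a`. The triangle
  -- inequalities `t1`, `t2`, `t3` give `0 ≤ n` and `0 ≤ a ≤ 1`.
  obtain ⟨n, hn⟩ : ∃ n, n = (‖ζ‖ + ‖ζ - 1‖ - 1) / 2 := ⟨_, rfl⟩
  obtain ⟨a, ha⟩ : ∃ a, a = (1 + ‖ζ‖ - ‖ζ - 1‖) / 2 := ⟨_, rfl⟩
  have hn0 : 0 ≤ n := by rw [hn]; linarith
  obtain ⟨x, hx, hxq, hxa⟩ := exists_slide hm hq hn0 (show 0 ≤ a by rw [ha]; linarith)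
    (show a ≤ 1 by rw [ha]; linarith)
  have hpos : 0 < lowBd m q x + n - x ^ 2 := by
    linarith [sq_lt_lowBd hm S.ne_one hq hx hxq]
  have hs := Real.sqrt_pos.2 hpos
  obtain ⟨z, hzre, hzim⟩ : ∃ z : ℍ, z.re = (if 0 ≤ ζ.im then x else -x) ∧
      z.im = √(lowBd m q x + n - x ^ 2) := ⟨⟨⟨_, _⟩, hs⟩, rfl, rfl⟩
  have habs : |z.re| = x := by
    rw [hzre]; split_ifs
    · exact abs_of_nonneg hx
    · rw [abs_neg]; exact abs_of_nonneg hx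
  have hN : nsq z = lowBd m q x + n := by
    rw [nsq, ← sq_abs, habs, hzim, Real.sq_sqrt hpos.le]; ring
  have hlow : lowBd m q |z.re| ≤ nsq z := by rw [habs, hN]; linarith
  have hF : Fund m q z := by
    refine ⟨habs.trans_le hxq, ?_⟩
    have := (le_max_left _ _).trans ((le_max_right _ _).trans hlow)
    unfold OutCircles; linarith
  have hhz : hgt m q z = n := by rw [hgt, habs, hN, add_sub_cancel_left, max_eq_left hn0]
  have haz : ang m q z = a := by rw [ang, hhz, habs, hxa]
  obtain ⟨e1, e2⟩ := chart_normSq hm hq hF.1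
  rw [hhz, haz] at e1 e2
  have e1 : ‖chart m q z‖ = ‖ζ‖ := by rw [e1, hn, ha]; ring
  have e2 : ‖chart m q z - 1‖ = ‖ζ - 1‖ := by rw [e2, hn, ha]; ring
  have e3 := congrArg (· ^ 2) e1
  have e4 := congrArg (· ^ 2) e2
  simp only [Complex.sq_norm, Complex.normSq_apply, Complex.sub_re, Complex.sub_im, Complex.one_re,
    Complex.one_im] at e3 e4
  have hre : (chart m q z).re = ζ.re := by linarith
  refine ⟨z, hF, Complex.ext hre ?_, hlow⟩
  rw [hre] at e3
  have e5 : (chart m q z).im ^ 2 = ζ.im ^ 2 := by linarith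
  have hY : 0 ≤ chartIm m q z := by unfold chartIm; positivity
  have him : (chart m q z).im = if 0 ≤ z.re then chartIm m q z else -chartIm m q z := rfl
  by_cases hζ : 0 ≤ ζ.im
  · rw [if_pos hζ] at hzre
    rw [if_pos (by rw [hzre]; exact hx)] at him
    rw [him] at e5 ⊢
    exact (sq_eq_sq₀ hY hζ).1 e5
  · rw [if_neg hζ] at hzre
    push Not at hζ
    rcases hx.eq_or_lt with rfl | hx
    · have h0 : z.re = 0 := by rw [hzre, neg_zero]
      rw [chartIm_of_re_eq_zero hm hq h0, neg_zero, ite_self] at him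
      rw [him] at e5
      nlinarith
    · rw [if_neg (by linarith)] at him
      have := (sq_eq_sq₀ hY (neg_nonneg.2 hζ.le)).1 (by rw [him] at e5; linarith)
      linarith

end Setup

end

namespace Setup

variable {m q : ℝ} {K G : Subgroup PSL2R}

theorem exists_chart_lift (S : Setup m q K G) :
    ∃ f : Surface G → ℂ, Continuous f ∧ ∀ z, Fund m q z → f (proj G z) = chart m q z :=
  S.exists_lift (chart m q) (continuous_chart S.nonneg S.lt).continuousOn
    fun _ _ h1 h2 _ h3 => chart_of_side S.nonneg S.lt h1 h2 h3

/-- The complement of two points in the plane is homeomorphic to its preimage under a lift of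
`chart` to the quotient. -/
theorem nonempty_homeomorph (S : Setup m q K G) {f : Surface G → ℂ} (hf : Continuous f)
    (hfc : ∀ z, Fund m q z → f (proj G z) = chart m q z) :
    Nonempty ((f ⁻¹' {0, 1}ᶜ : Set (Surface G)) ≃ₜ ({0, 1}ᶜ : Set ℂ)) := by
  have hm := S.nonneg
  have hq := S.lt
  have hopen : IsOpen ({0, 1}ᶜ : Set ℂ) := (Set.toFinite _).isClosed.isOpen_compl
  let F := ({0, 1}ᶜ : Set ℂ).restrictPreimage f
  have hFc : Continuous F := hf.restrictPreimage
  have hrep : ∀ x : Surface G, ∃ z, Fund m q z ∧ proj G z = x := by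
    intro x
    obtain ⟨z, rfl⟩ := proj_surjective G x
    obtain ⟨g, hg, hF, -⟩ := S.exists_fund z
    exact ⟨g • z, hF, proj_smul hg z⟩
  have hinj : Function.Injective F := by
    rintro ⟨x, hx⟩ ⟨y, hy⟩ hxy
    obtain ⟨z, hz, rfl⟩ := hrep x
    obtain ⟨w, hw, rfl⟩ := hrep y
    have h : f (proj G z) = f (proj G w) := congrArg Subtype.val hxy
    rw [Set.mem_preimage, hfc z hz] at hx
    rw [hfc z hz, hfc w hw] at h
    simp only [Set.mem_compl_iff, Set.mem_insert_iff, Set.mem_singleton_iff, not_or] at hx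
    exact Subtype.ext (S.proj_eq_of_chart_eq hz hw h hx.1 hx.2)
  have hsurj : Function.Surjective F := by
    rintro ⟨ζ, hζ⟩
    obtain ⟨z, hz, rfl, -⟩ := S.exists_chart_eq ζ
    exact ⟨⟨proj G z, by rwa [Set.mem_preimage, hfc z hz]⟩, Subtype.ext (hfc z hz)⟩
  -- A compact set missing `0` and `1` has bounded height, and its preimages in the domain are not
  -- beyond `u` or `v`. So they lie in the compact region of `isCompact_above`. A proper continuous
  -- bijection is a homeomorphism.
  have hproper : IsProperMap F := by
    have : LocallyCompactSpace ({0, 1}ᶜ : Set ℂ) := hopen.locallyCompactSpace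
    rw [isProperMap_iff_isCompact_preimage]
    refine ⟨hFc, fun C hC => ?_⟩
    have hC' : IsCompact (Subtype.val '' C) := hC.image continuous_subtype_val
    rw [Subtype.isCompact_iff]
    obtain ⟨r, hr⟩ := hC'.isBounded.exists_norm_le
    have hcomp : IsCompact ({z : ℍ | |z.re| ≤ q ∧ lowBd m q |z.re| ≤ nsq z ∧
        nsq z ≤ lowBd m q q + r} ∩ ({z | Fund m q z} ∩ chart m q ⁻¹' (Subtype.val '' C))) :=
      (isCompact_above hm S.ne_one hq _).inter_right
        ((isClosed_fund m q).inter (hC'.isClosed.preimage (continuous_chart hm hq)))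
    convert hcomp.image (continuous_proj G) using 1
    ext x
    constructor
    · rintro ⟨⟨x, hx⟩, hxC, rfl⟩
      obtain ⟨z, hz, rfl⟩ := hrep x
      have hzC : chart m q z ∈ Subtype.val '' C := ⟨_, hxC, hfc z hz⟩
      rw [Set.mem_preimage, hfc z hz] at hx
      simp only [Set.mem_compl_iff, Set.mem_insert_iff, Set.mem_singleton_iff, not_or] at hx
      obtain ⟨h0, h1⟩ := hx
      rw [chart_eq_zero_iff_beyondU hm hq hz, BeyondU, not_or, not_le] at h0
      rw [chart_eq_one_iff_beyondV hm hq hz, BeyondV, not_le] at h1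
      refine ⟨z, ⟨⟨hz.1, lowBd_le_nsq hz.2 h0.1.le h1.le, ?_⟩, hz, hzC⟩, rfl⟩
      have h2 := hr _ hzC
      rw [(chart_normSq hm hq hz.1).1] at h2
      have h3 : 0 ≤ ang m q z := (slide_mem hm hq (hgt_nonneg m q z) (abs_nonneg _) hz.1).1
      have h4 : nsq z - lowBd m q |z.re| ≤ hgt m q z := le_max_left _ _
      have h5 := lowBd_mono hm hq hz.1
      linarith
    · rintro ⟨z, ⟨-, hz, ⟨ζ, hζ, hζz⟩⟩, rfl⟩
      have hmem : f (proj G z) ∈ ({0, 1}ᶜ : Set ℂ) := by rw [hfc z hz, ← hζz]; exact ζ.2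
      refine ⟨⟨proj G z, hmem⟩, ?_, rfl⟩
      have : F ⟨proj G z, hmem⟩ = ζ := Subtype.ext ((hfc z hz).trans hζz.symm)
      rw [Set.mem_preimage, this]
      exact hζ
  exact ⟨(Equiv.ofBijective F ⟨hinj, hsurj⟩).toHomeomorphOfContinuousClosed hFc
    hproper.isClosedMap⟩

end Setup

/-! ### Tubes around the axes or fixed points, and their separation. -/

section

variable {m q : ℝ}

/-- A vertical line between the sides of length `u` and `v` of the half of the Y-piece. -/
noncomputable def midEnd (m q : ℝ) : ℝ := m + 1 / (2 * (q - m))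

theorem lt_midEnd (hq : m + 1 < q) : m < midEnd m q := by
  have : 0 < 1 / (2 * (q - m)) := by apply one_div_pos.2; linarith
  unfold midEnd; linarith

theorem midEnd_lt (hq : m + 1 < q) : midEnd m q < q := by
  have : 1 / (2 * (q - m)) < 1 := by rw [div_lt_one] <;> linarith
  unfold midEnd; linarith

theorem right_line_midEnd (hq : m + 1 < q) {x : ℝ} (hx : x ≤ midEnd m q) :
    1 ≤ 2 * (q - m) * (rightEnd m q - x) := by
  have h0 : 0 < q - m := by linarith
  have h1 : 2 * (q - m) * (rightEnd m q - midEnd m q) = 1 := by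
    unfold rightEnd midEnd; field_simp; ring
  have h2 : 2 * (q - m) * (rightEnd m q - midEnd m q) ≤ 2 * (q - m) * (rightEnd m q - x) := by
    gcongr
  linarith

/-- The square of `sinh` of half of the displacement of `rotGen m`. -/
noncomputable def dispU (m : ℝ) (z : ℍ) : ℝ :=
  (m ^ 2 - 1) + (nsq z - (m ^ 2 - 1)) ^ 2 / (4 * z.im ^ 2)

/-- The element `z ↦ z + 2 * q` after the inverse of `rotGen m`. -/
def genV (m q : ℝ) : PSL2R := shift (2 * q) * (rotGen m)⁻¹

/-- On the right half of the fundamental domain, the square of `sinh` of half of the displacement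
of `genV m q`. -/
noncomputable def dispV (m q : ℝ) (z : ℍ) : ℝ :=
  ((q - m) ^ 2 - 1) +
    ((|z.re| - q) ^ 2 + z.im ^ 2 - ((q - m) ^ 2 - 1)) ^ 2 / (4 * z.im ^ 2)

/-- About the line `re z = q` the element `genV` looks as `rotGen (q - m)` does about the imaginary
axis, so the displacement formula and the Dirichlet argument apply to it too. -/
theorem genV_eq (m q : ℝ) : genV m q = shift q * rotGen (q - m) * (shift q)⁻¹ := by
  rw [genV, rotGen, rot_inv, shift_inv, rot, rotGen, rot, shift, shift, shift, cls_mul, cls_mul,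
    cls_mul, ← cls_neg]
  apply cls_congr <;> ring

theorem disp_rotGen (m : ℝ) (z : ℍ) : disp (rotGen m) z = dispU m z := by
  rw [rotGen, disp_rot, one_pow, one_mul, dispU]

theorem disp_rot' {c d : ℝ} (h : d ^ 2 - (m ^ 2 - 1) * c ^ 2 = 1) (z : ℍ) :
    disp (rot m c d h) z = c ^ 2 * dispU m z := disp_rot h z

theorem disp_genV (m q : ℝ) (z : ℍ) : disp (genV m q) z =
    dispU (q - m) ((shift q)⁻¹ • z) := by
  have := disp_conj (shift q) (rotGen (q - m)) ((shift q)⁻¹ • z)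
  rw [smul_inv_smul, ← genV_eq, disp_rotGen] at this
  exact this

theorem disp_genV_eq (m q : ℝ) (z : ℍ) : disp (genV m q) z =
    ((q - m) ^ 2 - 1) +
    ((z.re - q) ^ 2 + z.im ^ 2 - ((q - m) ^ 2 - 1)) ^ 2 / (4 * z.im ^ 2) := by
  rw [disp_genV, dispU, nsq, shift_inv, shift_re, shift_im, ← sub_eq_add_neg]

theorem le_dispU (m : ℝ) (z : ℍ) : max (m ^ 2 - 1) 0 ≤ dispU m z := by
  have hy := z.im_pos
  refine max_le ?_ ?_
  · have : 0 ≤ (nsq z - (m ^ 2 - 1)) ^ 2 / (4 * z.im ^ 2) := by positivity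
    unfold dispU; linarith
  · rw [← disp_rotGen]; exact sq_nonneg _

theorem dispU_lt_iff {ε : ℝ} {z : ℍ} : dispU m z < max (m ^ 2 - 1) 0 + ε ↔
    (nsq z - (m ^ 2 - 1)) ^ 2 < 4 * z.im ^ 2 * (max (m ^ 2 - 1) 0 - (m ^ 2 - 1) + ε) := by
  have hy := z.im_pos
  unfold dispU
  rw [← lt_sub_iff_add_lt', div_lt_iff₀ (by positivity)]
  constructor <;> intro h <;> linarith

/-- In the hyperbolic case the displacement exceeds its minimum by a square. In the elliptic case,
clearing denominators in `dispU m z = 0` gives a sum of two squares, which vanishes only at the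
fixed point. -/
theorem dispU_eq_iff (hm1 : m ^ 2 - 1 ≠ 0) {z : ℍ} : dispU m z = max (m ^ 2 - 1) 0 ↔
    nsq z = m ^ 2 - 1 ∨ (z.re = 0 ∧ nsq z + (m ^ 2 - 1) = 0) := by
  have hy := z.im_pos
  have hp := nsq_pos z
  unfold dispU
  rcases lt_or_gt_of_ne hm1 with h | h
  · rw [max_eq_right h.le, ← eq_sub_iff_add_eq', div_eq_iff (by positivity)]
    constructor
    · intro h1
      right
      have h2 : (nsq z + (m ^ 2 - 1)) ^ 2 + 4 * (-(m ^ 2 - 1)) * z.re ^ 2 = 0 := by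
        have h3 : nsq z = z.re ^ 2 + z.im ^ 2 := rfl
        linear_combination h1 + 4 * (m ^ 2 - 1) * h3
      have h4 : 0 ≤ 4 * (-(m ^ 2 - 1)) * z.re ^ 2 :=
        mul_nonneg (by linarith) (sq_nonneg _)
      have h5 := sq_nonneg (nsq z + (m ^ 2 - 1))
      have h6 : 4 * (-(m ^ 2 - 1)) * z.re ^ 2 = 0 := by linarith
      have h7 : (nsq z + (m ^ 2 - 1)) ^ 2 = 0 := by linarith
      refine ⟨?_, by simpa using h7⟩
      rcases mul_eq_zero.1 h6 with h8 | h8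
      · linarith
      · simpa using h8
    · rintro (h1 | ⟨h1, h2⟩)
      · linarith
      · have h3 : nsq z = z.im ^ 2 := by rw [nsq, h1]; ring
        linear_combination (nsq z + (m ^ 2 - 1)) * h2 - 4 * (m ^ 2 - 1) * h3
  · rw [max_eq_left h.le, add_eq_left, div_eq_zero_iff]
    have : 4 * z.im ^ 2 ≠ 0 := by positivity
    simp only [this, or_false, ne_eq, OfNat.ofNat_ne_zero, not_false_eq_true, pow_eq_zero_iff,
      sub_eq_zero]
    constructor
    · exact .inl
    · rintro (h1 | ⟨-, h1⟩)
      · exact h1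
      · linarith

/-- A thin neighbourhood of the side of length `u` or of the elliptic fixed point lies to the left
of `midEnd`. -/
theorem exists_sepU (hm : 0 ≤ m) (hm1 : m ≠ 1) (hq : m + 1 < q) : ∃ ε, 0 < ε ∧ ε ≤ 1 ∧
    ∀ z : ℍ, OutCircles m z → dispU m z < max (m ^ 2 - 1) 0 + ε → |z.re| < midEnd m q := by
  have hmid := lt_midEnd hq
  rcases lt_or_gt_of_ne hm1 with h1 | h1
  · have hk : m ^ 2 - 1 < 0 := by nlinarith
    have hX : 0 < midEnd m q := by linarith
    set X := midEnd m q
    set k := -(m ^ 2 - 1) with hkd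
    have hk0 : 0 < k := by linarith
    have hk1 : k ≤ 1 := by nlinarith
    refine ⟨k * X ^ 2 / (2 * (1 + X ^ 2)), by positivity, ?_, ?_⟩
    · rw [div_le_one (by positivity)]; nlinarith [sq_nonneg X]
    · intro z hz ht
      by_contra! hx
      rw [dispU_lt_iff, max_eq_right hk.le] at ht
      set ε := k * X ^ 2 / (2 * (1 + X ^ 2)) with hε
      have e0 : 0 < ε := by positivity
      have e1 : ε * (2 * (1 + X ^ 2)) = k * X ^ 2 := by rw [hε]; field_simp
      have e2 : 2 * ε ≤ k * X ^ 2 := by nlinarith [sq_nonneg X]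
      have e3 : 2 * ε ≤ X ^ 2 := by nlinarith [sq_nonneg X]
      have e4 : ε ≤ 1 / 2 := by nlinarith [sq_nonneg X]
      have hx2 : X ^ 2 ≤ z.re ^ 2 := by rw [← sq_abs z.re]; gcongr
      have hN : nsq z = z.re ^ 2 + z.im ^ 2 := rfl
      unfold OutCircles at hz
      have hw : 0 ≤ nsq z - k := by
        have := mul_nonneg hm (abs_nonneg z.re)
        linarith
      have h5 : (nsq z - k) ^ 2 + 4 * k * z.re ^ 2 < 4 * ε * (nsq z - z.re ^ 2) := by
        have : z.im ^ 2 = nsq z - z.re ^ 2 := by linarith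
        rw [this] at ht
        nlinarith
      -- Completing the square in `h5` gives `(nsq z - k - 2 * ε) ^ 2 < 4 * (k + ε) * (ε - z.re ^
      -- 2)`, so `z.re ^ 2 < ε`, whereas `ε` was chosen at most `X ^ 2 / 2`.
      nlinarith [sq_nonneg (nsq z - k - 2 * ε), mul_le_mul_of_nonneg_left hx2 hk0.le,
        mul_nonneg e0.le (sq_nonneg z.re)]
  · have hk : 0 < m ^ 2 - 1 := by nlinarith
    set k := m ^ 2 - 1 with hkd
    refine ⟨1 / (2 + k), by positivity, ?_, ?_⟩
    · rw [div_le_one (by positivity)]; linarith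
    · intro z hz ht
      by_contra! hx
      rw [dispU_lt_iff, max_eq_left hk.le, sub_self, zero_add] at ht
      unfold OutCircles at hz
      -- Beyond `m` the circle condition keeps the point a definite amount above the axis. Then
      -- `(nsq z - k) ^ 2 ≥ 4 * nsq z / (2 + k)`, which is where the width `1 / (2 + k)` comes from.
      have h2 : 2 ≤ nsq z - k := by
        have : m * m ≤ m * |z.re| := by gcongr; linarith
        nlinarith
      have hN : z.im ^ 2 ≤ nsq z := by unfold nsq; nlinarith [sq_nonneg z.re]
      rw [mul_one_div, lt_div_iff₀ (by positivity), ← hkd] at ht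
      have h3 : 2 * nsq z ≤ (nsq z - k) * (2 + k) := by nlinarith
      have h4 : 2 * ((nsq z - k) * (2 + k)) ≤ (nsq z - k) * ((nsq z - k) * (2 + k)) :=
        mul_le_mul_of_nonneg_right h2 (by positivity)
      linarith

/-- A thin neighbourhood of the side of length `v` lies to the right of `midEnd`. -/
theorem exists_sepV (hq : m + 1 < q) : ∃ ε, 0 < ε ∧ ε ≤ 1 ∧
    ∀ z : ℍ, 2 * m * z.re ≤ nsq z + (m ^ 2 - 1) →
      disp (genV m q) z < ((q - m) ^ 2 - 1) + ε → midEnd m q < z.re := by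
  have hs : 0 < (q - m) ^ 2 - 1 := by nlinarith
  set s := (q - m) ^ 2 - 1 with hsd
  refine ⟨1 / (4 * (1 + s)), by positivity, ?_, ?_⟩
  · rw [div_le_one (by positivity)]; linarith
  · intro z hz ht
    by_contra! hx
    have hy := z.im_pos
    rw [disp_genV_eq, add_lt_add_iff_left, div_lt_div_iff₀ (by positivity) (by positivity)] at ht
    have h1 := right_line_midEnd hq hx
    rw [← right_line hq] at h1
    unfold nsq at hz
    -- The line `midEnd` is placed so that up to it the isometric circle is at least `1` above the
    -- axis of `genV`.
    have h2 : 1 ≤ (z.re - q) ^ 2 + z.im ^ 2 - s := by rw [hsd]; nlinarith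
    rw [← hsd] at ht
    set V := (z.re - q) ^ 2 + z.im ^ 2 - s with hV
    have h3 : z.im ^ 2 ≤ V + s := by rw [hV]; nlinarith [sq_nonneg (z.re - q)]
    have h4 : V + s ≤ V * (1 + s) := by nlinarith
    have h5 : 1 * (V * (1 + s)) ≤ V * (V * (1 + s)) :=
      mul_le_mul_of_nonneg_right h2 (by positivity)
    linarith

end

section

variable {m q : ℝ} {K G : Subgroup PSL2R}

/-- The isometric circles of `genV` and its inverse are the unit circles about `m` and `2 * q - m`:
one bounds the domain of `G`, the other is a translate of the circle about `-m`. -/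
theorem outCircles_shift (hq : m ≤ q) {z : ℍ} (hz : OutCircles (q - m) ((shift q)⁻¹ • z)) :
    2 * m * z.re ≤ nsq z + (m ^ 2 - 1) ∧
      2 * m * (2 * q - z.re) ≤ (2 * q - z.re) ^ 2 + z.im ^ 2 + (m ^ 2 - 1) := by
  unfold OutCircles nsq at *
  rw [shift_inv, shift_re, shift_im] at hz
  rcases abs_cases (z.re + -q) with ⟨h, h'⟩ | ⟨h, h'⟩ <;> rw [h] at hz <;>
    constructor
  · nlinarith [mul_nonneg (sub_nonneg.2 hq) h']
  · nlinarith
  · nlinarith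
  · nlinarith [mul_nonneg (sub_nonneg.2 hq) (neg_nonneg.2 h'.le)]

theorem dispU_eq_of_re {z w : ℍ} (h1 : |z.re| = |w.re|) (h2 : z.im = w.im) :
    dispU m z = dispU m w := by
  unfold dispU nsq
  rw [← sq_abs z.re, h1, sq_abs, h2]

theorem dispV_eq_of_re {z w : ℍ} (h1 : |z.re| = |w.re|) (h2 : z.im = w.im) :
    dispV m q z = dispV m q w := by
  unfold dispV
  rw [h1, h2]

theorem disp_genV_of_nonneg {z : ℍ} (hz : 0 ≤ z.re) : disp (genV m q) z = dispV m q z := by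
  rw [disp_genV_eq, dispV, abs_of_nonneg hz]

theorem disp_genV_of_nonpos {z : ℍ} (hz : z.re ≤ 0) :
    disp (genV m q) (shift (2 * q) • z) = dispV m q z := by
  rw [disp_genV_eq, dispV, abs_of_nonpos hz, shift_re, shift_im]
  congr 3; ring

namespace Setup

theorem genV_mem (S : Setup m q K G) : genV m q ∈ G :=
  mul_mem S.shift_mem (inv_mem S.gen_mem')

theorem midEnd_pos (S : Setup m q K G) : 0 < midEnd m q := S.nonneg.trans_lt (lt_midEnd S.lt)

theorem exists_zpowers_genV (S : Setup m q K G) (z : ℍ) :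
    ∃ n ∈ Subgroup.zpowers (genV m q), OutCircles (q - m) ((shift q)⁻¹ • n • z) := by
  have hle : Subgroup.zpowers (genV m q) ≤ G := by
    rw [Subgroup.zpowers_le]; exact S.genV_mem
  have hmem : ∀ k ∈ Subgroup.zpowers (rotGen (q - m)),
      shift q * k * (shift q)⁻¹ ∈ Subgroup.zpowers (genV m q) := by
    rintro k ⟨n, rfl⟩
    refine ⟨n, ?_⟩
    simp only [genV_eq]
    exact conj_zpow
  have hfin : OrbitFinite (Subgroup.zpowers (rotGen (q - m))) :=
    (S.fin.mono hle).conj (shift q)⁻¹ fun g hg => by rw [inv_inv]; exact hmem g hg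
  obtain ⟨k, hk, hmin⟩ := hfin.exists_closest ((shift q)⁻¹ • z) basePt
  refine ⟨_, hmem k hk, ?_⟩
  have : (shift q)⁻¹ • (shift q * k * (shift q)⁻¹) • z = k • (shift q)⁻¹ • z := by
    simp [mul_smul]
  rw [this]
  exact outCircles_of_dist_le (hmin _ (Subgroup.mem_zpowers _))
    (hmin _ (inv_mem (Subgroup.mem_zpowers _)))

theorem exists_zpowers_shift (S : Setup m q K G) (z : ℍ) :
    ∃ n ∈ Subgroup.zpowers (shift (2 * q)), |(n • z).re| ≤ q := by
  have hle : Subgroup.zpowers (shift (2 * q)) ≤ G := by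
    rw [Subgroup.zpowers_le]; exact S.shift_mem
  obtain ⟨k, hk, hmin⟩ := (S.fin.mono hle).exists_closest z basePt
  exact ⟨k, hk, abs_re_le_of_dist_le S.q_pos (hmin _ (Subgroup.mem_zpowers _))
    (hmin _ (inv_mem (Subgroup.mem_zpowers _)))⟩

section TubeU

variable {r : ℝ}

theorem dispU_smul (S : Setup m q K G) {k : PSL2R} (hk : k ∈ K) (z : ℍ) :
    dispU m (k • z) = dispU m z := by
  rw [← disp_rotGen, ← disp_rotGen]
  exact disp_pow_comm _ _ (S.mul_comm_K hk S.gen_mem) z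

theorem exists_fundU (S : Setup m q K G)
    (hr : ∀ z : ℍ, OutCircles m z → dispU m z < r → |z.re| < midEnd m q) {z : ℍ}
    (hz : dispU m z < r) : ∃ k ∈ K, Fund m q (k • z) ∧ |(k • z).re| < midEnd m q := by
  obtain ⟨k, hk, hkz⟩ := S.exists_outCircles z
  have := hr _ hkz (by rwa [S.dispU_smul hk])
  exact ⟨k, hk, ⟨(this.trans (midEnd_lt S.lt)).le, hkz⟩, this⟩

/-- Powers of the stabilizer bring both points into the domain without leaving the tube, hence into
the open strip. There `unique` allows only identifications by `K`. -/
theorem preciseU (S : Setup m q K G)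
    (hr : ∀ z : ℍ, OutCircles m z → dispU m z < r → |z.re| < midEnd m q) {z : ℍ}
    (hz : dispU m z < r) {g : PSL2R} (hg : g ∈ G) (hgz : dispU m (g • z) < r) : g ∈ K := by
  obtain ⟨k, hk, hF, hx⟩ := S.exists_fundU hr hz
  obtain ⟨k', hk', hF', -⟩ := S.exists_fundU hr hgz
  have hmem : k' * g * k⁻¹ ∈ G := mul_mem (mul_mem (S.K_le hk') hg) (inv_mem (S.K_le hk))
  have hK : k' * g * k⁻¹ ∈ K := by
    rcases S.unique hmem hF (by simpa [mul_smul] using hF') with h | ⟨-, -, -, -, -, h, -⟩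
    · rw [h]; exact one_mem _
    · exact h (hx.trans (midEnd_lt S.lt))
  have : g = k'⁻¹ * (k' * g * k⁻¹) * k := by group
  rw [this]
  exact mul_mem (mul_mem (inv_mem hk') hK) hk

/-- The predicate `p` lets the same argument serve for tubes (`<`) and for cores (`≤`). -/
theorem projU (S : Setup m q K G)
    (hr : ∀ z : ℍ, OutCircles m z → dispU m z < r → |z.re| < midEnd m q) {p : ℝ → Prop}
    (hp : ∀ x, p x → x < r) {z : ℍ} (hz : Fund m q z) :
    proj G z ∈ proj G '' {z | p (dispU m z)} ↔ p (dispU m z) := by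
  refine ⟨?_, fun h => ⟨z, h, rfl⟩⟩
  rintro ⟨w, hw, hwz⟩
  obtain ⟨k, hk, hF, -⟩ := S.exists_fundU hr (hp _ hw)
  have := S.eq_of_proj_eq hz hF (by rw [proj_smul (S.K_le hk), hwz])
  rw [dispU_eq_of_re this.1 this.2, S.dispU_smul hk]
  exact hw

end TubeU

section TubeV

variable {r : ℝ}

/-- The tube of `genV` straddles the line `re z = q`. After a power of `genV` a point lies between
the isometric circles; its part with `re z > q` is brought into the domain by one translation. -/
theorem exists_fundV (S : Setup m q K G)
    (hr : ∀ z : ℍ, 2 * m * z.re ≤ nsq z + (m ^ 2 - 1) → disp (genV m q) z < r →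
      midEnd m q < z.re) {z : ℍ} (hz : disp (genV m q) z < r) :
    ∃ n ∈ Subgroup.zpowers (genV m q), ∃ e ∈ G, Fund m q (e • n • z) ∧
      dispV m q (e • n • z) = disp (genV m q) z ∧
      ((e = 1 ∧ 0 < (e • n • z).re) ∨ (e = (shift (2 * q))⁻¹ ∧ (e • n • z).re < 0)) := by
  obtain ⟨n, hn, ho⟩ := S.exists_zpowers_genV z
  have hcomm : n * genV m q = genV m q * n := by
    obtain ⟨i, rfl⟩ := hn
    exact ((Commute.refl (genV m q)).zpow_left i).eq
  have hdn : disp (genV m q) (n • z) = disp (genV m q) z := disp_pow_comm _ _ hcomm z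
  obtain ⟨h1, h2⟩ := outCircles_shift (by linarith [S.lt]) ho
  have hmid := S.midEnd_pos
  have hl := hr _ h1 (by rwa [hdn])
  -- The reflection in `re z = q` preserves the displacement of `genV`, so the bound on the left
  -- also holds on the right.
  have hright : midEnd m q < 2 * q - (n • z).re := by
    let w : ℍ := ⟨⟨2 * q - (n • z).re, (n • z).im⟩, (n • z).im_pos⟩
    refine hr w h2 ?_
    have : disp (genV m q) w = disp (genV m q) (n • z) := by
      rw [disp_genV_eq, disp_genV_eq]
      have e1 : w.re = 2 * q - (n • z).re := rfl
      have e2 : w.im = (n • z).im := rfl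
      rw [e1, e2]
      congr 3; ring
    rwa [this, hdn]
  rcases le_or_gt (n • z).re q with hx | hx
  · refine ⟨n, hn, 1, one_mem _, ?_, ?_, .inl ⟨rfl, ?_⟩⟩ <;> rw [one_smul]
    · have habs := abs_of_pos (hmid.trans hl)
      refine ⟨by rwa [habs], ?_⟩
      unfold OutCircles; rwa [habs]
    · rw [← disp_genV_of_nonneg (hmid.trans hl).le, hdn]
    · exact hmid.trans hl
  · have hre : ((shift (2 * q))⁻¹ • n • z).re = -(2 * q - (n • z).re) := by
      rw [shift_inv, shift_re]; ring
    have him : ((shift (2 * q))⁻¹ • n • z).im = (n • z).im := by rw [shift_inv, shift_im]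
    have habs : |((shift (2 * q))⁻¹ • n • z).re| = 2 * q - (n • z).re := by
      rw [hre, abs_neg, abs_of_pos (hmid.trans hright)]
    refine ⟨n, hn, _, inv_mem S.shift_mem, ?_, ?_, .inr ⟨rfl, ?_⟩⟩
    · refine ⟨by rw [habs]; linarith, ?_⟩
      unfold OutCircles nsq
      rw [habs, hre, him, neg_sq]
      exact h2
    · rw [← disp_genV_of_nonpos (by rw [hre]; linarith), smul_inv_smul, hdn]
    · rw [hre]; linarith

/-- Representatives in the same half of the domain can only be equal. In opposite halves they are
related by the translation or by `rotGen m`, and undoing the translation of `exists_fundV` leaves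
the identity or `genV` or its inverse. -/
theorem preciseV (S : Setup m q K G)
    (hr : ∀ z : ℍ, 2 * m * z.re ≤ nsq z + (m ^ 2 - 1) → disp (genV m q) z < r →
      midEnd m q < z.re) {z : ℍ} (hz : disp (genV m q) z < r) {g : PSL2R} (hg : g ∈ G)
    (hgz : disp (genV m q) (g • z) < r) : g ∈ Subgroup.zpowers (genV m q) := by
  have hle : Subgroup.zpowers (genV m q) ≤ G := by
    rw [Subgroup.zpowers_le]; exact S.genV_mem
  obtain ⟨n, hn, e, he, hF, -, hc⟩ := S.exists_fundV hr hz
  obtain ⟨n', hn', e', he', hF', -, hc'⟩ := S.exists_fundV hr hgz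
  have hmem : e' * (n' * g * n⁻¹) * e⁻¹ ∈ G :=
    mul_mem (mul_mem he' (mul_mem (mul_mem (hle hn') hg) (inv_mem (hle hn)))) (inv_mem he)
  have hact : (e' * (n' * g * n⁻¹) * e⁻¹) • e • n • z = e' • n' • g • z := by
    simp [mul_smul]
  have hu := S.unique hmem hF (by rw [hact]; exact hF')
  rw [hact] at hu
  suffices h : n' * g * n⁻¹ ∈ Subgroup.zpowers (genV m q) by
    have : g = n'⁻¹ * (n' * g * n⁻¹) * n := by group
    rw [this]
    exact mul_mem (mul_mem (inv_mem hn') h) hn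
  have hV := Subgroup.mem_zpowers (genV m q)
  rcases hc with ⟨he1, hx⟩ | ⟨he1, hx⟩ <;> rcases hc' with ⟨he1', hx'⟩ | ⟨he1', hx'⟩
  · rcases hu with hu | ⟨hu, -⟩
    · rw [he1, he1', one_mul, inv_one, mul_one] at hu
      rw [hu]; exact one_mem _
    · linarith
  · rcases hu with hu | ⟨-, -, -, hu, -⟩
    · rw [hu, one_smul] at hact; rw [hact] at hx; linarith
    · rcases hu hx with hu | hu <;> rw [he1, he1', inv_one, mul_one] at hu
      · rw [mul_eq_left] at hu
        rw [hu]; exact one_mem _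
      · rw [inv_mul_eq_iff_eq_mul] at hu
        rw [hu]; exact hV
  · rcases hu with hu | ⟨-, -, -, -, hu, -⟩
    · rw [hu, one_smul] at hact; rw [hact] at hx; linarith
    · rcases hu hx with hu | hu <;> rw [he1, he1', inv_inv, one_mul] at hu
      · rw [mul_eq_right] at hu
        rw [hu]; exact one_mem _
      · rw [← eq_mul_inv_iff_mul_eq] at hu
        rw [hu, show rotGen m * (shift (2 * q))⁻¹ = (genV m q)⁻¹ by rw [genV]; group]
        exact inv_mem hV
  · rcases hu with hu | ⟨hu, -⟩
    · rw [he1, he1', inv_inv, mul_eq_one_iff_eq_inv, mul_eq_left] at hu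
      rw [hu]; exact one_mem _
    · linarith

theorem projV (S : Setup m q K G)
    (hr : ∀ z : ℍ, 2 * m * z.re ≤ nsq z + (m ^ 2 - 1) → disp (genV m q) z < r →
      midEnd m q < z.re) {p : ℝ → Prop}
    (hp : ∀ x, p x → x < r) {z : ℍ} (hz : Fund m q z) :
    proj G z ∈ proj G '' {z | p (disp (genV m q) z)} ↔ p (dispV m q z) := by
  have hle : Subgroup.zpowers (genV m q) ≤ G := by
    rw [Subgroup.zpowers_le]; exact S.genV_mem
  constructor
  · rintro ⟨w, hw, hwz⟩
    obtain ⟨n, hn, e, he, hF, hd, -⟩ := S.exists_fundV hr (hp _ hw)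
    have := S.eq_of_proj_eq hz hF (by rw [proj_smul he, proj_smul (hle hn), hwz])
    rw [dispV_eq_of_re this.1 this.2, hd]
    exact hw
  · intro h
    rcases le_total 0 z.re with hx | hx
    · exact ⟨z, by rwa [Set.mem_ofPred_eq, disp_genV_of_nonneg hx], rfl⟩
    · exact ⟨shift (2 * q) • z, by rwa [Set.mem_ofPred_eq, disp_genV_of_nonpos hx],
        proj_smul S.shift_mem z⟩

end TubeV

section TubeB

variable {r : ℝ}

/-- The isometric circles have radius `1`, so nothing at height above `1` is inside them. -/
theorem exists_fundB (S : Setup m q K G) {z : ℍ} (hz : 1 < z.im) :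
    ∃ n ∈ Subgroup.zpowers (shift (2 * q)), Fund m q (n • z) ∧ (n • z).im = z.im ∧
      2 * m * |(n • z).re| < nsq (n • z) + (m ^ 2 - 1) := by
  obtain ⟨n, hn, hx⟩ := S.exists_zpowers_shift z
  have him : (n • z).im = z.im := by
    obtain ⟨i, rfl⟩ := hn
    simp only [shift_zpow, shift_im]
  have : 2 * m * |(n • z).re| < nsq (n • z) + (m ^ 2 - 1) := by
    unfold nsq
    rw [him, ← sq_abs (n • z).re]
    nlinarith [sq_nonneg (|(n • z).re| - m)]
  exact ⟨n, hn, ⟨hx, this.le⟩, him, this⟩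

theorem preciseB (S : Setup m q K G) {z : ℍ} (hz : 1 < z.im) {g : PSL2R} (hg : g ∈ G)
    (hgz : 1 < (g • z).im) : g ∈ Subgroup.zpowers (shift (2 * q)) := by
  have hle : Subgroup.zpowers (shift (2 * q)) ≤ G := by
    rw [Subgroup.zpowers_le]; exact S.shift_mem
  obtain ⟨k, hk, hF, -, hx⟩ := S.exists_fundB hz
  obtain ⟨k', hk', hF', -⟩ := S.exists_fundB hgz
  have hmem : k' * g * k⁻¹ ∈ G := mul_mem (mul_mem (hle hk') hg) (inv_mem (hle hk))
  have hK : k' * g * k⁻¹ ∈ Subgroup.zpowers (shift (2 * q)) := by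
    rcases S.unique hmem hF (by simpa [mul_smul] using hF') with h | ⟨-, -, -, -, -, -, h⟩
    · rw [h]; exact one_mem _
    · exact h hx
  have : g = k'⁻¹ * (k' * g * k⁻¹) * k := by group
  rw [this]
  exact mul_mem (mul_mem (inv_mem hk') hK) hk

theorem projB (S : Setup m q K G) {H : ℝ} (hH : 1 ≤ H) {z : ℍ} (hz : Fund m q z) :
    proj G z ∈ proj G '' {z | H < z.im} ↔ H < z.im := by
  have hle : Subgroup.zpowers (shift (2 * q)) ≤ G := by
    rw [Subgroup.zpowers_le]; exact S.shift_mem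
  refine ⟨?_, fun h => ⟨z, h, rfl⟩⟩
  rintro ⟨w, hw, hwz⟩
  obtain ⟨n, hn, hF, him, -⟩ := S.exists_fundB (hH.trans_lt hw)
  have := S.eq_of_proj_eq hz hF (by rw [proj_smul (hle hn), hwz])
  rw [this.2, him]
  exact hw

end TubeB

end Setup

end

/-! ### Types of the three boundary elements and the closure of the Y-piece. -/

section

variable {m q : ℝ} {K G : Subgroup PSL2R}

section Types

theorem displacement_le_iff {T : PSL2R} {z : ℍ} {l : ℝ} (hl : 0 ≤ l) :
    l ≤ displacement T z ↔ Real.sinh (l / 2) ^ 2 ≤ disp T z := by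
  unfold disp
  rw [sq_le_sq₀ (Real.sinh_nonneg_iff.2 (by linarith))
    (Real.sinh_nonneg_iff.2 (div_nonneg (displacement_nonneg T z) zero_le_two)), Real.sinh_le_sinh]
  constructor <;> intro h <;> linarith

theorem isGLB_displacement {T : PSL2R} {l : ℝ} (hl : 0 ≤ l)
    (hmin : ∀ z, Real.sinh (l / 2) ^ 2 ≤ disp T z) {z₀ : ℍ}
    (hz₀ : disp T z₀ = Real.sinh (l / 2) ^ 2) : IsGLB (Set.range (displacement T)) l := by
  refine IsLeast.isGLB ⟨⟨z₀, ?_⟩, ?_⟩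
  · refine le_antisymm ?_ ((displacement_le_iff hl).2 (hmin _))
    have h1 : Real.sinh (displacement T z₀ / 2) ^ 2 = Real.sinh (l / 2) ^ 2 := hz₀
    rw [sq_eq_sq₀ (Real.sinh_nonneg_iff.2 (div_nonneg (displacement_nonneg T z₀) zero_le_two))
      (Real.sinh_nonneg_iff.2 (by linarith))] at h1
    have := Real.sinh_injective h1
    linarith
  · rintro _ ⟨z, rfl⟩
    exact (displacement_le_iff hl).2 (hmin _)

theorem core_eq_of_min {T : PSL2R} {r : ℝ} (hmin : ∀ z, r ≤ disp T z) {z₀ : ℍ}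
    (hz₀ : disp T z₀ = r) : core T = {z | disp T z ≤ r} := by
  rw [core_eq]
  ext z
  exact ⟨fun h => (h z₀).trans_eq hz₀, fun h w => le_trans h (hmin w)⟩

theorem exists_length {d : ℝ} (hd : 1 ≤ d ^ 2) : ∃ l : ℝ≥0, Real.sinh ((l : ℝ) / 2) ^ 2 = d ^ 2 - 1 ∧
    (Boundary.geodesic l).trace = 2 * |d| := by
  have h0 : 0 ≤ Real.arsinh √(d ^ 2 - 1) := Real.arsinh_nonneg_iff.2 (Real.sqrt_nonneg _)
  refine ⟨⟨2 * Real.arsinh √(d ^ 2 - 1), by positivity⟩, ?_, ?_⟩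
  · change Real.sinh (2 * Real.arsinh √(d ^ 2 - 1) / 2) ^ 2 = _
    rw [mul_div_cancel_left₀ _ two_ne_zero, Real.sinh_arsinh, Real.sq_sqrt (by linarith)]
  · change 2 * Real.cosh (2 * Real.arsinh √(d ^ 2 - 1) / 2) = _
    rw [mul_div_cancel_left₀ _ two_ne_zero, Real.cosh_arsinh, Real.sq_sqrt (by linarith),
      ← Real.sqrt_sq_eq_abs]
    congr 2; ring

theorem exists_dispU_eq (hm1 : m ^ 2 - 1 ≠ 0) : ∃ z : ℍ, dispU m z = max (m ^ 2 - 1) 0 := by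
  have hp : 0 < |m ^ 2 - 1| := abs_pos.2 hm1
  refine ⟨⟨⟨0, √|m ^ 2 - 1|⟩, Real.sqrt_pos.2 hp⟩, ?_⟩
  rw [dispU_eq_iff hm1]
  have e1 : (⟨⟨0, √|m ^ 2 - 1|⟩, Real.sqrt_pos.2 hp⟩ : ℍ).re = 0 := rfl
  have e2 : nsq (⟨⟨0, √|m ^ 2 - 1|⟩, Real.sqrt_pos.2 hp⟩ : ℍ) = |m ^ 2 - 1| := by
    change (0 : ℝ) ^ 2 + √|m ^ 2 - 1| ^ 2 = _
    rw [Real.sq_sqrt hp.le]; ring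
  rw [e1, e2]
  rcases abs_cases (m ^ 2 - 1) with ⟨h, -⟩ | ⟨h, -⟩ <;> rw [h]
  · exact .inl rfl
  · exact .inr ⟨rfl, by ring⟩

theorem tr_rot {c d : ℝ} (h : d ^ 2 - (m ^ 2 - 1) * c ^ 2 = 1) : tr (rot m c d h) = 2 * |d| := by
  rw [rot, tr_cls, ← two_mul, abs_mul, abs_two]

theorem tr_genV (m q : ℝ) : tr (genV m q) = 2 * |q - m| := by
  rw [genV_eq, tr_conj, rotGen, tr_rot]

theorem disp_rot_min {c d : ℝ} (h : d ^ 2 - (m ^ 2 - 1) * c ^ 2 = 1) (z : ℍ) :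
    c ^ 2 * max (m ^ 2 - 1) 0 ≤ disp (rot m c d h) z := by
  rw [disp_rot']
  exact mul_le_mul_of_nonneg_left (le_dispU m z) (sq_nonneg c)

theorem exists_hasType_rot (hm1 : m ^ 2 - 1 ≠ 0) {c d : ℝ} (hc : 1 ≤ c ^ 2)
    (h : d ^ 2 - (m ^ 2 - 1) * c ^ 2 = 1) :
    ∃ u : Boundary, u.trace = tr (rot m c d h) ∧ HasType (rot m c d h) u := by
  obtain ⟨z₀, hz₀⟩ := exists_dispU_eq hm1
  rw [tr_rot]
  rcases lt_or_gt_of_ne hm1 with hk | hk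
  · refine ⟨.ellipticPoint (2 * |d|), rfl, ?_, tr_rot h⟩
    rw [IsElliptic, tr_rot]
    have : d ^ 2 < 1 := by nlinarith
    linarith [(sq_lt_one_iff_abs_lt_one _).1 this]
  · have hd : 1 < d ^ 2 := by nlinarith
    obtain ⟨l, hl, hl'⟩ := exists_length hd.le
    -- The determinant condition says `c ^ 2 * (m ^ 2 - 1) = d ^ 2 - 1`, so the smallest
    -- displacement corresponds to the trace `2 * |d|`.
    have e : c ^ 2 * max (m ^ 2 - 1) 0 = Real.sinh ((l : ℝ) / 2) ^ 2 := by
      rw [hl, max_eq_left hk.le]; linarith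
    have habs : 1 < |d| := (one_lt_sq_iff_one_lt_abs _).1 hd
    refine ⟨.geodesic l, hl', ?_, ?_, ?_⟩
    · intro h1
      have := congrArg tr h1
      rw [tr_rot, ← cls_one, tr_cls] at this
      norm_num at this
      linarith
    · rw [IsElliptic, tr_rot]; linarith
    · refine isGLB_displacement l.2 (fun z => ?_) (z₀ := z₀) ?_
      · rw [← e]; exact disp_rot_min h z
      · rw [← e, disp_rot', hz₀]

theorem genV_min (m q : ℝ) (z : ℍ) : (q - m) ^ 2 - 1 ≤ disp (genV m q) z := by
  rw [disp_genV]
  exact (le_max_left _ _).trans (le_dispU _ _)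

theorem exists_disp_genV_eq (hq : m + 1 < q) : ∃ z, disp (genV m q) z = (q - m) ^ 2 - 1 := by
  have hs : 0 < (q - m) ^ 2 - 1 := by nlinarith
  obtain ⟨z₀, hz₀⟩ := exists_dispU_eq hs.ne'
  refine ⟨shift q • z₀, ?_⟩
  rw [disp_genV, inv_smul_smul, hz₀, max_eq_left hs.le]

theorem exists_hasType_genV (hq : m + 1 < q) :
    ∃ v : ℝ≥0, (Boundary.geodesic v).trace = tr (genV m q) ∧
      HasType (genV m q) (.geodesic v) := by
  have hs : 1 < (q - m) ^ 2 := by nlinarith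
  have habs : 1 < |q - m| := (one_lt_sq_iff_one_lt_abs _).1 hs
  obtain ⟨v, hv, hv'⟩ := exists_length hs.le
  obtain ⟨z₀, hz₀⟩ := exists_disp_genV_eq hq
  refine ⟨v, by rw [hv', tr_genV], ?_, ?_, ?_⟩
  · intro h1
    have := congrArg tr h1
    rw [tr_genV, ← cls_one, tr_cls] at this
    norm_num at this
    linarith
  · rw [IsElliptic, tr_genV]; linarith
  · refine isGLB_displacement v.2 (fun z => ?_) (z₀ := z₀) ?_
    · rw [hv]; exact genV_min m q z
    · rw [hv, hz₀]

theorem exists_disp_shift_lt (t : ℝ) {r : ℝ} (hr : 0 < r) : ∃ z : ℍ, disp (shift t) z < r := by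
  have hy : 0 < √(t ^ 2 / r + 1) := by positivity
  refine ⟨⟨⟨0, √(t ^ 2 / r + 1)⟩, hy⟩, ?_⟩
  rw [disp_shift]
  change t ^ 2 / (4 * √(t ^ 2 / r + 1) ^ 2) < r
  rw [Real.sq_sqrt (by positivity), div_lt_iff₀ (by positivity)]
  field_simp
  nlinarith [sq_nonneg t]

theorem hasType_shift {t : ℝ} (ht : t ≠ 0) : HasType (shift t) (.geodesic 0) := by
  refine ⟨shift_ne_one ht, ?_, ?_, ?_⟩
  · rw [IsElliptic, shift, tr_cls]; norm_num
  · rintro _ ⟨z, rfl⟩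
    exact displacement_nonneg _ _
  · intro b hb
    by_contra! hb0
    have hb0 : 0 < b := hb0
    have hs : 0 < Real.sinh (b / 2) ^ 2 := by
      have := Real.sinh_pos_iff.2 (half_pos hb0); positivity
    obtain ⟨z, hz⟩ := exists_disp_shift_lt t hs
    have := (displacement_le_iff hb0.le).1 (hb ⟨z, rfl⟩)
    linarith

theorem core_shift {t : ℝ} (ht : t ≠ 0) : core (shift t) = ∅ := by
  rw [core_eq, Set.eq_empty_iff_forall_notMem]
  intro z hz
  have hy := z.im_pos
  have hpos : 0 < disp (shift t) z := by rw [disp_shift]; positivity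
  obtain ⟨w, hw⟩ := exists_disp_shift_lt t hpos
  exact absurd (hz w) (not_le.2 hw)

end Types

/-- The point at Euclidean distance `|t|` above `z`. -/
def above (z : ℍ) (t : ℝ) : ℍ := ⟨⟨z.re, z.im + |t|⟩, add_pos_of_pos_of_nonneg z.im_pos (abs_nonneg t)⟩

theorem above_re (z : ℍ) (t : ℝ) : (above z t).re = z.re := rfl

theorem above_im (z : ℍ) (t : ℝ) : (above z t).im = z.im + |t| := rfl

theorem above_zero (z : ℍ) : above z 0 = z :=
  UpperHalfPlane.ext_re_im rfl (by rw [above_im, abs_zero, add_zero])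

theorem nsq_above_lt (z : ℍ) {t : ℝ} (ht : t ≠ 0) : nsq z < nsq (above z t) := by
  have := abs_pos.2 ht
  have := z.im_pos
  unfold nsq
  rw [above_re, above_im]
  nlinarith

theorem continuous_above (z : ℍ) : Continuous (above z) := by
  rw [UpperHalfPlane.isEmbedding_coe.continuous_iff]
  have : Continuous fun t : ℝ => (z.re : ℂ) + ((z.im + |t| : ℝ) : ℂ) * Complex.I := by fun_prop
  convert this using 2 with t
  exact Complex.mk_eq_add_mul_I _ _

namespace Setup

theorem m_sq (S : Setup m q K G) : m ^ 2 - 1 ≠ 0 := by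
  intro h
  have h0 := S.nonneg
  have : (m - 1) * (m + 1) = 0 := by linarith
  rcases mul_eq_zero.1 this with h | h
  · exact S.ne_one (by linarith)
  · linarith

theorem sepV' {r : ℝ}
    (hr : ∀ z : ℍ, 2 * m * z.re ≤ nsq z + (m ^ 2 - 1) → disp (genV m q) z < r →
      midEnd m q < z.re) {z : ℍ} (hz : OutCircles m z) (h : dispV m q z < r) :
    midEnd m q < |z.re| := by
  let w : ℍ := ⟨⟨|z.re|, z.im⟩, z.im_pos⟩
  have e1 : w.re = |z.re| := rfl
  have e2 : w.im = z.im := rfl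
  have := hr w ?_ ?_
  · exact this
  · rw [nsq, e1, e2, sq_abs]; exact hz
  · rw [disp_genV_of_nonneg (abs_nonneg _), dispV_eq_of_re (by rw [e1, abs_abs]) e2]
    exact h

theorem dispV_le_iff {z : ℍ} : dispV m q z ≤ (q - m) ^ 2 - 1 ↔
    nsq z = 2 * q * |z.re| - 2 * q * m + (m ^ 2 - 1) := by
  have hy := z.im_pos
  have e : (|z.re| - q) ^ 2 + z.im ^ 2 - ((q - m) ^ 2 - 1) =
      nsq z - (2 * q * |z.re| - 2 * q * m + (m ^ 2 - 1)) := by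
    rw [nsq, ← sq_abs z.re]; ring
  unfold dispV
  rw [e, add_le_iff_nonpos_right, div_le_iff₀ (by positivity), zero_mul, sq_nonpos_iff, sub_eq_zero]

/-- A point of the fundamental domain lies in the closure of the Y-piece if and only if it is not
strictly beyond the sides. -/
theorem mem_closure_iff (S : Setup m q K G) {f : Surface G → ℂ}
    (hfc : ∀ z, Fund m q z → f (proj G z) = chart m q z) {z : ℍ} (hz : Fund m q z) :
    proj G z ∈ closure (f ⁻¹' {0, 1}ᶜ) ↔ m ^ 2 - 1 ≤ nsq z ∧
      2 * q * |z.re| - 2 * q * m + (m ^ 2 - 1) ≤ nsq z := by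
  have hm := S.nonneg
  have hq := S.lt
  have hmemS : ∀ z, Fund m q z → (proj G z ∈ f ⁻¹' {0, 1}ᶜ ↔ ¬ BeyondU m z ∧ ¬ BeyondV m q z) := by
    intro z hz
    rw [Set.mem_preimage, hfc z hz, ← chart_eq_zero_iff_beyondU hm hq hz,
      ← chart_eq_one_iff_beyondV hm hq hz]
    simp
  constructor
  · intro h
    -- The smaller of the heights above the two axis lines is invariant under the side pairing,
    -- hence continuous on the quotient; it is nonnegative on the Y-piece and so on its closure.
    obtain ⟨g, hg, hgF⟩ := S.exists_lift
      (fun z => min (nsq z - (m ^ 2 - 1)) (nsq z - (2 * q * |z.re| - 2 * q * m + (m ^ 2 - 1))))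
      (by
        have h1 := UpperHalfPlane.continuous_re
        have h2 := UpperHalfPlane.continuous_im
        unfold nsq
        exact Continuous.continuousOn (by fun_prop))
      (fun z w h1 h2 _ _ => by simp only [nsq_congr h1 h2, h1, abs_neg])
    have hsub : closure (f ⁻¹' {0, 1}ᶜ) ⊆ g ⁻¹' Set.Ici 0 := by
      refine closure_minimal ?_ (isClosed_Ici.preimage hg)
      intro x hx
      obtain ⟨z, rfl⟩ := proj_surjective G x
      obtain ⟨γ, hγ, hF, -⟩ := S.exists_fund z
      rw [← proj_smul hγ] at hx ⊢
      obtain ⟨h1, h2⟩ := (hmemS _ hF).1 hx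
      unfold BeyondU at h1
      unfold BeyondV at h2
      push Not at h1 h2
      rw [Set.mem_preimage, hgF _ hF]
      exact le_min (sub_nonneg.2 h1.1.le) (sub_nonneg.2 h2.le)
    have := hsub h
    rw [Set.mem_preimage, hgF _ hz, Set.mem_Ici, le_min_iff] at this
    exact ⟨by linarith [this.1], by linarith [this.2]⟩
  · rintro ⟨h1, h2⟩
    -- Conversely, moving straight up makes all inequalities strict without leaving the domain.
    have hc : Filter.Tendsto (fun t => proj G (above z t)) (nhdsWithin 0 {0}ᶜ) (nhds (proj G z)) := by
      have h3 := ((continuous_proj G).comp (continuous_above z)).tendsto 0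
      simp only [Function.comp, above_zero] at h3
      exact h3.mono_left nhdsWithin_le_nhds
    refine mem_closure_of_tendsto hc ?_
    filter_upwards [self_mem_nhdsWithin] with t ht
    have h4 := nsq_above_lt z ht
    have hz2 := hz.2
    unfold OutCircles at hz2
    have hF : Fund m q (above z t) := by
      refine ⟨hz.1, ?_⟩
      unfold OutCircles
      rw [above_re]; linarith
    rw [hmemS _ hF]
    unfold BeyondU BeyondV
    rw [above_re]
    push Not
    refine ⟨⟨by linarith, fun h0 => ?_⟩, by linarith⟩
    rw [h0, abs_zero] at hz2
    linarith

end Setup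

end

/-! ### Assembling the Y-piece. -/

section

variable {m q : ℝ} {K G : Subgroup PSL2R}

/-- A height above which there are only points of the cusp. -/
noncomputable def cuspHeight (m q : ℝ) : ℝ := 3 + m ^ 2 + (q - m) ^ 2

theorem one_le_cuspHeight (m q : ℝ) : 1 ≤ cuspHeight m q := by
  unfold cuspHeight; nlinarith [sq_nonneg m, sq_nonneg (q - m)]

theorem im_le_of_dispU_lt {ε : ℝ} (hε : ε ≤ 1) {z : ℍ}
    (hz : dispU m z < max (m ^ 2 - 1) 0 + ε) : z.im ≤ cuspHeight m q := by
  by_contra! hy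
  have h1 : 3 + m ^ 2 < z.im := by
    unfold cuspHeight at hy; nlinarith [sq_nonneg (q - m)]
  rw [dispU_lt_iff] at hz
  have h2 : max (m ^ 2 - 1) 0 - (m ^ 2 - 1) + ε ≤ 2 := by
    rcases max_cases (m ^ 2 - 1) 0 with ⟨h, -⟩ | ⟨h, -⟩ <;> rw [h] <;> nlinarith [sq_nonneg m]
  have hy0 := z.im_pos
  have h3 : 3 * z.im ≤ nsq z - (m ^ 2 - 1) := by
    unfold nsq
    nlinarith [sq_nonneg z.re, sq_nonneg m]
  have h4 : (3 * z.im) ^ 2 ≤ (nsq z - (m ^ 2 - 1)) ^ 2 := by gcongr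
  have h5 : 4 * z.im ^ 2 * (max (m ^ 2 - 1) 0 - (m ^ 2 - 1) + ε) ≤ 4 * z.im ^ 2 * 2 := by gcongr
  nlinarith

theorem im_le_of_dispV_lt {ε : ℝ} (hε : ε ≤ 1) {z : ℍ}
    (hz : dispV m q z < (q - m) ^ 2 - 1 + ε) : z.im ≤ cuspHeight m q := by
  by_contra! hy
  have h1 : 3 + (q - m) ^ 2 < z.im := by
    unfold cuspHeight at hy; nlinarith [sq_nonneg m]
  have hy0 := z.im_pos
  unfold dispV at hz
  rw [add_lt_add_iff_left, div_lt_iff₀ (by positivity)] at hz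
  have h3 : 3 * z.im ≤ (|z.re| - q) ^ 2 + z.im ^ 2 - ((q - m) ^ 2 - 1) := by
    nlinarith [sq_nonneg (|z.re| - q), sq_nonneg (q - m)]
  have h4 : (3 * z.im) ^ 2 ≤ ((|z.re| - q) ^ 2 + z.im ^ 2 - ((q - m) ^ 2 - 1)) ^ 2 := by gcongr
  have h5 : ε * (4 * z.im ^ 2) ≤ 1 * (4 * z.im ^ 2) := by gcongr
  nlinarith

theorem disp_shift_lt_iff (hq : 0 < q) {H : ℝ} (hH : 0 < H) {z : ℍ} :
    disp (shift (2 * q)) z < q ^ 2 / H ^ 2 ↔ H < z.im := by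
  have hy := z.im_pos
  rw [disp_shift, div_lt_div_iff₀ (by positivity) (by positivity), ← sq_lt_sq₀ hH.le hy.le]
  have : 0 < q ^ 2 := by positivity
  constructor <;> intro h <;> nlinarith

theorem continuous_dispU (m : ℝ) : Continuous (dispU m) := by
  have := continuous_disp (rotGen m)
  simp only [funext (disp_rotGen m)] at this
  exact this

theorem continuous_dispV (m q : ℝ) : Continuous (dispV m q) := by
  have h1 := UpperHalfPlane.continuous_re
  have h2 := UpperHalfPlane.continuous_im
  unfold dispV
  refine continuous_const.add (Continuous.div (by fun_prop) (by fun_prop) fun z => ?_)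
  have := z.im_pos
  positivity

theorem iUnion_fin_three {α : Type*} (A : Fin 3 → Set α) : ⋃ i, A i = A 0 ∪ A 1 ∪ A 2 := by
  ext x
  simp only [Set.mem_iUnion, Fin.exists_fin_succ, Set.mem_union, Fin.exists_fin_zero]
  tauto

namespace Setup

/-- The quotient by the group `G` contains a Y-piece. -/
theorem containsYPiece (S : Setup m q K G) {c d : ℝ} (hc : 1 ≤ c ^ 2)
    (h : d ^ 2 - (m ^ 2 - 1) * c ^ 2 = 1) (hzK : Subgroup.zpowers (rot m c d h) = K)
    {u : Boundary} (hu : HasType (rot m c d h) u) {v : ℝ≥0}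
    (hv : HasType (genV m q) (.geodesic v)) :
    ContainsYPiece G u (.geodesic v) (.geodesic 0) := by
  have hm := S.nonneg
  have hq := S.lt
  have hq0 := S.q_pos
  obtain ⟨f, hf, hfc⟩ := S.exists_chart_lift
  obtain ⟨ε, hε, hε1, hsU⟩ := exists_sepU hm S.ne_one hq
  obtain ⟨ε', hε', hε1', hsV⟩ := exists_sepV hq
  have hmid := lt_midEnd hq
  set rU := max (m ^ 2 - 1) 0 + ε with hrU
  set rV := (q - m) ^ 2 - 1 + ε' with hrV
  set H := cuspHeight m q with hH
  have hH1 : 1 ≤ H := one_le_cuspHeight m q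
  have hH0 : 0 < H := by linarith
  have hc0 : 0 < c ^ 2 := by linarith
  have hTK : rot m c d h ∈ K := hzK ▸ Subgroup.mem_zpowers _
  obtain ⟨δ₀, hδ₀⟩ := exists_tube_eq (rot m c d h) (c ^ 2 * rU)
  obtain ⟨δ₁, hδ₁⟩ := exists_tube_eq (genV m q) rV
  obtain ⟨δ₂, hδ₂⟩ := exists_tube_eq (shift (2 * q)) (q ^ 2 / H ^ 2)
  have hδ₀ : tube (rot m c d h) δ₀ = {z | dispU m z < rU} := by
    rw [hδ₀]; ext z
    rw [Set.mem_ofPred_eq, disp_rot', mul_lt_mul_iff_right₀ hc0]; rfl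
  have hδ₂ : tube (shift (2 * q)) δ₂ = {z | H < z.im} := by
    rw [hδ₂]; ext z
    exact disp_shift_lt_iff hq0 hH0
  obtain ⟨zU, hzU⟩ := exists_dispU_eq S.m_sq
  obtain ⟨zV, hzV⟩ := exists_disp_genV_eq hq
  have hcore₀ : core (rot m c d h) = {z | dispU m z ≤ max (m ^ 2 - 1) 0} := by
    rw [core_eq_of_min (disp_rot_min h) (z₀ := zU) (by rw [disp_rot', hzU])]
    ext z
    rw [Set.mem_ofPred_eq, disp_rot', mul_le_mul_iff_right₀ hc0]; rfl
  have hcore₁ : core (genV m q) = {z | disp (genV m q) z ≤ (q - m) ^ 2 - 1} :=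
    core_eq_of_min (genV_min m q) hzV
  have hcore₂ : core (shift (2 * q)) = ∅ := core_shift (by positivity)
  have hltU : ∀ x, x ≤ max (m ^ 2 - 1) 0 → x < rU := fun x hx => by linarith
  have hltV : ∀ x, x ≤ (q - m) ^ 2 - 1 → x < rV := fun x hx => by linarith
  set Y := f ⁻¹' {0, 1}ᶜ with hY
  have hopen : IsOpen Y := (Set.toFinite _).isClosed.isOpen_compl.preimage hf
  have hmemY : ∀ z, Fund m q z → (proj G z ∈ Y ↔ ¬ BeyondU m z ∧ ¬ BeyondV m q z) := by
    intro z hz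
    rw [hY, Set.mem_preimage, hfc z hz, ← chart_eq_zero_iff_beyondU hm hq hz,
      ← chart_eq_one_iff_beyondV hm hq hz]
    simp
  have hfr : frontier Y = proj G '' {z | dispU m z ≤ max (m ^ 2 - 1) 0} ∪
      proj G '' {z | disp (genV m q) z ≤ (q - m) ^ 2 - 1} := by
    ext x
    obtain ⟨z, rfl⟩ := proj_surjective G x
    obtain ⟨γ, hγ, hF, -⟩ := S.exists_fund z
    rw [← proj_smul hγ]
    generalize γ • z = z at hF
    rw [hopen.frontier_eq, Set.mem_sdiff, hmemY z hF, S.mem_closure_iff hfc hF, Set.mem_union,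
      S.projU hsU (p := (· ≤ max (m ^ 2 - 1) 0)) hltU hF,
      S.projV hsV (p := (· ≤ (q - m) ^ 2 - 1)) hltV hF, dispV_le_iff]
    have hF2 := hF.2
    unfold OutCircles at hF2
    have hU : dispU m z ≤ max (m ^ 2 - 1) 0 ↔
        nsq z = m ^ 2 - 1 ∨ (z.re = 0 ∧ nsq z + (m ^ 2 - 1) = 0) := by
      rw [← dispU_eq_iff S.m_sq]
      exact ⟨fun h => le_antisymm h (le_dispU m z), le_of_eq⟩
    constructor
    · rintro ⟨⟨h1, h2⟩, h3⟩
      rw [not_and_or, not_not, not_not] at h3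
      rcases h3 with (h3 | h3) | h3
      · exact .inl (hU.2 (.inl (le_antisymm h3 h1)))
      · exact .inl (hU.2 (.inr h3))
      · exact .inr (le_antisymm h3 h2)
    · rintro (h1 | h1)
      · have h2 := hsU z hF.2 (hltU _ h1)
        have h3 := right_line_midEnd hq h2.le
        rw [← right_line hq] at h3
        rw [hU] at h1
        refine ⟨⟨?_, by linarith⟩, fun h4 => h4.1 ?_⟩
        · rcases h1 with h1 | h1
          · exact h1.ge
          · have := nsq_pos z; linarith
        · rcases h1 with h1 | h1
          · exact .inl h1.le
          · exact .inr h1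
      · have h2 := sepV' hsV hF.2 (hltV _ (dispV_le_iff.2 h1))
        refine ⟨⟨?_, h1.ge⟩, fun h4 => h4.2 h1.le⟩
        have : m * m ≤ m * |z.re| := by gcongr; linarith
        nlinarith
  have hUY : ∀ z, dispU m z ≤ max (m ^ 2 - 1) 0 → proj G z ∈ closure Y := fun z hz =>
    frontier_subset_closure (hfr ▸ .inl ⟨z, hz, rfl⟩)
  have hVY : ∀ z, disp (genV m q) z ≤ (q - m) ^ 2 - 1 → proj G z ∈ closure Y := fun z hz =>
    frontier_subset_closure (hfr ▸ .inr ⟨z, hz, rfl⟩)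
  let P : Fin 3 → PSL2R := ![rot m c d h, genV m q, shift (2 * q)]
  let δ : Fin 3 → ℝ := ![δ₀, δ₁, δ₂]
  have htube0 : tube (P 0) (δ 0) = {z | dispU m z < rU} := hδ₀
  have htube1 : tube (P 1) (δ 1) = {z | disp (genV m q) z < rV} := hδ₁
  have htube2 : tube (P 2) (δ 2) = {z | H < z.im} := hδ₂
  have hopen_tube : ∀ i, IsOpen (tube (P i) (δ i)) := fun i =>
    isOpen_lt (continuous_displacement _) continuous_const
  have hp0 : ∀ z, Fund m q z → (proj G z ∈ proj G '' tube (P 0) (δ 0) ↔ dispU m z < rU) :=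
    fun z hz => by rw [htube0]; exact S.projU hsU (p := (· < rU)) (fun _ => id) hz
  have hp1 : ∀ z, Fund m q z → (proj G z ∈ proj G '' tube (P 1) (δ 1) ↔ dispV m q z < rV) :=
    fun z hz => by rw [htube1]; exact S.projV hsV (p := (· < rV)) (fun _ => id) hz
  have hp2 : ∀ z, Fund m q z → (proj G z ∈ proj G '' tube (P 2) (δ 2) ↔ H < z.im) :=
    fun z hz => by rw [htube2]; exact S.projB hH1 hz
  have hrep : ∀ x : Surface G, ∃ z, Fund m q z ∧ proj G z = x := by
    intro x
    obtain ⟨z, rfl⟩ := proj_surjective G x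
    obtain ⟨g, hg, hF, -⟩ := S.exists_fund z
    exact ⟨g • z, hF, proj_smul hg z⟩
  have hYpt : ∃ z, Fund m q z ∧ proj G z ∈ Y ∧ H < z.im := by
    refine ⟨⟨⟨0, H + 1⟩, by linarith⟩, ?_⟩
    set z : ℍ := ⟨⟨0, H + 1⟩, by linarith⟩
    have e1 : z.re = 0 := rfl
    have e2 : z.im = H + 1 := rfl
    have e3 : nsq z = (H + 1) ^ 2 := by rw [nsq, e1, e2]; ring
    have e4 : m ^ 2 + 3 ≤ H := by rw [hH, cuspHeight]; nlinarith [sq_nonneg (q - m)]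
    have e5 : m ^ 2 + 3 ≤ nsq z := by rw [e3]; nlinarith
    have hF : Fund m q z := by
      refine ⟨by rw [e1, abs_zero]; exact hq0.le, ?_⟩
      unfold OutCircles
      rw [e1, abs_zero]; nlinarith [sq_nonneg m]
    refine ⟨hF, ?_, by rw [e2]; linarith⟩
    rw [hmemY z hF, BeyondU, BeyondV, e1, abs_zero]
    have := mul_nonneg hq0.le hm
    push Not
    exact ⟨⟨by linarith, fun _ => by nlinarith [sq_nonneg m]⟩, by linarith⟩
  refine ⟨Y, hopen, ?_, S.nonempty_homeomorph hf hfc, P, δ, ?_, ?_, ?_, ?_, ?_⟩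
  · intro z hz g hg hgz
    obtain ⟨γ, hγ, hF, -⟩ := S.exists_fund z
    rw [← proj_smul hγ, hmemY _ hF] at hz
    have hfix : (γ * g * γ⁻¹) • γ • z = γ • z := by simp [mul_smul, hgz]
    have hu := S.unique (mul_mem (mul_mem hγ hg) (inv_mem hγ)) hF (by rwa [hfix])
    rw [hfix] at hu
    rcases hu with hu | ⟨hu, -, hside, -⟩
    · simpa using hu
    -- A nontrivial stabilizer identifies the point with its mirror image, so it lies on the
    -- imaginary axis and on a side: it is the elliptic vertex, which is beyond `u`.
    · exfalso
      have h0 : (γ • z).re = 0 := by linarith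
      refine hz.1 (.inr ⟨h0, ?_⟩)
      rcases hside with hs | hs
      · rw [h0, abs_zero] at hs; linarith
      · rw [h0, abs_zero, mul_zero] at hs; exact hs
  · have b0 : IsBoundary G (P 0) (δ 0) u := by
      refine ⟨S.K_le hTK, hu, ⟨zU, by rw [htube0]; exact hltU _ hzU.le⟩, ?_⟩
      intro g hg z hz hgz
      rw [htube0] at hz hgz
      change g ∈ Subgroup.zpowers (rot m c d h)
      rw [hzK]
      exact S.preciseU hsU hz hg hgz
    have b1 : IsBoundary G (P 1) (δ 1) (.geodesic v) := by
      refine ⟨S.genV_mem, hv, ⟨zV, by rw [htube1]; exact hltV _ hzV.le⟩, ?_⟩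
      intro g hg z hz hgz
      rw [htube1] at hz hgz
      exact S.preciseV hsV hz hg hgz
    have b2 : IsBoundary G (P 2) (δ 2) (.geodesic 0) := by
      obtain ⟨w, -, -, hw⟩ := hYpt
      refine ⟨S.shift_mem, hasType_shift (by positivity), ⟨w, by rw [htube2]; exact hw⟩, ?_⟩
      intro g hg z hz hgz
      rw [htube2] at hz hgz
      exact S.preciseB (hH1.trans_lt hz) hg (hH1.trans_lt hgz)
    intro i
    fin_cases i
    exacts [b0, b1, b2]
  · have d01 : Disjoint (proj G '' tube (P 0) (δ 0)) (proj G '' tube (P 1) (δ 1)) := by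
      rw [Set.disjoint_left]
      intro x hx hx'
      obtain ⟨z, hz, rfl⟩ := hrep x
      have h1 := hsU z hz.2 ((hp0 z hz).1 hx)
      have h2 := sepV' hsV hz.2 ((hp1 z hz).1 hx')
      linarith
    have d02 : Disjoint (proj G '' tube (P 0) (δ 0)) (proj G '' tube (P 2) (δ 2)) := by
      rw [Set.disjoint_left]
      intro x hx hx'
      obtain ⟨z, hz, rfl⟩ := hrep x
      have h1 := im_le_of_dispU_lt (q := q) hε1 ((hp0 z hz).1 hx)
      exact absurd ((hp2 z hz).1 hx') (not_lt.2 h1)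
    have d12 : Disjoint (proj G '' tube (P 1) (δ 1)) (proj G '' tube (P 2) (δ 2)) := by
      rw [Set.disjoint_left]
      intro x hx hx'
      obtain ⟨z, hz, rfl⟩ := hrep x
      have h1 := im_le_of_dispV_lt hε1' ((hp1 z hz).1 hx)
      exact absurd ((hp2 z hz).1 hx') (not_lt.2 h1)
    intro i j hij
    fin_cases i <;> fin_cases j
    · exact absurd rfl hij
    · exact d01
    · exact d02
    · exact d01.symm
    · exact absurd rfl hij
    · exact d12
    · exact d02.symm
    · exact d12.symm
    · exact absurd rfl hij
  · rw [hfr, iUnion_fin_three]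
    change _ = (proj G '' core (rot m c d h) ∪ proj G '' core (genV m q)) ∪
      proj G '' core (shift (2 * q))
    rw [hcore₀, hcore₁, hcore₂, Set.image_empty, Set.union_empty]
  · intro i
    -- Since `proj` is open, the image of a tube is a neighbourhood of each of its points, and so it
    -- meets the Y-piece if it meets the closure.
    have hcl : ∀ i, ∀ z ∈ tube (P i) (δ i), proj G z ∈ closure Y →
        (Y ∩ proj G '' tube (P i) (δ i)).Nonempty := fun i z hz hzc => by
      rw [Set.inter_comm]
      exact _root_.mem_closure_iff.1 hzc _ (isOpenMap_proj G _ (hopen_tube i)) ⟨z, hz, rfl⟩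
    have n0 := hcl 0 zU (by rw [htube0]; exact hltU _ hzU.le) (hUY _ hzU.le)
    have n1 := hcl 1 zV (by rw [htube1]; exact hltV _ hzV.le) (hVY _ hzV.le)
    have n2 : (Y ∩ proj G '' tube (P 2) (δ 2)).Nonempty := by
      obtain ⟨z, -, hzY, hz⟩ := hYpt
      exact hcl 2 z (by rw [htube2]; exact hz) (subset_closure hzY)
    fin_cases i
    exacts [n0, n1, n2]
  -- Outside the horoball both coordinates are bounded. Requiring points to stay off the tubes also
  -- keeps them off the frontier, so weak inequalities describe the set and it is compact.
  · have hcpt : IsCompact ({z : ℍ | |z.re| ≤ q ∧ lowBd m q |z.re| ≤ nsq z ∧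
        nsq z ≤ q ^ 2 + H ^ 2} ∩ {z | OutCircles m z ∧ rU ≤ dispU m z ∧ rV ≤ dispV m q z ∧
          z.im ≤ H}) := by
      refine (isCompact_above hm S.ne_one hq _).inter_right ?_
      have h1 := UpperHalfPlane.continuous_re
      have h2 := UpperHalfPlane.continuous_im
      have h3 : Continuous (dispU m) := continuous_dispU m
      have h4 : Continuous (dispV m q) := continuous_dispV m q
      have h5 : IsClosed {z : ℍ | OutCircles m z} := by
        unfold OutCircles nsq
        exact isClosed_le (by fun_prop) (by fun_prop)
      exact h5.inter ((isClosed_le continuous_const h3).inter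
        ((isClosed_le continuous_const h4).inter (isClosed_le h2 continuous_const)))
    have himg : Y \ ⋃ i, proj G '' tube (P i) (δ i) = proj G '' ({z : ℍ | |z.re| ≤ q ∧
        lowBd m q |z.re| ≤ nsq z ∧ nsq z ≤ q ^ 2 + H ^ 2} ∩ {z | OutCircles m z ∧
          rU ≤ dispU m z ∧ rV ≤ dispV m q z ∧ z.im ≤ H}) := by
      have hmem : ∀ z, Fund m q z → (proj G z ∈ Y \ ⋃ i, proj G '' tube (P i) (δ i) ↔
          (¬ BeyondU m z ∧ ¬ BeyondV m q z) ∧ rU ≤ dispU m z ∧ rV ≤ dispV m q z ∧ z.im ≤ H) := by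
        intro z hz
        rw [Set.mem_sdiff, hmemY z hz, iUnion_fin_three, Set.mem_union, Set.mem_union,
          hp0 z hz, hp1 z hz, hp2 z hz]
        simp only [not_or, not_lt, and_assoc]
      ext x
      constructor
      · intro hx
        obtain ⟨z, hz, rfl⟩ := hrep x
        obtain ⟨⟨hbU, hbV⟩, h1, h2, h3⟩ := (hmem z hz).1 hx
        unfold BeyondU at hbU
        unfold BeyondV at hbV
        push Not at hbU hbV
        refine ⟨z, ⟨⟨hz.1, lowBd_le_nsq hz.2 hbU.1.le hbV.le, ?_⟩, hz.2, h1, h2, h3⟩, rfl⟩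
        have h4 := hz.1
        have h5 := z.im_pos
        rw [nsq, ← sq_abs z.re]
        gcongr
      · rintro ⟨z, ⟨⟨h1, h2, -⟩, h3, h4, h5, h6⟩, rfl⟩
        refine (hmem z ⟨h1, h3⟩).2 ⟨⟨fun hb => ?_, fun hb => ?_⟩, h4, h5, h6⟩
        · refine not_lt.2 h4 (hltU _ ((dispU_eq_iff S.m_sq).2 ?_).le)
          exact hb.imp_left fun hb => le_antisymm hb ((le_max_left _ _).trans h2)
        · refine not_lt.2 h5 (hltV _ (dispV_le_iff.2 ?_))
          exact le_antisymm hb (((le_max_right _ _).trans (le_max_right _ _)).trans h2)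
    rw [himg]
    exact hcpt.image (continuous_proj G)

end Setup

end

/-! ### Normal form of a pair of elements of a Fuchsian group. -/

theorem abs_eq_one_of_sq {a : ℝ} (h : a ^ 2 = 1) : |a| = 1 := by
  rw [← sq_abs] at h
  exact (pow_eq_one_iff_of_nonneg (abs_nonneg a) two_ne_zero).1 h

theorem cls_eq_one_iff {a b c d : ℝ} {h : a * d - b * c = 1} :
    cls a b c d h = 1 ↔ a ^ 2 = 1 ∧ b = 0 ∧ c = 0 ∧ a = d := by
  rw [← cls_one, cls_eq_iff]
  constructor
  · rintro (⟨rfl, rfl, rfl, rfl⟩ | ⟨rfl, rfl, rfl, rfl⟩) <;> norm_num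
  · rintro ⟨h1, rfl, rfl, rfl⟩
    rw [sq, mul_self_eq_one_iff] at h1
    rcases h1 with rfl | rfl <;> norm_num

/-- A parabolic element is conjugate to a translation. -/
theorem IsParabolic.exists_conj_eq_shift {P : PSL2R} (hP : IsParabolic P) :
    ∃ h t, t ≠ 0 ∧ h * P * h⁻¹ = shift t := by
  obtain ⟨hne, htr⟩ := hP
  obtain ⟨a, b, c, d, h, rfl, had⟩ : ∃ a b c d h, P = cls a b c d h ∧ a + d = 2 := by
    obtain ⟨a, b, c, d, h, rfl⟩ := exists_eq_cls P
    rw [tr_cls] at htr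
    rcases abs_eq (by norm_num) |>.1 htr with h1 | h1
    · exact ⟨a, b, c, d, h, rfl, h1⟩
    · exact ⟨-a, -b, -c, -d, by linarith, (cls_neg _ _ _ _ h).symm, by linarith⟩
  by_cases hc : c = 0
  · subst hc
    have ha : a = 1 := by
      have : (a - 1) ^ 2 = 0 := by linear_combination a * had - h
      have := pow_eq_zero_iff (two_ne_zero) |>.1 this
      linarith
    have hd : d = 1 := by linarith
    subst ha hd
    refine ⟨1, b, ?_, by rw [one_mul, inv_one, mul_one, shift]⟩
    rintro rfl
    exact hne cls_one
  · obtain ⟨x, hx⟩ : ∃ x, c * x = (a - d) / 2 := ⟨(a - d) / 2 / c, by field_simp⟩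
    -- The number `x` is the fixed point of the parabolic element, and `z ↦ -1 / (z - x)` sends it
    -- to ∞.
    refine ⟨cls 0 (-1) 1 (-x) (by ring), -c, neg_ne_zero.2 hc, ?_⟩
    rw [cls_inv, cls_mul, cls_mul, shift]
    apply cls_congr
    · linear_combination hx + had / 2
    · ring
    · refine mul_left_cancel₀ hc ?_
      linear_combination (c * x - (a - d) / 2) * hx + h - (a + d + 2) / 4 * had
    · linear_combination -hx + had / 2

theorem displacement_le_displacement_iff {S T : PSL2R} {z w : ℍ} :
    displacement S z ≤ displacement T w ↔ disp S z ≤ disp T w := by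
  rw [displacement_le_iff (displacement_nonneg S z)]
  rfl

/-- A discrete group with a translation contains no other maps `z ↦ a * z + b`. -/
theorem OrbitFinite.sq_eq_one {G : Subgroup PSL2R} (hG : OrbitFinite G) {t : ℝ} (ht : t ≠ 0)
    (hs : shift t ∈ G) {a b d : ℝ} {h : a * d - b * 0 = 1} (hT : cls a b 0 d h ∈ G) :
    a ^ 2 = 1 := by
  have had : a * d = 1 := by linarith
  have ha0 : a ≠ 0 := left_ne_zero_of_mul_eq_one had
  -- A contraction would conjugate the translation to infinitely many shorter ones. The inverse
  -- element gives the opposite bound.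
  have main : ∀ {a b d : ℝ} {h : a * d - b * 0 = 1}, cls a b 0 d h ∈ G → 1 ≤ a ^ 2 := by
    intro a b d h hT
    by_contra! hlt
    have ha0 : a ≠ 0 := by rintro rfl; norm_num at h
    have hpos : 0 < a ^ 2 := by positivity
    have hconj : ∀ s, cls a b 0 d h * shift s * (cls a b 0 d h)⁻¹ = shift (a ^ 2 * s) := by
      intro s
      rw [shift, cls_inv, cls_mul, cls_mul, shift]
      apply cls_congr <;> linarith
    have hmem : ∀ n : ℕ, shift ((a ^ 2) ^ n * t) ∈ G := by
      intro n
      induction n with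
      | zero => simpa using hs
      | succ n ih =>
        rw [pow_succ', mul_assoc, ← hconj]
        exact mul_mem (mul_mem hT ih) (inv_mem hT)
    refine Set.infinite_of_injective_forall_mem (f := fun n : ℕ => shift ((a ^ 2) ^ n * t))
      (s := {g | g ∈ G ∧ dist basePt (g • basePt) ≤ displacement (shift t) basePt}) ?_ ?_
      (hG basePt basePt _)
    · intro n k hnk
      have h1 := congrArg (fun g : PSL2R => (g • basePt).re) hnk
      simp only [shift_re, add_right_inj] at h1
      exact (pow_right_strictAnti₀ hpos hlt).injective (mul_right_cancel₀ ht h1)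
    · intro n
      refine ⟨hmem n, displacement_le_displacement_iff.2 ?_⟩
      have := basePt.im_pos
      rw [disp_shift, disp_shift, mul_pow]
      have h1 : ((a ^ 2) ^ n) ^ 2 ≤ 1 := pow_le_one₀ (by positivity)
        (pow_le_one₀ hpos.le hlt.le)
      gcongr
      nlinarith [sq_nonneg t]
  have h1 := main hT
  have h2 := inv_mem hT
  simp only [cls_inv, neg_zero] at h2
  have h3 := main h2
  have h4 : a ^ 2 * d ^ 2 = 1 := by rw [← mul_pow, had, one_pow]
  nlinarith

/-- The elements `[d, k * c; c, d]` form a group. -/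
theorem zpowers_form {k c d : ℝ} {h : d * d - k * c * c = 1} {g : PSL2R}
    (hg : g ∈ Subgroup.zpowers (cls d (k * c) c d h)) :
    ∃ c d h, g = cls d (k * c) c d h := by
  rw [Subgroup.zpowers_eq_closure] at hg
  induction hg using Subgroup.closure_induction with
  | mem x hx => exact ⟨c, d, h, hx⟩
  | one => exact ⟨0, 1, by ring, by rw [← cls_one]; apply cls_congr <;> ring⟩
  | mul x y _ _ hx hy =>
    obtain ⟨c, d, h, rfl⟩ := hx
    obtain ⟨c', d', h', rfl⟩ := hy
    refine ⟨c * d' + d * c', d * d' + k * c * c', ?_, ?_⟩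
    · linear_combination (d' * d' - k * c' * c') * h + h'
    · rw [cls_mul]
      apply cls_congr <;> ring
  | inv x _ hx =>
    obtain ⟨c, d, h, rfl⟩ := hx
    exact ⟨-c, d, by linarith, by rw [cls_inv]; apply cls_congr <;> ring⟩

theorem disp_cls_of_eq {k c d : ℝ} {h : d * d - k * c * c = 1} (z : ℍ) :
    disp (cls d (k * c) c d h) z =
      c ^ 2 * ((4 * k * z.im ^ 2 + (nsq z - k) ^ 2) / (4 * z.im ^ 2)) := by
  rw [disp_cls, nsq, ← mul_div_assoc]
  congr 1
  ring

/-- A nontrivial element of smallest lower left entry. -/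
theorem exists_minimal {k c d : ℝ} {h : d * d - k * c * c = 1} (hc : c ≠ 0)
    (hfin : OrbitFinite (Subgroup.zpowers (cls d (k * c) c d h))) :
    ∃ c₁ d₁ h₁, c₁ ≠ 0 ∧ cls d₁ (k * c₁) c₁ d₁ h₁ ∈ Subgroup.zpowers (cls d (k * c) c d h) ∧
      ∀ g ∈ Subgroup.zpowers (cls d (k * c) c d h), g ≠ 1 →
        ∃ c₂ d₂ h₂, g = cls d₂ (k * c₂) c₂ d₂ h₂ ∧ c₁ ^ 2 ≤ c₂ ^ 2 := by
  set K := Subgroup.zpowers (cls d (k * c) c d h) with hK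
  -- At a point that is not fixed by the group the displacement is an increasing function of `c ^
  -- 2`, so finiteness of orbits gives a minimum. The height `√(|k| + 1)` avoids the possible fixed
  -- point at height `√(-k)`.
  have hy : 0 < √(|k| + 1) := by positivity
  let z : ℍ := ⟨⟨0, √(|k| + 1)⟩, hy⟩
  have e1 : z.re = 0 := rfl
  have e2 : z.im ^ 2 = |k| + 1 := Real.sq_sqrt (by positivity)
  have e3 : nsq z = |k| + 1 := by rw [nsq, e1, e2]; ring
  have hpos : 0 < (4 * k * z.im ^ 2 + (nsq z - k) ^ 2) / (4 * z.im ^ 2) := by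
    rw [e2, e3]
    have h1 : 0 < |k| + 1 + k := by linarith [neg_abs_le k]
    have h2 : 4 * k * (|k| + 1) + (|k| + 1 - k) ^ 2 = (|k| + 1 + k) ^ 2 := by ring
    rw [h2]; positivity
  have hmem : cls d (k * c) c d h ∈ K := Subgroup.mem_zpowers _
  have hne : cls d (k * c) c d h ≠ 1 := fun h1 => hc (cls_eq_one_iff.1 h1).2.2.1
  obtain ⟨R, ⟨⟨hR, hRd⟩, hR1⟩, hmin⟩ := Set.exists_min_image
    ({g | g ∈ K ∧ dist z (g • z) ≤ displacement (cls d (k * c) c d h) z} \ {1})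
    (fun g => displacement g z) ((hfin z z _).subset Set.sdiff_subset)
    ⟨_, ⟨hmem, le_rfl⟩, hne⟩
  obtain ⟨c₁, d₁, h₁, rfl⟩ := zpowers_form hR
  refine ⟨c₁, d₁, h₁, ?_, hR, ?_⟩
  · rintro rfl
    exact hR1 (cls_eq_one_iff.2 ⟨by linarith, by ring, rfl, rfl⟩)
  · intro g hg hg1
    obtain ⟨c₂, d₂, h₂, rfl⟩ := zpowers_form hg
    refine ⟨c₂, d₂, h₂, rfl, ?_⟩
    have hle : displacement (cls d₁ (k * c₁) c₁ d₁ h₁) z ≤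
        displacement (cls d₂ (k * c₂) c₂ d₂ h₂) z := by
      rcases le_total (displacement (cls d₂ (k * c₂) c₂ d₂ h₂) z)
        (displacement (cls d (k * c) c d h) z) with h3 | h3
      · exact hmin _ ⟨⟨hg, h3⟩, hg1⟩
      · exact hRd.trans h3
    rw [displacement_le_displacement_iff, disp_cls_of_eq, disp_cls_of_eq] at hle
    exact le_of_mul_le_mul_right hle hpos

theorem shift_conj_shift (x t : ℝ) : shift x * shift t * (shift x)⁻¹ = shift t := by
  rw [shift_inv, shift_mul, shift_mul]; congr 1; ring

theorem OrbitFinite.zpowers_conj {T g : PSL2R} (hT : OrbitFinite (Subgroup.zpowers T)) :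
    OrbitFinite (Subgroup.zpowers (g * T * g⁻¹)) := by
  refine hT.conj g ?_
  rintro _ ⟨n, rfl⟩
  refine ⟨n, ?_⟩
  simp only [conj_zpow]
  group

/-- A dilation by the smallest `|c₁|` makes that entry `1`, with `m = |d₁|`. A generating rotation
need not be the one with the smallest entry, hence the weaker `1 ≤ c' ^ 2` for the given element
itself. -/
theorem exists_conj_eq_rot {k c d : ℝ} {h : d * d - k * c * c = 1} (hc : c ≠ 0)
    (hpar : ¬ IsParabolic (cls d (k * c) c d h))
    (hfin : OrbitFinite (Subgroup.zpowers (cls d (k * c) c d h))) :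
    ∃ (g : PSL2R) (e m c' d' : ℝ) (h' : d' ^ 2 - (m ^ 2 - 1) * c' ^ 2 = 1),
      0 < e ∧ 0 ≤ m ∧ m ≠ 1 ∧ 1 ≤ c' ^ 2 ∧
      g * cls d (k * c) c d h * g⁻¹ = rot m c' d' h' ∧
      (∀ t, g * shift t * g⁻¹ = shift (e * t)) ∧
      rotGen m ∈ Subgroup.zpowers (rot m c' d' h') ∧
      ∀ r ∈ Subgroup.zpowers (rot m c' d' h'), r ≠ 1 → ∃ c d h, 1 ≤ c ^ 2 ∧ r = rot m c d h := by
  obtain ⟨c₁, d₁, h₁, hc₁, hR, hmin⟩ := exists_minimal hc hfin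
  set T := cls d (k * c) c d h with hT
  have he : 0 < |c₁| := abs_pos.2 hc₁
  obtain ⟨s, hs, hs2⟩ : ∃ s, 0 < s ∧ s * s = |c₁| :=
    ⟨√|c₁|, Real.sqrt_pos.2 he, Real.mul_self_sqrt he.le⟩
  have hm2 : |d₁| ^ 2 - 1 = |c₁| ^ 2 * k := by
    rw [sq_abs, sq_abs]; linear_combination h₁
  have hform : ∀ {c d : ℝ}, d * d - k * c * c = 1 →
      d ^ 2 - (|d₁| ^ 2 - 1) * (c / |c₁|) ^ 2 = 1 := by
    intro c d h
    rw [hm2]; field_simp; linear_combination h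
  -- This is the dilation `z ↦ |c₁| * z`; it divides lower left entries by `|c₁|`.
  let g : PSL2R := cls s 0 0 (1 / s) (by field_simp; ring)
  have hconj : ∀ {c d : ℝ} (h : d * d - k * c * c = 1),
      g * cls d (k * c) c d h * g⁻¹ = rot |d₁| (c / |c₁|) d (hform h) := by
    intro c d h
    rw [cls_inv, cls_mul, cls_mul, rot]
    apply cls_congr
    · field_simp; ring
    · rw [hm2]; field_simp
      rw [← hs2]; ring
    · field_simp
      rw [← hs2]; ring
    · field_simp; ring
  have hzmem : ∀ r, r ∈ Subgroup.zpowers (g * T * g⁻¹) ↔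
      ∃ r' ∈ Subgroup.zpowers T, r = g * r' * g⁻¹ := by
    intro r
    constructor
    · rintro ⟨n, rfl⟩
      exact ⟨T ^ n, ⟨n, rfl⟩, by simp only [conj_zpow]⟩
    · rintro ⟨_, ⟨n, rfl⟩, rfl⟩
      exact ⟨n, by simp only [conj_zpow]⟩
  have hT1 : T ≠ 1 := fun h1 => hc (cls_eq_one_iff.1 h1).2.2.1
  refine ⟨g, |c₁|, |d₁|, c / |c₁|, d, hform h, he, abs_nonneg _, ?_, ?_, hconj h, ?_, ?_, ?_⟩
  · intro h1
    rw [h1] at hm2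
    have hk : k = 0 := by
      have : |c₁| ^ 2 * k = 0 := by linarith
      exact (mul_eq_zero.1 this).resolve_left (by positivity)
    refine hpar ⟨hT1, ?_⟩
    rw [hT, tr_cls, ← two_mul, abs_mul, abs_two]
    have h2 : d ^ 2 = 1 := by rw [hk] at h; linarith
    rw [abs_eq_one_of_sq h2, mul_one]
  · obtain ⟨c₂, d₂, h₂, h3, h4⟩ := hmin T (Subgroup.mem_zpowers _) hT1
    have h5 : c₂ ^ 2 = c ^ 2 := by
      rcases cls_eq_iff.1 h3 with ⟨-, -, h5, -⟩ | ⟨-, -, h5, -⟩ <;> rw [h5]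
      rw [neg_sq]
    rw [div_pow, sq_abs, ← h5, le_div_iff₀ (by positivity), one_mul]
    exact h4
  · intro t
    rw [shift, cls_inv, cls_mul, cls_mul, shift]
    apply cls_congr
    · field_simp; ring
    · rw [← hs2]; ring
    · ring
    · field_simp; ring
  · rw [← hconj h]
    have hR' := (hzmem _).2 ⟨_, hR, rfl⟩
    rw [hconj h₁] at hR'
    have key : rotGen |d₁| = rot |d₁| (c₁ / |c₁|) d₁ (hform h₁) ∨
        rotGen |d₁| = (rot |d₁| (c₁ / |c₁|) d₁ (hform h₁))⁻¹ := by
      rw [rot_inv, rotGen]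
      rcases abs_cases c₁ with ⟨h1, -⟩ | ⟨h1, -⟩ <;> rcases abs_cases d₁ with ⟨h2, -⟩ | ⟨h2, -⟩
      · left; apply rot_congr
        · rw [h1, div_self hc₁]
        · exact h2
      · right; rw [← rot_neg]; apply rot_congr
        · rw [h1, div_self hc₁]
        · linarith
      · right; apply rot_congr
        · rw [h1, div_neg, div_self hc₁, neg_neg]
        · exact h2
      · left; rw [← rot_neg]; apply rot_congr
        · rw [h1, div_neg, div_self hc₁]
        · linarith
    rcases key with key | key <;> rw [key]
    · exact hR'
    · exact inv_mem hR'
  · intro r hr hr1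
    rw [← hconj h, hzmem] at hr
    obtain ⟨r, hr, rfl⟩ := hr
    obtain ⟨c₂, d₂, h₂, rfl, hle⟩ := hmin r hr (by rintro rfl; simp at hr1)
    refine ⟨_, _, hform h₂, ?_, hconj h₂⟩
    rw [div_pow, sq_abs, le_div_iff₀ (by positivity), one_mul]
    exact hle

/-- The normal form of a pair of a nontrivial, non-parabolic and a parabolic element of a Fuchsian
group. -/
theorem exists_normalForm {Γ : Subgroup PSL2R} (hΓ : OrbitFinite Γ) {P T : PSL2R} (hP : P ∈ Γ)
    (hPpar : IsParabolic P) (hT : T ∈ Γ) (hT1 : T ≠ 1) (hTpar : ¬ IsParabolic T) :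
    ∃ (g : PSL2R) (t m c d : ℝ) (h : d ^ 2 - (m ^ 2 - 1) * c ^ 2 = 1),
      t ≠ 0 ∧ 0 ≤ m ∧ m ≠ 1 ∧ 1 ≤ c ^ 2 ∧ g * T * g⁻¹ = rot m c d h ∧ g * P * g⁻¹ = shift t ∧
      rotGen m ∈ Subgroup.zpowers (rot m c d h) ∧
      ∀ r ∈ Subgroup.zpowers (rot m c d h), r ≠ 1 → ∃ c d h, 1 ≤ c ^ 2 ∧ r = rot m c d h := by
  obtain ⟨h₀, t, ht, hPt⟩ := hPpar.exists_conj_eq_shift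
  have hfin : OrbitFinite (Γ.comap (MulAut.conj h₀⁻¹).toMonoidHom) :=
    hΓ.conj h₀ fun g hg => by simpa [Subgroup.mem_comap] using hg
  have hmem : ∀ g ∈ Γ, h₀ * g * h₀⁻¹ ∈ Γ.comap (MulAut.conj h₀⁻¹).toMonoidHom := by
    intro g hg
    simp only [Subgroup.mem_comap, MulEquiv.coe_toMonoidHom, MulAut.conj_apply]
    convert hg using 1
    group
  obtain ⟨a, b, c, d, h, hTc⟩ := exists_eq_cls (h₀ * T * h₀⁻¹)
  have hne : h₀ * T * h₀⁻¹ ≠ 1 := fun h1 => hT1 (conj_eq_one_iff.1 h1)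
  have hpar : ¬ IsParabolic (h₀ * T * h₀⁻¹) := fun h1 => hTpar ⟨hT1, tr_conj h₀ T ▸ h1.2⟩
  -- If the element fixed ∞, discreteness would make it a translation or the identity, both of which
  -- are excluded.
  have hc : c ≠ 0 := by
    rintro rfl
    have h1 := hfin.sq_eq_one ht (hPt ▸ hmem P hP) (hTc ▸ hmem T hT)
    refine hpar ⟨hne, ?_⟩
    have h2 : a = d := by
      have : a * (a - d) = 0 := by linear_combination h1 - h
      rcases mul_eq_zero.1 this with h3 | h3
      · rw [h3] at h1; norm_num at h1
      · linarith
    rw [hTc, tr_cls, ← h2, ← two_mul, abs_mul, abs_two, abs_eq_one_of_sq h1, mul_one]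
  have hT2 : ∃ (x k d' : ℝ) (h' : d' * d' - k * c * c = 1),
      shift x * (h₀ * T * h₀⁻¹) * (shift x)⁻¹ = cls d' (k * c) c d' h' := by
    have hk : ((a + d) / 2) * ((a + d) / 2) - (((a + d) / 2) ^ 2 - 1) / c ^ 2 * c * c = 1 := by
      field_simp; ring
    -- This translation equalizes the diagonal entries; both become half of the trace.
    refine ⟨(d - a) / (2 * c), (((a + d) / 2) ^ 2 - 1) / c ^ 2, (a + d) / 2, hk, ?_⟩
    rw [hTc, shift, cls_inv, cls_mul, cls_mul]
    apply cls_congr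
    · field_simp; ring
    · field_simp; linear_combination (-4) * h
    · ring
    · field_simp; ring
  obtain ⟨x, k, d', h', hT2⟩ := hT2
  have hT3 : (shift x * h₀) * T * (shift x * h₀)⁻¹ = cls d' (k * c) c d' h' := by
    rw [← hT2]; group
  have hzfin : OrbitFinite (Subgroup.zpowers T) :=
    hΓ.mono (by rw [Subgroup.zpowers_le]; exact hT)
  have hpar' : ¬ IsParabolic (cls d' (k * c) c d' h') := fun h1 =>
    hTpar ⟨hT1, by rw [← tr_conj (shift x * h₀), hT3]; exact h1.2⟩
  obtain ⟨g, e, m, c', d'', h'', he, hm, hm1, hc', hg, hsh, hgen, hform⟩ :=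
    exists_conj_eq_rot hc hpar' (hT3 ▸ hzfin.zpowers_conj)
  refine ⟨g * (shift x * h₀), e * t, m, c', d'', h'', mul_ne_zero he.ne' ht, hm, hm1, hc', ?_, ?_,
    hgen, hform⟩
  · rw [← hg, ← hT3]; group
  · rw [← hsh, ← shift_conj_shift x t, ← hPt]; group

theorem exists_shift_mem_zpowers {t r : ℝ} (ht : t ≠ 0) :
    ∃ s > r, shift s ∈ Subgroup.zpowers (shift t) := by
  obtain ⟨n, hn⟩ := exists_nat_gt (r / |t|)
  rw [div_lt_iff₀ (abs_pos.2 ht)] at hn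
  refine ⟨n * |t|, hn, ?_⟩
  rcases abs_choice t with h | h <;> rw [h]
  · exact ⟨n, by simp [shift_pow]⟩
  · refine ⟨-n, ?_⟩
    simp [shift_pow, shift_inv]

end FuchsianY

theorem corollary3p5 (Γ : Subgroup PSL2R) (hΓ : IsFuchsian Γ) (hpar : ∃ T ∈ Γ, IsParabolic T)
    (Tu : PSL2R) (hTu : Tu ∈ Γ) (hTu_ne : Tu ≠ 1) (hTu_par : ¬ IsParabolic Tu) :
    ∃ Tv ∈ Γ, ∃ (u : Boundary) (v : ℝ≥0),
      u.trace = tr Tu ∧ (Boundary.geodesic v).trace = tr Tv ∧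
        ContainsYPiece (Subgroup.closure {Tu, Tv}) u (Boundary.geodesic v)
          (Boundary.geodesic 0) := by
  obtain ⟨P, hP, hPpar⟩ := hpar
  have hfin := hΓ.orbitFinite
  obtain ⟨g, t, m, c, d, h, ht, hm, hm1, hc, hgT, hgP, hgen, hform⟩ :=
    exists_normalForm hfin hP hPpar hTu hTu_ne hTu_par
  -- A high power of the parabolic element makes the strip wider than the discs, which reach out to
  -- `|re z| = m + 1`.
  obtain ⟨s, hs, hst⟩ := exists_shift_mem_zpowers (r := 2 * (m + 1)) ht
  obtain ⟨q, rfl⟩ : ∃ q, s = 2 * q := ⟨s / 2, by ring⟩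
  have hq : m + 1 < q := by linarith
  let Γ' := Γ.comap (MulAut.conj g⁻¹).toMonoidHom
  have hmem : ∀ x, x ∈ Γ' ↔ g⁻¹ * x * g ∈ Γ := fun x => by simp [Γ', Subgroup.mem_comap]
  have hT' : rot m c d h ∈ Γ' := by
    rw [hmem, ← hgT]; convert hTu using 1; group
  have hP' : shift (2 * q) ∈ Γ' := by
    have : shift t ∈ Γ' := by rw [hmem, ← hgP]; convert hP using 1; group
    exact (Subgroup.zpowers_le.2 this) hst
  set K := Subgroup.zpowers (rot m c d h) with hK
  set G := K ⊔ Subgroup.zpowers (shift (2 * q)) with hG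
  have hGle : G ≤ Γ' := sup_le (Subgroup.zpowers_le.2 hT') (Subgroup.zpowers_le.2 hP')
  have S : Setup m q K G :=
    ⟨hm, hm1, hq, hform, hgen, rfl, hfin.conj g fun x hx => (hmem x).1 (hGle hx)⟩
  obtain ⟨u, hutr, hu⟩ := exists_hasType_rot S.m_sq hc h
  obtain ⟨v, hvtr, hv⟩ := exists_hasType_genV hq
  -- The translation is recovered as `genV m q * rotGen m`, and `rotGen m` is a power of the given
  -- element.
  have hcl : Subgroup.closure {rot m c d h, genV m q} = G := by
    apply le_antisymm
    · rw [Subgroup.closure_le]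
      rintro x (rfl | rfl)
      · exact S.K_le (Subgroup.mem_zpowers _)
      · exact S.genV_mem
    · have hK' : K ≤ Subgroup.closure {rot m c d h, genV m q} :=
        Subgroup.zpowers_le.2 (Subgroup.subset_closure (.inl rfl))
      refine sup_le hK' (Subgroup.zpowers_le.2 ?_)
      have : shift (2 * q) = genV m q * rotGen m := by rw [genV]; group
      rw [this]
      exact mul_mem (Subgroup.subset_closure (.inr rfl)) (hK' hgen)
  refine ⟨g⁻¹ * genV m q * g, (hmem _).1 (hGle S.genV_mem), u, v, ?_, ?_, ?_⟩
  · rw [hutr, ← hgT, tr_conj]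
  · rw [hvtr]
    simpa using (tr_conj g⁻¹ (genV m q)).symm
  · refine ContainsYPiece.of_conj (h := g) (fun x => ?_) (S.containsYPiece hc h rfl hu hv)
    have himg : (MulAut.conj g).toMonoidHom '' {Tu, g⁻¹ * genV m q * g} =
        {rot m c d h, genV m q} := by
      rw [Set.image_pair]
      simp only [MulEquiv.coe_toMonoidHom, MulAut.conj_apply, hgT]
      congr 2
      group
    rw [← hcl, ← himg, ← MonoidHom.map_closure]
    exact Subgroup.mem_map_iff_mem (MulAut.conj g).injective
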